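/- **Conventions.** A locally topologically ringed space is a topological space with a sheaf of topological rings whose stalks are local rings; morphisms are continuous on sections and local on stalks. A scheme is such a space via the pseudo-discrete topology on its structure sheaf (sections over quasi-compact opens are discrete). For a ring $A$ that is complete and separated for the $I$-adic topology, with $I$ finitely generated, $\operatorname{Spf} A$ is the space $V(I)$ with the sheaf $\varprojlim_n \mathcal{O}_{\operatorname{Spec}(A/I^n)}$ of topological rings. Such an $A$ is *of principal ideal type* if it has a principal ideal of definition $(\varpi)$ with $\varpi$ a nonzerodivisor. A locally topologically ringed space $\mathfrak{X}$ is a *formal scheme of principal ideal type* if it is covered by open subspaces of the form $\operatorname{Spf} A$ as above, and for every open subspace of this form the ring $A$ is of principal ideal type. The *reduced special fibre* $\iota\colon \mathfrak{X}_{\mathrm{rs}} \to \mathfrak{X}$ is the reduced scheme with underlying space $|\mathfrak{X}|$ which over an affine open $\operatorname{Spf} A$ is $\operatorname{Spec}\,(A/I)_{\mathrm{red}}$. A morphism of adic formal schemes is *affine* if the inverse image of every affine open formal subscheme is affine. **Proposition.** Let $\mathfrak{X}$ be a quasi-compact quasi-separated formal scheme of principal ideal type, $\iota\colon \mathfrak{X}_{\mathrm{rs}}\to\mathfrak{X}$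 its reduced special fibre, and $j\colon \mathfrak{X}_{\mathrm{rs}} \hookrightarrow Y$ an affine, schematically dense open immersion of schemes such that $Y\setminus j(\mathfrak{X}_{\mathrm{rs}})$ is the support of a Cartier divisor on $Y$. Identify $|\mathfrak{X}|$ with $|\mathfrak{X}_{\mathrm{rs}}|$ along $\iota$, let $$\mathcal{O}_{\mathfrak{X}_Y} := j_*\mathcal{O}_{\mathfrak{X}} \times_{j_*\mathcal{O}_{\mathfrak{X}_{\mathrm{rs}}}} \mathcal{O}_Y ,$$ a sheaf of topological rings on $|Y|$ (with the subspace topology of the product on sections), and let $\mathfrak{X}_Y := (|Y|, \mathcal{O}_{\mathfrak{X}_Y})$. This is a locally topologically ringed space, with natural morphisms $\tilde{\jmath}\colon \mathfrak{X}\to\mathfrak{X}_Y$ and $Y \to \mathfrak{X}_Y$ given by the two projections, and: 1. $\mathfrak{X}_Y$ is a formal scheme of principal ideal type, and $Y\to \mathfrak{X}_Y$ is its reduced special fibre; 2. $\tilde{\jmath}\colon \mathfrak{X}\to \mathfrak{X}_Y$ is an affine open immersion; 3. the commutative square $$\begin{array}{ccc} \mathfrak{X} & \longrightarrow & \mathfrak{X}_Y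 \\ \uparrow & & \uparrow \\ \mathfrak{X}_{\mathrm{rs}} & \longrightarrow & Y \end{array}$$ is a pushout in the category of locally topologically ringed spaces. -/

import Mathlib

open CategoryTheory AlgebraicGeometry TopologicalSpace Opposite

universe u

noncomputable section

/-! ### Locally topologically ringed spaces -/

/-- A locally topologically ringed space: a topological space with a sheaf of topological rings
all of whose stalks are local rings.

For a presheaf of topological rings whose underlying presheaf of rings is a sheaf, being a sheaf of
topological rings means that for every open cover `W = ⋃ U i` the topology of `𝒪(W)` is the
coarsest one for which all restrictions `𝒪(W) → 𝒪(U i)` are continuous.  (The cover of `W` by `W`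
and one smaller open set shows that all restriction maps are continuous.) -/
structure TopLRS extends LocallyRingedSpace.{u} where
  /-- the topology on the ring of sections over an open set -/
  top : ∀ U : Opens toLocallyRingedSpace.toTopCat,
    TopologicalSpace (toLocallyRingedSpace.presheaf.obj (op U))
  isTopologicalRing : ∀ U : Opens toLocallyRingedSpace.toTopCat,
    @IsTopologicalRing (toLocallyRingedSpace.presheaf.obj (op U)) (top U) _
  top_eq_iInf : ∀ {κ : Type u} (W : Opens toLocallyRingedSpace.toTopCat)
    (U : κ → Opens toLocallyRingedSpace.toTopCat) (hU : ∀ i, U i ≤ W), W ≤ ⨆ i, U i →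
    top W = ⨅ i, (top (U i)).induced
      (toLocallyRingedSpace.presheaf.map (homOfLE (hU i)).op).hom

namespace TopLRS

/-- The ring of sections over an open set. -/
abbrev sec (X : TopLRS.{u}) (U : Opens X.toTopCat) : Type u :=
  X.presheaf.obj (op U)

/-- Morphisms of locally topologically ringed spaces: morphisms of locally ringed spaces (local on
stalks) whose maps on sections are continuous. -/
@[ext]
structure Hom (X Y : TopLRS.{u}) where
  hom : X.toLocallyRingedSpace ⟶ Y.toLocallyRingedSpace
  continuous_app : ∀ U : Opens Y.toTopCat,
    @Continuous _ _ (Y.top U) (X.top ((Opens.map hom.base).obj U)) (hom.c.app (op U)).hom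

instance : Category TopLRS.{u} where
  Hom := Hom
  id X := ⟨𝟙 _, fun U => by
    let _ := X.top U
    exact continuous_id⟩
  comp {X Y Z} f g := ⟨f.hom ≫ g.hom, fun U => by
    let _ := Z.top U
    let _ := Y.top ((Opens.map g.hom.base).obj U)
    let _ := X.top ((Opens.map f.hom.base).obj ((Opens.map g.hom.base).obj U))
    exact (f.continuous_app ((Opens.map g.hom.base).obj U)).comp (g.continuous_app U)⟩

/-- The underlying map of topological spaces. -/
abbrev Hom.base {X Y : TopLRS.{u}} (f : X ⟶ Y) : X.toTopCat ⟶ Y.toTopCat :=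
  (Hom.hom f).base

end TopLRS

/-! ### Initial ring topologies -/

theorem isTopologicalRing_induced {R S : Type*} [CommRing R] [CommRing S] (f : R →+* S)
    (t : TopologicalSpace S) (ht : @IsTopologicalRing S t _) :
    @IsTopologicalRing R (t.induced f) _ := by
  let _ := t.induced f
  have h1 : ContinuousAdd R := continuousAdd_induced f
  have h2 : ContinuousMul R := continuousMul_induced f
  have h3 : ContinuousNeg R := ⟨by
    rw [continuous_induced_rng]
    have : (f ∘ fun a : R => -a) = fun a => - f a := by ext; simp
    rw [this]
    exact continuous_neg.comp continuous_induced_dom⟩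
  exact { }

theorem isTopologicalRing_iInf {R : Type*} [CommRing R] {κ : Sort*} (t : κ → TopologicalSpace R)
    (ht : ∀ i, @IsTopologicalRing R (t i) _) : @IsTopologicalRing R (⨅ i, t i) _ := by
  let _ := ⨅ i, t i
  have h1 : ContinuousAdd R := continuousAdd_iInf fun i => (ht i).toContinuousAdd
  have h2 : ContinuousMul R := continuousMul_iInf fun i => (ht i).toContinuousMul
  have h3 : ContinuousNeg R := continuousNeg_iInf fun i => (ht i).toContinuousNeg
  exact { }

/-! ### Schemes as locally topologically ringed spaces -/

/-- The pseudo-discrete topology on the sections of the structure sheaf over an open set `W`: the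
coarsest topology for which the restrictions to all quasi-compact open subsets of `W`, equipped with
the discrete topology, are continuous.  It is discrete if `W` is quasi-compact. -/
def pseudoDiscrete (X : LocallyRingedSpace.{u}) (W : Opens X.toTopCat) :
    TopologicalSpace (X.presheaf.obj (op W)) :=
  ⨅ V : {V : Opens X.toTopCat // V ≤ W ∧ IsCompact (V : Set X.toTopCat)},
    (⊥ : TopologicalSpace (X.presheaf.obj (op V.1))).induced
      (X.presheaf.map (homOfLE V.2.1).op).hom

theorem isTopologicalRing_pseudoDiscrete (X : LocallyRingedSpace.{u}) (W : Opens X.toTopCat) :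
    @IsTopologicalRing _ (pseudoDiscrete X W) _ := by
  refine isTopologicalRing_iInf _ fun V => isTopologicalRing_induced _ _ ?_
  let _ : TopologicalSpace (X.presheaf.obj (op V.1)) := ⊥
  have : DiscreteTopology (X.presheaf.obj (op V.1)) := ⟨rfl⟩
  infer_instance

theorem presheaf_map_map {X : LocallyRingedSpace.{u}} {U V W : Opens X.toTopCat}
    (h : U ≤ V) (h' : V ≤ W) (s : X.presheaf.obj (op W)) :
    X.presheaf.map (homOfLE h).op (X.presheaf.map (homOfLE h').op s) =
      X.presheaf.map (homOfLE (h.trans h')).op s := by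
  rw [← CommRingCat.comp_apply, ← X.presheaf.map_comp]
  rfl

theorem pseudoDiscrete_le (X : LocallyRingedSpace.{u}) {V W : Opens X.toTopCat}
    (h : V ≤ W) :
    pseudoDiscrete X W ≤ (pseudoDiscrete X V).induced (X.presheaf.map (homOfLE h).op).hom := by
  rw [pseudoDiscrete, pseudoDiscrete, induced_iInf]
  refine le_iInf fun K => ?_
  rw [induced_compose]
  refine (iInf_le _ ⟨K.1, K.2.1.trans h, K.2.2⟩).trans (le_of_eq ?_)
  congr 1
  funext s
  exact (presheaf_map_map K.2.1 h s).symm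

theorem pseudoDiscrete_eq_iInf (X : Scheme.{u}) {κ : Type u} (W : Opens X.toTopCat)
    (U : κ → Opens X.toTopCat) (hU : ∀ i, U i ≤ W) (hW : W ≤ ⨆ i, U i) :
    pseudoDiscrete X.toLocallyRingedSpace W =
      ⨅ i, (pseudoDiscrete X.toLocallyRingedSpace (U i)).induced
        (X.toLocallyRingedSpace.presheaf.map (homOfLE (hU i)).op).hom := by
  refine le_antisymm (le_iInf fun i => pseudoDiscrete_le _ (hU i)) (le_iInf fun V => ?_)
  let _ : TopologicalSpace (X.toLocallyRingedSpace.presheaf.obj (op V.1)) := ⊥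
  let _ : TopologicalSpace (X.toLocallyRingedSpace.presheaf.obj (op W)) :=
    ⨅ i, (pseudoDiscrete X.toLocallyRingedSpace (U i)).induced
      (X.toLocallyRingedSpace.presheaf.map (homOfLE (hU i)).op).hom
  refine continuous_iff_le_induced.1 ?_
  have : DiscreteTopology (X.toLocallyRingedSpace.presheaf.obj (op V.1)) := ⟨rfl⟩
  rw [continuous_discrete_rng]
  intro b
  have hx : ∀ x : V.1, ∃ (i : κ) (K : Opens X.toTopCat), IsCompact (K : Set X.toTopCat) ∧
      x.1 ∈ K ∧ K ≤ V.1 ∧ K ≤ U i := by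
    intro x
    obtain ⟨i, hi⟩ := Opens.mem_iSup.1 (hW (V.2.1 x.2))
    obtain ⟨K, hK, hxK, hKU⟩ := X.isBasis_affineOpens.exists_subset_of_mem_open
      (show x.1 ∈ ((V.1 ⊓ U i : Opens X.toTopCat) : Set X.toTopCat) from ⟨x.2, hi⟩) (V.1 ⊓ U i).2
    obtain ⟨K, hK, rfl⟩ := hK
    exact ⟨i, K, IsAffineOpen.isCompact hK, hxK, fun y hy => (hKU hy).1, fun y hy => (hKU hy).2⟩
  choose i K hKc hxK hKV hKU using hx
  obtain ⟨t, ht⟩ := V.2.2.elim_finite_subcover (fun x : V.1 => (K x : Set X.toTopCat))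
    (fun x => (K x).2) (fun x hx => Set.mem_iUnion.2 ⟨⟨x, hx⟩, hxK ⟨x, hx⟩⟩)
  let r (x : V.1) (s : X.toLocallyRingedSpace.presheaf.obj (op W)) :=
    X.toLocallyRingedSpace.presheaf.map (homOfLE ((hKV x).trans V.2.1)).op s
  let c (x : V.1) := X.toLocallyRingedSpace.presheaf.map (homOfLE (hKV x)).op b
  have heq : (X.toLocallyRingedSpace.presheaf.map (homOfLE V.2.1).op).hom ⁻¹' {b} =
      ⋂ x ∈ t, r x ⁻¹' {c x} := by
    ext s
    simp only [Set.mem_preimage, Set.mem_singleton_iff, Set.mem_iInter]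
    constructor
    · rintro hs x -
      change _ = X.toLocallyRingedSpace.presheaf.map (homOfLE (hKV x)).op b
      rw [← hs]
      exact (presheaf_map_map (hKV x) V.2.1 s).symm
    · intro hs
      refine TopCat.Sheaf.eq_of_locally_eq' X.toLocallyRingedSpace.sheaf
        (fun x : t => K x.1) V.1 (fun x => homOfLE (hKV x.1)) ?_ _ _ ?_
      · intro y hy
        obtain ⟨x, hxt, hyx⟩ := Set.mem_iUnion₂.1 (ht hy)
        exact Opens.mem_iSup.2 ⟨⟨x, hxt⟩, hyx⟩
      · intro x
        exact (presheaf_map_map (hKV x.1) V.2.1 s).trans (hs x.1 x.2)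
  rw [heq]
  refine isOpen_biInter_finset fun x _ => ?_
  have hle := (iInf_le (fun i => (pseudoDiscrete X.toLocallyRingedSpace (U i)).induced
    (X.toLocallyRingedSpace.presheaf.map (homOfLE (hU i)).op).hom) (i x)).trans
    (induced_mono (iInf_le _ ⟨K x, hKU x, hKc x⟩))
  refine IsOpen.mono ?_ hle
  rw [induced_compose]
  let _ : TopologicalSpace (X.toLocallyRingedSpace.presheaf.obj (op (K x))) := ⊥
  refine isOpen_induced_iff.2 ⟨{c x}, trivial, ?_⟩
  ext s
  simp only [Set.mem_preimage, Set.mem_singleton_iff]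
  exact Eq.congr_left (presheaf_map_map (hKU x) (hU (i x)) s)

/-- A scheme, with its pseudo-discrete structure sheaf. -/
def schemeTop (X : Scheme.{u}) : TopLRS.{u} where
  toLocallyRingedSpace := X.toLocallyRingedSpace
  top := pseudoDiscrete X.toLocallyRingedSpace
  isTopologicalRing := isTopologicalRing_pseudoDiscrete X.toLocallyRingedSpace
  top_eq_iInf := pseudoDiscrete_eq_iInf X

theorem continuous_pseudoDiscrete {X Y : Scheme.{u}} (f : X ⟶ Y) (U : Opens Y.toTopCat) :
    @Continuous _ _ (pseudoDiscrete Y.toLocallyRingedSpace U)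
      (pseudoDiscrete X.toLocallyRingedSpace ((Opens.map f.toLRSHom.base).obj U))
      (f.toLRSHom.c.app (op U)).hom := by
  let _ := pseudoDiscrete Y.toLocallyRingedSpace U
  refine continuous_iInf_rng.2 fun V => continuous_induced_rng.2 ?_
  obtain ⟨K, hKc, hKo, hVK, hKU⟩ := PrespectralSpace.exists_isCompact_and_isOpen_between
    (V.2.2.image f.toLRSHom.base.hom.continuous) U.2
    (Set.image_subset_iff.2 fun x hx => V.2.1 hx)
  let K' : Opens Y.toTopCat := ⟨K, hKo⟩
  have hVK' : V.1 ≤ (Opens.map f.toLRSHom.base).obj K' := fun x hx => hVK ⟨x, hx, rfl⟩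
  have hKU' : K' ≤ U := hKU
  have h1 : @Continuous _ _ (pseudoDiscrete Y.toLocallyRingedSpace U) ⊥
      (Y.toLocallyRingedSpace.presheaf.map (homOfLE hKU').op).hom :=
    continuous_iff_le_induced.2 (iInf_le
      (fun V : {V : Opens Y.toTopCat // V ≤ U ∧ IsCompact (V : Set Y.toTopCat)} =>
        (⊥ : TopologicalSpace (Y.toLocallyRingedSpace.presheaf.obj (op V.1))).induced
          (Y.toLocallyRingedSpace.presheaf.map (homOfLE V.2.1).op).hom) ⟨K', hKU, hKc⟩)
  have h2 : ∀ s, X.toLocallyRingedSpace.presheaf.map (homOfLE V.2.1).op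
      (f.toLRSHom.c.app (op U) s) = X.toLocallyRingedSpace.presheaf.map (homOfLE hVK').op
        (f.toLRSHom.c.app (op K') (Y.toLocallyRingedSpace.presheaf.map (homOfLE hKU').op s)) := by
    intro s
    have h := congr($(f.toLRSHom.c.naturality (homOfLE hKU').op) s)
    refine Eq.trans ?_ (congrArg (X.toLocallyRingedSpace.presheaf.map (homOfLE hVK').op) h).symm
    exact (presheaf_map_map hVK' (fun x hx => hKU' hx) (f.toLRSHom.c.app (op U) s)).symm
  let _ : TopologicalSpace (Y.presheaf.obj (op K')) := ⊥
  have : DiscreteTopology (Y.presheaf.obj (op K')) := ⟨rfl⟩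
  let _ : TopologicalSpace (X.presheaf.obj (op V.1)) := ⊥
  have h3 := (continuous_of_discreteTopology (f := fun t : Y.presheaf.obj (op K') =>
    (X.toLocallyRingedSpace.presheaf.map (homOfLE hVK').op (f.toLRSHom.c.app (op K') t)))).comp h1
  convert h3 using 1
  exact funext h2

/-- A morphism of schemes as a morphism of locally topologically ringed spaces. -/
def schemeTopMap {X Y : Scheme.{u}} (f : X ⟶ Y) : schemeTop X ⟶ schemeTop Y :=
  TopLRS.Hom.mk f.toLRSHom (continuous_pseudoDiscrete f)

/-! ### Formal spectra -/

section Spf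

variable (A : Type u) [CommRing A] (I : Ideal A)

/-- The infinitesimal neighbourhood `Spec (A / I ^ (n + 1))`. -/
abbrev thickening (n : ℕ) : Scheme.{u} :=
  Spec (CommRingCat.of (A ⧸ I ^ (n + 1)))

/-- The sequence `Spec (A / I) → Spec (A / I ^ 2) → ⋯`, in locally ringed spaces. -/
def thickeningDiagram : ℕ ⥤ LocallyRingedSpace.{u} where
  obj n := (thickening A I n).toLocallyRingedSpace
  map {m n} h := (Spec.map (CommRingCat.ofHom (Ideal.Quotient.factor
    (Ideal.pow_le_pow_right (Nat.add_le_add_right (leOfHom h) 1) :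
      I ^ (n + 1) ≤ I ^ (m + 1))))).toLRSHom
  map_id n := by
    have h : CommRingCat.ofHom (Ideal.Quotient.factor (le_refl (I ^ (n + 1)))) = 𝟙 _ := by
      ext x
      rfl
    rw [h, Spec.map_id]
    rfl
  map_comp {l m n} f g := by
    rw [← Scheme.Hom.comp_toLRSHom, ← Spec.map_comp]
    congr 2
    ext x
    rfl

instance : Limits.HasColimitsOfShape ℕ LocallyRingedSpace.{u} := 
  (Limits.hasColimitsOfSizeShrink.{0, 0, u, u} LocallyRingedSpace.{u}).1 ℕ

/-- The underlying locally ringed space of `Spf A`, where `A` carries the `I`-adic topology: the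
colimit of the schemes `Spec (A / I ^ (n + 1))`.  As all of them have the same underlying space, its
underlying space is `V(I)`, and its structure sheaf is the limit of the sheaves
`𝒪_{Spec (A / I ^ (n + 1))}`. -/
def spfLRS : LocallyRingedSpace.{u} :=
  Limits.colimit (thickeningDiagram A I)

/-- The inclusion of `Spec (A / I ^ (n + 1))` into `Spf A`. -/
def spfι (n : ℕ) : (thickening A I n).toLocallyRingedSpace ⟶ spfLRS A I :=
  Limits.colimit.ι (thickeningDiagram A I) n

/-- The formal spectrum `Spf A` of the ring `A` with its `I`-adic topology.  The sections over an
open set carry the topology of the limit of the pseudo-discrete sheaves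
`𝒪_{Spec (A / I ^ (n + 1))}`. -/
def Spf : TopLRS.{u} where
  toLocallyRingedSpace := spfLRS A I
  top U := ⨅ n : ℕ, (pseudoDiscrete (thickening A I n).toLocallyRingedSpace
    ((Opens.map (spfι A I n).base).obj U)).induced ((spfι A I n).c.app (op U)).hom
  isTopologicalRing U := isTopologicalRing_iInf _ fun n => isTopologicalRing_induced _ _
    (isTopologicalRing_pseudoDiscrete (thickening A I n).toLocallyRingedSpace
      ((Opens.map (spfι A I n).base).obj U))
  top_eq_iInf {κ} W U hU hW := by
    simp_rw [induced_iInf, induced_compose]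
    rw [iInf_comm]
    refine iInf_congr fun n => ?_
    rw [pseudoDiscrete_eq_iInf (thickening A I n) ((Opens.map (spfι A I n).base).obj W)
      (fun i => (Opens.map (spfι A I n).base).obj (U i)) (fun i x hx => hU i hx) (by
        intro x hx
        obtain ⟨i, hi⟩ := Opens.mem_iSup.1 (hW hx)
        exact Opens.mem_iSup.2 ⟨i, hi⟩), induced_iInf]
    refine iInf_congr fun i => ?_
    rw [induced_compose]
    congr 1
    funext s
    exact (congr($((spfι A I n).c.naturality (homOfLE (hU i)).op) s)).symm

/-- The inclusion of `Spec (A / I ^ (n + 1))` into `Spf A`. -/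
def spfInc (n : ℕ) : schemeTop (thickening A I n) ⟶ Spf A I :=
  TopLRS.Hom.mk (spfι A I n) fun _ => continuous_iff_le_induced.2 (iInf_le _ n)

/-- The closed immersion `Spec ((A / I)_red) → Spf A`; note that `(A / I)_red = A / √I`. -/
def spfRed : schemeTop (Spec (CommRingCat.of (A ⧸ I.radical))) ⟶ Spf A I :=
  schemeTopMap (Spec.map (CommRingCat.ofHom (Ideal.Quotient.factor
    ((Ideal.pow_le_self (Nat.succ_ne_zero 0)).trans Ideal.le_radical :
      I ^ (0 + 1) ≤ I.radical)))) ≫ spfInc A I 0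

end Spf

/-! ### Gluing along a homeomorphic closed subspace -/

namespace Glue

variable {X Y Z : TopLRS.{u}} (i : Z ⟶ X) (j : Z ⟶ Y) (hi : IsHomeomorph (TopLRS.Hom.base i))

/-- The continuous map `|X| → |Y|` given by `j`, if `|X|` and `|Z|` are identified along `i`. -/
def q : X.toTopCat ⟶ Y.toTopCat :=
  TopCat.ofHom ⟨fun x => TopLRS.Hom.base j (hi.homeomorph.symm x),
    (TopLRS.Hom.base j).hom.continuous.comp hi.homeomorph.symm.continuous⟩

theorem q_apply (z : Z.toTopCat) :
    q i j hi (TopLRS.Hom.base i z) = TopLRS.Hom.base j z :=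
  congrArg (TopLRS.Hom.base j) (hi.homeomorph.symm_apply_apply z)

/-- The open set `q⁻¹ U` of `X`.  It corresponds to `j⁻¹ U` under the homeomorphism `i`, so
`𝒪_X (q⁻¹ U)` are the sections over `U` of the direct image `j_* 𝒪_X` on `Y`. -/
abbrev pre (U : Opens Y.toTopCat) : Opens X.toTopCat :=
  (Opens.map (q i j hi)).obj U

theorem pre_le (U : Opens Y.toTopCat) :
    (Opens.map (TopLRS.Hom.base j)).obj U ≤
      (Opens.map (TopLRS.Hom.base i)).obj (pre i j hi U) := by
  intro z hz
  change q i j hi (TopLRS.Hom.base i z) ∈ U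
  rw [q_apply]
  exact hz

/-- The map `(j_* 𝒪_X) (U) → (j_* 𝒪_Z) (U)`. -/
def toZ (U : Opens Y.toTopCat) :
    X.sec (pre i j hi U) →+* Z.sec ((Opens.map (TopLRS.Hom.base j)).obj U) :=
  (Z.presheaf.map (homOfLE (pre_le i j hi U)).op).hom.comp
    ((TopLRS.Hom.hom i).c.app (op (pre i j hi U))).hom

/-- The map `𝒪_Y (U) → (j_* 𝒪_Z) (U)`. -/
def ofY (U : Opens Y.toTopCat) :
    Y.sec U →+* Z.sec ((Opens.map (TopLRS.Hom.base j)).obj U) :=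
  ((TopLRS.Hom.hom j).c.app (op U)).hom

/-- The sections over `U` of the fibre product `j_* 𝒪_X ×_{j_* 𝒪_Z} 𝒪_Y`. -/
def sections (U : Opens Y.toTopCat) : Subring (X.sec (pre i j hi U) × Y.sec U) :=
  RingHom.eqLocus ((toZ i j hi U).comp (RingHom.fst _ _)) ((ofY j U).comp (RingHom.snd _ _))

theorem toZ_res {U V : Opens Y.toTopCat} (h : V ≤ U) (a : X.sec (pre i j hi U)) :
    toZ i j hi V (X.presheaf.map (homOfLE (show pre i j hi V ≤ pre i j hi U from
      fun _ hx => h hx)).op a) =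
    Z.presheaf.map (homOfLE (show (Opens.map (TopLRS.Hom.base j)).obj V ≤
      (Opens.map (TopLRS.Hom.base j)).obj U from fun _ hx => h hx)).op (toZ i j hi U a) := by
  have h1 := congr($((TopLRS.Hom.hom i).c.naturality (homOfLE (show pre i j hi V ≤ pre i j hi U from
      fun _ hx => h hx)).op) a)
  refine (congrArg (Z.presheaf.map (homOfLE (pre_le i j hi V)).op) h1).trans ?_
  refine (presheaf_map_map (pre_le i j hi V) (fun _ hx => h hx)
    ((TopLRS.Hom.hom i).c.app (op (pre i j hi U)) a)).trans ?_
  exact (presheaf_map_map (X := Z.toLocallyRingedSpace) _ (pre_le i j hi U) _).symm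

theorem ofY_res {U V : Opens Y.toTopCat} (h : V ≤ U) (b : Y.sec U) :
    ofY j V (Y.presheaf.map (homOfLE h).op b) =
    Z.presheaf.map (homOfLE (show (Opens.map (TopLRS.Hom.base j)).obj V ≤
      (Opens.map (TopLRS.Hom.base j)).obj U from fun _ hx => h hx)).op (ofY j U b) :=
  congr($((TopLRS.Hom.hom j).c.naturality (homOfLE h).op) b)

/-- The restriction maps of the fibre product. -/
def res {U V : Opens Y.toTopCat} (h : V ≤ U) : sections i j hi U →+* sections i j hi V :=
  (RingHom.prodMap
    (X.presheaf.map (homOfLE (show pre i j hi V ≤ pre i j hi U from fun _ hx => h hx)).op).hom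
    (Y.presheaf.map (homOfLE h).op).hom).restrict _ _ fun s hs => by
      refine (toZ_res i j hi h s.1).trans (Eq.trans ?_ (ofY_res j h s.2).symm)
      exact congrArg _ hs

/-- The presheaf of rings `j_* 𝒪_X ×_{j_* 𝒪_Z} 𝒪_Y` on `|Y|`. -/
def presheaf : TopCat.Presheaf CommRingCat.{u} Y.toTopCat where
  obj U := CommRingCat.of (sections i j hi U.unop)
  map f := CommRingCat.ofHom (res i j hi (leOfHom f.unop))
  map_id U := by
    ext s
    · exact congr($(X.presheaf.map_id _) s.1.1)
    · exact congr($(Y.presheaf.map_id _) s.1.2)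
  map_comp f g := by
    ext s
    · exact (presheaf_map_map (X := X.toLocallyRingedSpace) _ _ s.1.1).symm
    · exact (presheaf_map_map (X := Y.toLocallyRingedSpace) _ _ s.1.2).symm

theorem isSheaf : (presheaf i j hi).IsSheaf := by
  refine (TopCat.Presheaf.isSheaf_iff_isSheafUniqueGluing _).2 ?_
  intro κ U s hs
  have hUi (k : κ) : U k ≤ iSup U := le_iSup U k
  have hcov : pre i j hi (iSup U) ≤ ⨆ k, pre i j hi (U k) := by
    intro x hx
    obtain ⟨k, hk⟩ := Opens.mem_iSup.1 hx
    exact Opens.mem_iSup.2 ⟨k, hk⟩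
  have hcovZ : (Opens.map (TopLRS.Hom.base j)).obj (iSup U) ≤
      ⨆ k, (Opens.map (TopLRS.Hom.base j)).obj (U k) := by
    intro x hx
    obtain ⟨k, hk⟩ := Opens.mem_iSup.1 hx
    exact Opens.mem_iSup.2 ⟨k, hk⟩
  obtain ⟨a, ha, ha'⟩ := X.sheaf.existsUnique_gluing' (fun k => pre i j hi (U k))
    (pre i j hi (iSup U)) (fun k => homOfLE fun _ hx => hUi k hx) hcov (fun k => (s k).1.1)
    (fun k l => congrArg (fun t => t.1.1) (hs k l))
  obtain ⟨b, hb, hb'⟩ := Y.sheaf.existsUnique_gluing' U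
    (iSup U) (fun k => homOfLE (hUi k)) le_rfl (fun k => (s k).1.2)
    (fun k l => congrArg (fun t => t.1.2) (hs k l))
  have hab : (a, b) ∈ sections i j hi (iSup U) := by
    refine Z.sheaf.eq_of_locally_eq' (fun k => (Opens.map (TopLRS.Hom.base j)).obj (U k)) _
      (fun k => homOfLE fun _ hx => hUi k hx) hcovZ _ _ fun k => ?_
    refine (toZ_res i j hi (hUi k) a).symm.trans (Eq.trans ?_ (ofY_res j (hUi k) b))
    refine (congrArg (toZ i j hi (U k)) (ha k)).trans (Eq.trans ?_
      (congrArg (ofY j (U k)) (hb k)).symm)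
    exact (s k).2
  refine ⟨⟨(a, b), hab⟩, fun k => Subtype.ext (Prod.ext (ha k) (hb k)), ?_⟩
  intro t ht
  refine Subtype.ext (Prod.ext ?_ ?_)
  · exact ha' _ fun k => congrArg (fun t => t.1.1) (ht k)
  · exact hb' _ fun k => congrArg (fun t => t.1.2) (ht k)

theorem isUnit_germ_toZ {U : Opens Y.toTopCat} (a : X.sec (pre i j hi U)) (z : Z.toTopCat)
    (hz : TopLRS.Hom.base j z ∈ U) :
    IsUnit (Z.presheaf.germ ((Opens.map (TopLRS.Hom.base j)).obj U) z hz (toZ i j hi U a)) ↔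
      IsUnit (X.presheaf.germ (pre i j hi U) (TopLRS.Hom.base i z) (pre_le i j hi U hz) a) := by
  have h1 : Z.presheaf.germ ((Opens.map (TopLRS.Hom.base j)).obj U) z hz (toZ i j hi U a) =
      Z.presheaf.germ _ z (pre_le i j hi U hz)
        ((TopLRS.Hom.hom i).c.app (op (pre i j hi U)) a) :=
    TopCat.Presheaf.germ_res_apply Z.presheaf (homOfLE (pre_le i j hi U)) z hz _
  have h2 := PresheafedSpace.stalkMap_germ_apply (TopLRS.Hom.hom i).toHom (pre i j hi U) z
    (pre_le i j hi U hz) a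
  rw [h1]
  refine (iff_of_eq (congrArg IsUnit h2.symm)).trans ?_
  exact isUnit_map_iff ((TopLRS.Hom.hom i).toHom.stalkMap z).hom _

theorem isUnit_germ_ofY {U : Opens Y.toTopCat} (b : Y.sec U) (z : Z.toTopCat)
    (hz : TopLRS.Hom.base j z ∈ U) :
    IsUnit (Z.presheaf.germ ((Opens.map (TopLRS.Hom.base j)).obj U) z hz (ofY j U b)) ↔
      IsUnit (Y.presheaf.germ U (TopLRS.Hom.base j z) hz b) := by
  have h2 := PresheafedSpace.stalkMap_germ_apply (TopLRS.Hom.hom j).toHom U z hz b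
  refine (iff_of_eq (congrArg IsUnit h2.symm)).trans ?_
  exact isUnit_map_iff ((TopLRS.Hom.hom j).toHom.stalkMap z).hom _

theorem isUnit_of_isUnit_snd {U : Opens Y.toTopCat} (s : sections i j hi U)
    (hs : IsUnit s.1.2) : IsUnit s := by
  have h1 : IsUnit s.1.1 := by
    refine X.toRingedSpace.isUnit_of_isUnit_germ (pre i j hi U) s.1.1 fun x hx => ?_
    obtain ⟨z, rfl⟩ := hi.surjective x
    have hz : TopLRS.Hom.base j z ∈ U := by
      rw [← q_apply i j hi]
      exact hx
    refine (isUnit_germ_toZ i j hi s.1.1 z hz).1 ?_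
    have := (hs.map (ofY j U)).map (Z.presheaf.germ _ z hz).hom
    rw [← show toZ i j hi U s.1.1 = ofY j U s.1.2 from s.2] at this
    exact this
  obtain ⟨a, ha⟩ := h1
  obtain ⟨b, hb⟩ := hs
  have hab : Units.map (toZ i j hi U).toMonoidHom a = Units.map (ofY j U).toMonoidHom b := by
    ext
    change toZ i j hi U a.1 = ofY j U b.1
    rw [ha, hb]
    exact s.2
  have hab' : ((a⁻¹).1, (b⁻¹).1) ∈ sections i j hi U :=
    congrArg (fun t : (Z.sec ((Opens.map (TopLRS.Hom.base j)).obj U))ˣ => (t⁻¹).1) hab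
  refine IsUnit.of_mul_eq_one ⟨_, hab'⟩ (Subtype.ext (Prod.ext ?_ ?_))
  · change s.1.1 * (a⁻¹).1 = 1
    rw [← ha, Units.mul_inv]
  · change s.1.2 * (b⁻¹).1 = 1
    rw [← hb, Units.mul_inv]

theorem isUnit_germ_of_snd {U : Opens Y.toTopCat} (s : sections i j hi U) (y : Y.toTopCat)
    (hy : y ∈ U) (hs : IsUnit (Y.presheaf.germ U y hy s.1.2)) :
    IsUnit ((presheaf i j hi).germ U y hy s) := by
  obtain ⟨V, k, hyV, hV⟩ := Y.toRingedSpace.isUnit_res_of_isUnit_germ U s.1.2 y hy hs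
  have h := isUnit_of_isUnit_snd i j hi (res i j hi (leOfHom k) s) hV
  have h' := h.map ((presheaf i j hi).germ V y hyV).hom
  exact (iff_of_eq (congrArg IsUnit
    (TopCat.Presheaf.germ_res_apply (presheaf i j hi) k y hyV s))).1 h'

/-- The second projection of the fibre product. -/
def sndNat : presheaf i j hi ⟶ Y.presheaf where
  app U := CommRingCat.ofHom ((RingHom.snd _ _).comp (sections i j hi U.unop).subtype)
  naturality _ _ _ := rfl

/-- The first projection of the fibre product. -/
def fstNat : presheaf i j hi ⟶ (TopCat.Presheaf.pushforward _ (q i j hi)).obj X.presheaf where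
  app U := CommRingCat.ofHom ((RingHom.fst _ _).comp (sections i j hi U.unop).subtype)
  naturality _ _ _ := rfl

theorem isLocalHom_snd (y : Y.toTopCat) :
    IsLocalHom ((TopCat.Presheaf.stalkFunctor CommRingCat y).map (sndNat i j hi)).hom := by
  refine ⟨fun t ht => ?_⟩
  obtain ⟨U, hy, s, rfl⟩ := TopCat.Presheaf.exists_germ_eq _ t
  refine isUnit_germ_of_snd i j hi s y hy ?_
  exact (iff_of_eq (congrArg IsUnit
    (TopCat.Presheaf.stalkFunctor_map_germ_apply U y hy (sndNat i j hi) s))).1 ht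

/-- The topology on the sections of the fibre product: the subspace topology of the product
topology. -/
def topSections (U : Opens Y.toTopCat) : TopologicalSpace (sections i j hi U) :=
  ((X.top (pre i j hi U)).induced fun s : sections i j hi U => s.1.1) ⊓
    (Y.top U).induced fun s : sections i j hi U => s.1.2

theorem isTopologicalRing_topSections (U : Opens Y.toTopCat) :
    @IsTopologicalRing (sections i j hi U) (topSections i j hi U) _ := by
  have h1 := isTopologicalRing_induced ((RingHom.fst _ _).comp (sections i j hi U).subtype)
    (X.top (pre i j hi U)) (X.isTopologicalRing _)
  have h2 := isTopologicalRing_induced ((RingHom.snd _ _).comp (sections i j hi U).subtype)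
    (Y.top U) (Y.isTopologicalRing _)
  rw [topSections, inf_eq_iInf]
  exact isTopologicalRing_iInf _ fun b => by cases b; exacts [h2, h1]

theorem topSections_eq_iInf {κ : Type u} (W : Opens Y.toTopCat) (U : κ → Opens Y.toTopCat)
    (hU : ∀ k, U k ≤ W) (hW : W ≤ ⨆ k, U k) :
    topSections i j hi W = ⨅ k, (topSections i j hi (U k)).induced (res i j hi (hU k)) := by
  have hW' : pre i j hi W ≤ ⨆ k, pre i j hi (U k) := by
    intro x hx
    obtain ⟨k, hk⟩ := Opens.mem_iSup.1 (hW hx)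
    exact Opens.mem_iSup.2 ⟨k, hk⟩
  rw [topSections, X.top_eq_iInf (pre i j hi W) (fun k => pre i j hi (U k))
    (fun k _ hx => hU k hx) hW', Y.top_eq_iInf W U hU hW]
  simp_rw [topSections, induced_iInf, induced_inf, induced_compose]
  rw [iInf_inf_eq]
  rfl

/-- The locally topologically ringed space `(|Y|, j_* 𝒪_X ×_{j_* 𝒪_Z} 𝒪_Y)`. -/
def space : TopLRS.{u} where
  carrier := Y.toTopCat
  presheaf := presheaf i j hi
  IsSheaf := isSheaf i j hi
  isLocalRing y := by
    have := isLocalHom_snd i j hi y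
    have : IsLocalRing ((TopCat.Presheaf.stalkFunctor CommRingCat y).obj Y.presheaf) :=
      Y.isLocalRing y
    exact ((TopCat.Presheaf.stalkFunctor CommRingCat y).map (sndNat i j hi)).hom.domain_isLocalRing
  top := topSections i j hi
  isTopologicalRing := isTopologicalRing_topSections i j hi
  top_eq_iInf := topSections_eq_iInf i j hi

theorem isUnit_germ_congr {U : Opens Y.toTopCat} {y y' : Y.toTopCat} (h : y = y') (b : Y.sec U)
    (hy : y ∈ U) (hy' : y' ∈ U) (hb : IsUnit (Y.presheaf.germ U y' hy' b)) :
    IsUnit (Y.presheaf.germ U y hy b) := by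
  subst h
  exact hb

theorem stalkMap_inl (x : X.toTopCat) :
    IsLocalHom (PresheafedSpace.Hom.stalkMap (X := X.toPresheafedSpace)
      (Y := (space i j hi).toPresheafedSpace) ⟨(q i j hi : X.toTopCat ⟶ Y.toTopCat), fstNat i j hi⟩ x).hom := by
  refine ⟨fun t ht => ?_⟩
  obtain ⟨U, hy, s, rfl⟩ := TopCat.Presheaf.exists_germ_eq (presheaf i j hi) t
  have h := PresheafedSpace.stalkMap_germ_apply (X := X.toPresheafedSpace)
    (Y := (space i j hi).toPresheafedSpace) ⟨(q i j hi : X.toTopCat ⟶ Y.toTopCat), fstNat i j hi⟩ U x hy s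
  have h1 := (iff_of_eq (congrArg IsUnit h)).1 ht
  obtain ⟨z, rfl⟩ := hi.surjective x
  have hz : TopLRS.Hom.base j z ∈ U := by
    rw [← q_apply i j hi]
    exact hy
  have h2 := (isUnit_germ_toZ i j hi s.1.1 z hz).2 h1
  rw [show toZ i j hi U s.1.1 = ofY j U s.1.2 from s.2] at h2
  have h3 := (isUnit_germ_ofY j s.1.2 z hz).1 h2
  refine isUnit_germ_of_snd i j hi s _ hy ?_
  exact isUnit_germ_congr (q_apply i j hi z) s.1.2 hy hz h3

theorem stalkMap_inr (y : Y.toTopCat) :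
    IsLocalHom (PresheafedSpace.Hom.stalkMap (X := Y.toPresheafedSpace)
      (Y := (space i j hi).toPresheafedSpace) ⟨𝟙 Y.toTopCat, sndNat i j hi⟩ y).hom := by
  refine ⟨fun t ht => ?_⟩
  obtain ⟨U, hy, s, rfl⟩ := TopCat.Presheaf.exists_germ_eq (presheaf i j hi) t
  have h := PresheafedSpace.stalkMap_germ_apply (X := Y.toPresheafedSpace)
    (Y := (space i j hi).toPresheafedSpace) ⟨𝟙 Y.toTopCat, sndNat i j hi⟩ U y hy s
  have h1 := (iff_of_eq (congrArg IsUnit h)).1 ht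
  exact isUnit_germ_of_snd i j hi s _ hy h1

/-- The canonical morphism from `X`, given by the first projection of the fibre product. -/
def inl : X ⟶ space i j hi :=
  TopLRS.Hom.mk ⟨⟨(q i j hi : X.toTopCat ⟶ Y.toTopCat), fstNat i j hi⟩, stalkMap_inl i j hi⟩ fun _ =>
    continuous_iff_le_induced.2 inf_le_left

/-- The canonical morphism from `Y`, given by the identity of `|Y|` and the second projection of
the fibre product. -/
def inr : Y ⟶ space i j hi :=
  TopLRS.Hom.mk ⟨⟨𝟙 Y.toTopCat, sndNat i j hi⟩, stalkMap_inr i j hi⟩ fun _ =>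
    continuous_iff_le_induced.2 inf_le_right

end Glue

/-! ### Formal schemes of principal ideal type -/

/-- Open immersions of locally topologically ringed spaces: open immersions of locally ringed spaces
for which the bijections `𝒪_Y(U) → 𝒪_X(f⁻¹ U)`, `U` an open subset of the image, are
homeomorphisms. -/
def TopLRS.IsOpenImmersion {X Y : TopLRS.{u}} (f : X ⟶ Y) : Prop :=
  LocallyRingedSpace.IsOpenImmersion (TopLRS.Hom.hom f) ∧
    ∀ U : Opens Y.toTopCat, (U : Set Y.toTopCat) ⊆ Set.range (TopLRS.Hom.base f) →
      Y.top U = (X.top ((Opens.map (TopLRS.Hom.base f)).obj U)).induced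
        ((TopLRS.Hom.hom f).c.app (op U)).hom

/-- An affine adic open formal subscheme of `X`: an open immersion `Spf A → X`, where `A` is
complete and separated for its `I`-adic topology, with `I` finitely generated. -/
structure AffineChart (X : TopLRS.{u}) where
  A : Type u
  [commRing : CommRing A]
  I : Ideal A
  fg : I.FG
  complete : IsAdicComplete I A
  hom : Spf A I ⟶ X
  isOpenImmersion : TopLRS.IsOpenImmersion hom

attribute [instance] AffineChart.commRing

namespace AffineChart

/-- The open subset of `X` covered by the chart. -/
def range {X : TopLRS.{u}} (c : AffineChart X) : Set X.toTopCat :=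
  Set.range (TopLRS.Hom.base c.hom)

/-- The topological ring `A` is of principal ideal type: it has a principal ideal of definition
`(ϖ)` and is `ϖ`-torsion free. -/
def IsPrincipal {X : TopLRS.{u}} (c : AffineChart X) : Prop :=
  ∃ ϖ ∈ nonZeroDivisors c.A, (Ideal.span {ϖ}).adicTopology = c.I.adicTopology

end AffineChart

/-- Adic formal schemes of principal ideal type: `X` is covered by affine adic open formal
subschemes, and all of these are of principal ideal type. -/
def IsPrincipalIdealType (X : TopLRS.{u}) : Prop :=
  (∀ x : X.toTopCat, ∃ c : AffineChart X, x ∈ c.range) ∧ ∀ c : AffineChart X, c.IsPrincipal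

/-- The morphism `i : S → X` is the inclusion of the reduced special fibre of the adic formal scheme
`X`: it is a homeomorphism, and `X` is covered by affine open formal subschemes `Spf A` over which
`i` is the closed immersion `Spec ((A / I)_red) → Spf A`. -/
structure IsReducedSpecialFibre {S : Scheme.{u}} {X : TopLRS.{u}} (i : schemeTop S ⟶ X) : Prop where
  isHomeomorph : IsHomeomorph (TopLRS.Hom.base i)
  exists_chart : ∀ x : X.toTopCat, ∃ c : AffineChart X, x ∈ c.range ∧
    ∃ k : Spec (CommRingCat.of (c.A ⧸ c.I.radical)) ⟶ S, IsOpenImmersion k ∧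
      schemeTopMap k ≫ i = spfRed c.A c.I ≫ c.hom ∧
      Set.range k = TopLRS.Hom.base i ⁻¹' c.range

/-- Affine morphisms of adic formal schemes: the inverse image of every affine open formal subscheme
is affine. -/
def IsAffineMorphism {X Y : TopLRS.{u}} (f : X ⟶ Y) : Prop :=
  ∀ c : AffineChart Y, ∃ d : AffineChart X, d.range = TopLRS.Hom.base f ⁻¹' c.range

/-! ### Cartier divisors -/

/-- A Cartier divisor on a scheme, i.e. a global section of `ℳ^× / 𝒪^×` for the sheaf `ℳ` of
total fractions: fractions `num k / den k` of sections over an open cover which are nonzerodivisors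
in all stalks, such that on overlaps two of these fractions differ by a unit of `𝒪` (it suffices to
say this in the stalks, as the unit is unique). -/
structure CartierDivisor (Y : Scheme.{u}) where
  index : Type u
  U : index → Y.Opens
  cover : ∀ y : Y, ∃ k, y ∈ U k
  num : ∀ k, Γ(Y, U k)
  den : ∀ k, Γ(Y, U k)
  num_regular : ∀ k y (hy : y ∈ U k), Y.presheaf.germ (U k) y hy (num k) ∈ nonZeroDivisors _
  den_regular : ∀ k y (hy : y ∈ U k), Y.presheaf.germ (U k) y hy (den k) ∈ nonZeroDivisors _
  compatible : ∀ k l y (hk : y ∈ U k) (hl : y ∈ U l),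
    Associated (Y.presheaf.germ (U k) y hk (num k) * Y.presheaf.germ (U l) y hl (den l))
      (Y.presheaf.germ (U l) y hl (num l) * Y.presheaf.germ (U k) y hk (den k))

/-- The support of a Cartier divisor: the points `y` such that a local equation `num k / den k` is
not a unit of the local ring `𝒪_{Y, y}`. -/
def CartierDivisor.support {Y : Scheme.{u}} (D : CartierDivisor Y) : Set Y :=
  {y | ∃ (k : D.index) (hy : y ∈ D.U k),
    ¬ Associated (Y.presheaf.germ (D.U k) y hy (D.num k)) (Y.presheaf.germ (D.U k) y hy (D.den k))}

end

/-!
The space glued from `X` and `Y` along `S` is studied over the affine open subsets `U` of `Y`, using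
a description of affine formal schemes by sections alone. An open subset `U` of a locally
topologically ringed space is called adic (`TopLRS.IsAdicOpen`) if the ring of sections over `D(f)`
is the completed localization of `A = 𝒪(U)` away from `f` with the adic topology, for all `f ∈ A`.
It is called affine adic (`TopLRS.IsAffineAdicOpen`) if moreover its reduction is an affine open
subset of the reduced special fibre with ring `A / √I`. Since the reduction has the same points, an
affine adic open set is the same thing as the image of a chart `Spf A` compatible with the reduced
special fibre: `AffineChart.isAffineAdicOpen` and `TopLRS.IsAffineAdicOpen.exists_chart`.

The main step on the side of `X` is that an open subset of `X` whose reduction is affine is itself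
affine (`TopLRS.IsAffineAdicOpen.exists_of_isAffineOpen`), the formal analogue of the theorem that a
scheme is affine if its reduction is. The functions `f` on the reduction for which the open set
lying over `D(f)` is affine form an ideal. Closure under addition reduces to a covering of an open
set by two pieces lying over `D(f)` and `D(1 - f)`. There the first Čech cohomology of the powers of
the ideal of definition, and of its radical, vanishes (`exists_split_pow`, `exists_split_radical`).
The second vanishing allows functions on the reduction to be lifted, and by the first one an ideal
of definition and the completed localizations can be glued (the lemmas on `IsAdicGluing`).

Now let `U ⊆ Y` be affine. As `j` is affine, the part of `X` over `U` has affine reduction, so it is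
`Spf R` with `R` of principal ideal type, say with ideal of definition `(ϖ)`. The sections of the
glued space over `U` form the fibre product `A = R ×_C B`, with `B = 𝒪_Y(U)` and
`C = R / √(ϖ) = 𝒪_S(j⁻¹ U)`. The element `w = (ϖ, 0)` generates an ideal of definition of `A`: an
element `(ϖ r, 0)` of `R ×_C B` always exists, so the powers of `w` and of `ϖ` differ by at most one
step (`IsFibreProduct.mem_span_pow`). Hence `A` is `(w)`-adically complete, with completed
localizations the fibre products of those of `R` and `B`. Schematic density makes `B → C`
injective, so that the kernel of `A → B` is `√(w)` and `w` is a nonzerodivisor. This shows that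
`U` is an affine adic open subset of the glued space (`Glue.exists_isAffineAdicOpen`).
Conversely every chart of the glued space has affine reduction (`AffineChart.isAffineOpen`), so
that these are all its affine open subsets; with the lemma on open subsets of `X` with affine
reduction this also gives that `X` maps to the glued space by an affine morphism.

The pushout property holds for formal reasons (`Glue.isPushout`): a cocone determines a continuous
map on `|Y|` and maps of sections into the fibre products, and locality on stalks can be tested
after composition with the morphism from `Y`, which is the identity on points.
-/

/-! ### Adically complete rings -/

/-- A sequence whose successive differences lie in the steps of a decreasing filtration is a Cauchy
sequence for it. -/
theorem mem_of_sub_succ_mem {L : Type*} [CommRing L] {F : ℕ → Ideal L} (hF : Antitone F)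
    {s : ℕ → L} (hs : ∀ n, s (n + 1) - s n ∈ F n) {m n : ℕ} (h : m ≤ n) : s n - s m ∈ F m := by
  induction n, h using Nat.le_induction with
  | base => simp
  | succ n hmn ih =>
    have := (F m).add_mem (hF hmn (hs n)) ih
    rwa [sub_add_sub_cancel] at this

/-- Adic completeness of a ring, in terms of elements and sequences. -/
theorem isAdicComplete_iff_seq {L : Type*} [CommRing L] (I : Ideal L) :
    IsAdicComplete I L ↔ (∀ x : L, (∀ n, x ∈ I ^ n) → x = 0) ∧
      ∀ s : ℕ → L, (∀ n, s (n + 1) - s n ∈ I ^ n) → ∃ l, ∀ n, l - s n ∈ I ^ n := by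
  have e (n : ℕ) : (I ^ n • ⊤ : Submodule L L) = I ^ n := by simp
  constructor
  · intro h
    refine ⟨fun x hx => h.toIsHausdorff.haus' x fun n => ?_, fun s hs => ?_⟩
    · rw [e, SModEq.zero]
      exact hx n
    · obtain ⟨l, hl⟩ := h.toIsPrecomplete.prec' s fun {m n} hmn => by
        rw [e, SModEq.comm, SModEq.sub_mem]
        exact mem_of_sub_succ_mem (F := fun n => I ^ n) (fun _ _ => Ideal.pow_le_pow_right) hs hmn
      refine ⟨l, fun n => ?_⟩
      have := hl n
      rw [e, SModEq.comm, SModEq.sub_mem] at this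
      exact this
  · rintro ⟨h1, h2⟩
    refine { haus' := fun x hx => h1 x fun n => ?_, prec' := fun s hs => ?_ }
    · have := hx n
      rw [e, SModEq.zero] at this
      exact this
    · obtain ⟨l, hl⟩ := h2 s fun n => by
        have := hs (Nat.le_succ n)
        rw [e, SModEq.comm, SModEq.sub_mem] at this
        exact this
      refine ⟨l, fun n => ?_⟩
      rw [e, SModEq.comm, SModEq.sub_mem]
      exact hl n

/-- A ring that is complete for a filtration by ideals `F n` with `F n = I ^ n + F (n + 1)`, where
`I` is finitely generated, is `I`-adically complete, and the filtration is the `I`-adic one: an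
element of `F n` is a convergent sum of elements of `I ^ n`, `I ^ (n + 1)`, …, whose coefficients
with respect to finitely many generators of `I ^ n` can be summed up. -/
theorem eq_pow_of_complete_filtration {L : Type*} [CommRing L] {I : Ideal L} (hI : I.FG)
    {F : ℕ → Ideal L} (hF : Antitone F) (h1 : ∀ n, I ^ n ≤ F n)
    (h2 : ∀ n, F n ≤ I ^ n ⊔ F (n + 1)) (h3 : ∀ x, (∀ n, x ∈ F n) → x = 0)
    (h4 : ∀ s : ℕ → L, (∀ n, s (n + 1) - s n ∈ F n) → ∃ l, ∀ n, l - s n ∈ F n) (n : ℕ) :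
    F n = I ^ n := by
  refine le_antisymm (fun z hz => ?_) (h1 n)
  obtain ⟨t, ht⟩ := hI.pow (n := n)
  have step : ∀ k (y : F (n + k)), ∃ (y' : F (n + (k + 1))) (c : t → L), (∀ j, c j ∈ I ^ k) ∧
      y.1 = y'.1 + ∑ j, c j * j.1 := by
    intro k y
    obtain ⟨a, ha, y', hy', h⟩ := Submodule.mem_sup.1 (h2 _ y.2)
    have ha' : a ∈ I ^ k • Ideal.span (Set.range (Subtype.val : t → L)) := by
      rw [Subtype.range_coe_subtype]
      change a ∈ I ^ k • Ideal.span (t : Set L)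
      rw [ht, smul_eq_mul, ← pow_add, add_comm]
      exact ha
    obtain ⟨c, hc, hca⟩ := (Submodule.mem_ideal_smul_span_iff_exists_sum _ _ _).1 ha'
    refine ⟨⟨y', hy'⟩, c, hc, ?_⟩
    rw [← h, ← hca, add_comm, Finsupp.sum_fintype _ _ (by simp)]
    rfl
  choose nxt c hc hnxt using step
  let y : (k : ℕ) → F (n + k) := fun k => Nat.rec ⟨z, hz⟩ (fun k y => nxt k y) k
  let S (j : t) (k : ℕ) : L := ∑ l ∈ Finset.range k, c l (y l) j
  have hS (j : t) (k : ℕ) : S j (k + 1) - S j k ∈ F k := by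
    simp only [S, Finset.sum_range_succ, add_sub_cancel_left]
    exact h1 k (hc k (y k) j)
  choose C hC using fun j => h4 (S j) (hS j)
  have hy (k : ℕ) : z = (y k).1 + ∑ j, S j k * j.1 := by
    induction k with
    | zero => simp [S, y]
    | succ k ih =>
      rw [ih, hnxt k (y k)]
      simp only [S, Finset.sum_range_succ, add_mul, Finset.sum_add_distrib]
      change _ = (nxt k (y k)).1 + _
      ring
  have hz : z - ∑ j, C j * j.1 = 0 := by
    refine h3 _ fun k => ?_
    have : z - ∑ j, C j * j.1 = (y k).1 - ∑ j, (C j - S j k) * j.1 := by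
      simp only [sub_mul, Finset.sum_sub_distrib]
      rw [hy k]
      ring
    rw [this]
    refine (F k).sub_mem (hF (Nat.le_add_left k n) (y k).2) ((F k).sum_mem fun j _ => ?_)
    exact (F k).mul_mem_right _ (hC j k)
  rw [sub_eq_zero.1 hz]
  refine (I ^ n).sum_mem fun j _ => (I ^ n).mul_mem_left _ ?_
  rw [← ht]
  exact Submodule.subset_span j.2

theorem isAdicComplete_of_complete_filtration {L : Type*} [CommRing L] {I : Ideal L} (hI : I.FG)
    {F : ℕ → Ideal L} (hF : Antitone F) (h1 : ∀ n, I ^ n ≤ F n)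
    (h2 : ∀ n, F n ≤ I ^ n ⊔ F (n + 1)) (h3 : ∀ x, (∀ n, x ∈ F n) → x = 0)
    (h4 : ∀ s : ℕ → L, (∀ n, s (n + 1) - s n ∈ F n) → ∃ l, ∀ n, l - s n ∈ F n) :
    IsAdicComplete I L := by
  obtain rfl : F = fun n => I ^ n := funext (eq_pow_of_complete_filtration hI hF h1 h2 h3 h4)
  exact (isAdicComplete_iff_seq I).2 ⟨h3, h4⟩

/-- Adic completeness only depends on the adic topology. -/
theorem IsAdicComplete.of_pow_le {L : Type*} [CommRing L] {I I' : Ideal L}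
    (h : IsAdicComplete I L) {k l : ℕ} (h1 : I ^ k ≤ I') (h2 : I' ^ l ≤ I) :
    IsAdicComplete I' L := by
  obtain ⟨h3, h4⟩ := (isAdicComplete_iff_seq I).1 h
  have hk (n : ℕ) : I ^ (k * n) ≤ I' ^ n := by
    rw [pow_mul]
    exact Ideal.pow_right_mono h1 n
  have hl (n : ℕ) : I' ^ (l * n) ≤ I ^ n := by
    rw [pow_mul]
    exact Ideal.pow_right_mono h2 n
  refine (isAdicComplete_iff_seq I').2 ⟨fun x hx => h3 x fun n => hl n (hx _), fun s hs => ?_⟩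
  have hs' {m n : ℕ} (h : m ≤ n) := mem_of_sub_succ_mem (F := fun n => I' ^ n)
    (fun _ _ => Ideal.pow_le_pow_right) hs h
  obtain ⟨x, hx⟩ := h4 (fun n => s (l * n)) fun n => hl n (hs' (Nat.mul_le_mul_left l n.le_succ))
  refine ⟨x, fun n => ?_⟩
  let N := max n (k * n)
  -- it is enough to compare with a later term of the sequence
  have h5 : x - s (max n (l * N)) ∈ I' ^ n := by
    have e1 := hx N
    have e2 := Ideal.pow_le_pow_right (I := I) (le_max_right n (k * n)) e1
    have e3 := hk n e2
    by_cases hN : n ≤ l * N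
    · rwa [max_eq_right hN]
    · obtain rfl : l = 0 := by
        by_contra h0
        have : N ≤ l * N := Nat.le_mul_of_pos_left N (Nat.pos_of_ne_zero h0)
        exact hN ((le_max_left n (k * n)).trans this)
      have htop : I = ⊤ := by
        rw [pow_zero, Ideal.one_eq_top, top_le_iff] at h2
        exact h2
      have : x - s (max n (0 * N)) = 0 := h3 _ fun m => by
        rw [htop, Ideal.top_pow]
        trivial
      rw [this]
      exact zero_mem _
  have h6 := (I' ^ n).add_mem h5 (hs' (le_max_left n (l * N)))
  rwa [sub_add_sub_cancel] at h6

theorem isUnit_of_sub_mem_of_isAdicComplete {L : Type*} [CommRing L] {I : Ideal L}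
    (h : IsAdicComplete I L) {x y : L} (hx : IsUnit x) (hxy : y - x ∈ I) : IsUnit y := by
  have h1 := Ideal.mem_jacobson_bot.1 (h.le_jacobson_bot _ hxy)
  obtain ⟨v, rfl⟩ := hx
  have h2 := h1 (v⁻¹).1
  rw [sub_mul, Units.mul_inv, sub_add_cancel] at h2
  exact isUnit_of_mul_isUnit_left h2

/-- A finitely generated ideal that is extended from `K` is extended from a finitely generated ideal
inside `K`. -/
theorem Ideal.exists_fg_le_map_eq {A L : Type*} [CommRing A] [CommRing L] {φ : A →+* L}
    {K : Ideal A} (h : (K.map φ).FG) : ∃ K' ≤ K, K'.FG ∧ K'.map φ = K.map φ := by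
  obtain ⟨s, hs, h1⟩ := (Submodule.fg_span_iff_fg_span_finset_subset _).1 h
  classical
  obtain ⟨t, ht, hts⟩ := Finset.subset_set_image_iff.1 hs
  subst hts
  refine ⟨Ideal.span t, Ideal.span_le.2 ht, ⟨t, rfl⟩, ?_⟩
  rw [Ideal.map_span, Ideal.map]
  rw [Finset.coe_image] at h1
  exact h1.symm

/-! ### Completed localizations -/

/-- The ring homomorphism `φ : A → L` exhibits `L` as the `I`-adic completion of the localization
of `A` away from `f`: the ring `L` is `I L`-adically complete, `f` is invertible in `L`, and
`L / I ^ n L` is the localization of `A / I ^ n` away from `f`. -/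
structure IsAdicLocalization {A L : Type*} [CommRing A] [CommRing L] (I : Ideal A) (f : A)
    (φ : A →+* L) : Prop where
  isUnit : IsUnit (φ f)
  complete : IsAdicComplete (I.map φ) L
  surj : ∀ n x, ∃ m a, φ f ^ m * x - φ a ∈ I.map φ ^ n
  inj : ∀ n a, φ a ∈ I.map φ ^ n → ∃ m, f ^ m * a ∈ I ^ n

theorem IsUnit.mul_mem_iff {R : Type*} [CommRing R] {J : Ideal R} {u x : R} (hu : IsUnit u) :
    u * x ∈ J ↔ x ∈ J :=
  J.unit_mul_mem_iff_mem hu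

namespace IsAdicLocalization

section Basic

variable {A L L' : Type*} [CommRing A] [CommRing L] [CommRing L'] {I : Ideal A} {f : A}
  {φ : A →+* L}

theorem map_mem {ψ : A →+* L'} {χ : L →+* L'} (h : χ.comp φ = ψ) {n : ℕ} {x : L}
    (hx : x ∈ I.map φ ^ n) : χ x ∈ I.map ψ ^ n := by
  have := Ideal.mem_map_of_mem χ hx
  rwa [Ideal.map_pow, Ideal.map_map, h] at this

/-- Uniqueness in the universal property of the completed localization. -/
theorem hom_ext (h : IsAdicLocalization I f φ) {χ χ' : L →+* L'} (h1 : χ.comp φ = χ'.comp φ)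
    (h2 : IsAdicComplete (I.map (χ.comp φ)) L') : χ = χ' := by
  refine RingHom.ext fun x => sub_eq_zero.1 (((isAdicComplete_iff_seq _).1 h2).1 _ fun n => ?_)
  obtain ⟨m, a, ha⟩ := h.surj n x
  have e1 := map_mem (ψ := χ.comp φ) rfl ha
  have e2 := map_mem h1.symm ha
  have e3 := Ideal.sub_mem _ e1 e2
  have e4 (b : A) : χ (φ b) = χ' (φ b) := congr($h1 b)
  have e5 : χ (φ f ^ m * x - φ a) - χ' (φ f ^ m * x - φ a) = χ (φ f) ^ m * (χ x - χ' x) := by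
    simp only [map_sub, map_mul, map_pow, e4]
    ring
  rw [e5] at e3
  exact ((h.isUnit.map χ).pow m).mul_mem_iff.1 e3

/-- The map induced by `ψ` from the completed localization to a quotient of the target: `L / I ^ n
L` is a quotient of `A_f`, and the kernel dies in the target. The map is characterized by its values
on approximations `a / f ^ m` of elements of `L`. -/
theorem exists_lift_mod (h : IsAdicLocalization I f φ) {ψ : A →+* L'} (hf : IsUnit (ψ f)) (n : ℕ) :
    ∃ g : L →+* L' ⧸ I.map ψ ^ n, ∀ x m a, φ f ^ m * x - φ a ∈ I.map φ ^ n →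
      Ideal.Quotient.mk _ (ψ f) ^ m * g x = Ideal.Quotient.mk _ (ψ a) := by
  let α : Localization.Away f →+* L ⧸ I.map φ ^ n :=
    IsLocalization.Away.lift f (g := (Ideal.Quotient.mk _).comp φ)
      (h.isUnit.map (Ideal.Quotient.mk _))
  let β : Localization.Away f →+* L' ⧸ I.map ψ ^ n :=
    IsLocalization.Away.lift f (g := (Ideal.Quotient.mk _).comp ψ)
      (hf.map (Ideal.Quotient.mk _))
  have hα (a : A) : α (algebraMap _ _ a) = Ideal.Quotient.mk _ (φ a) :=
    IsLocalization.Away.lift_eq f _ a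
  have hβ (a : A) : β (algebraMap _ _ a) = Ideal.Quotient.mk _ (ψ a) :=
    IsLocalization.Away.lift_eq f _ a
  have hu : IsUnit (algebraMap A (Localization.Away f) f) :=
    IsLocalization.Away.algebraMap_isUnit f
  have hs : Function.Surjective α := by
    intro x
    obtain ⟨x, rfl⟩ := Ideal.Quotient.mk_surjective x
    obtain ⟨m, a, ha⟩ := h.surj n x
    obtain ⟨v, hv⟩ := hu.pow m
    refine ⟨(v⁻¹).1 * algebraMap _ _ a, ((h.isUnit.map (Ideal.Quotient.mk (I.map φ ^ n))).pow m
      ).mul_left_cancel ?_⟩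
    rw [← hα, ← map_pow, ← hv, ← map_mul, Units.mul_inv_cancel_left, hα, hv, map_pow, hα,
      ← map_pow, ← map_mul, eq_comm, Ideal.Quotient.eq]
    exact ha
  have hker : ∀ s ∈ RingHom.ker α, β s = 0 := by
    intro s hs
    obtain ⟨m, a, ha⟩ := IsLocalization.Away.surj f s
    have h1 : φ a ∈ I.map φ ^ n := by
      rw [← Ideal.Quotient.eq_zero_iff_mem, ← hα, ← ha, map_mul, RingHom.mem_ker.1 hs, zero_mul]
    obtain ⟨k, hk⟩ := h.inj n a h1
    have h2 : ψ (f ^ k * a) ∈ I.map ψ ^ n := by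
      rw [← Ideal.map_pow]
      exact Ideal.mem_map_of_mem _ hk
    rw [← Ideal.Quotient.eq_zero_iff_mem, ← hβ, map_mul, ← ha, map_mul, map_mul] at h2
    refine ((hu.pow m).map β).mul_right_cancel ?_
    refine ((hu.pow k).map β).mul_left_cancel ?_
    rw [zero_mul, mul_zero, ← h2, map_pow _ f k]
  refine ⟨(Ideal.Quotient.lift (RingHom.ker α) β hker).comp
    ((RingHom.quotientKerEquivOfSurjective hs).symm.toRingHom.comp (Ideal.Quotient.mk _)),
    fun x m a hx => ?_⟩
  obtain ⟨s, hs'⟩ := hs (Ideal.Quotient.mk _ x)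
  have e1 : (RingHom.quotientKerEquivOfSurjective hs).symm (Ideal.Quotient.mk _ x) =
      Ideal.Quotient.mk _ s := by
    rw [RingEquiv.symm_apply_eq, ← hs']
    rfl
  change _ * Ideal.Quotient.lift (RingHom.ker α) β hker
    ((RingHom.quotientKerEquivOfSurjective hs).symm (Ideal.Quotient.mk _ x)) = _
  rw [e1, Ideal.Quotient.lift_mk, ← hβ, ← map_pow, ← map_mul, ← hβ, ← sub_eq_zero, ← map_sub]
  refine hker _ ?_
  rw [RingHom.mem_ker, map_sub, map_mul, map_pow, hα, hα, hs', sub_eq_zero, ← map_pow, ← map_mul,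
    Ideal.Quotient.eq]
  exact hx

/-- Existence in the universal property of the completed localization: a homomorphism to an adically
complete ring in which `f` becomes invertible factors through it. -/
theorem exists_lift (h : IsAdicLocalization I f φ) {ψ : A →+* L'} (hf : IsUnit (ψ f))
    (h2 : IsAdicComplete (I.map ψ) L') : ∃ χ : L →+* L', χ.comp φ = ψ := by
  choose g hg using fun n => h.exists_lift_mod (ψ := ψ) hf n
  have hu (m n : ℕ) : IsUnit (Ideal.Quotient.mk (I.map ψ ^ n) (ψ f) ^ m) := (hf.map _).pow m
  have hcomp : ∀ {m n : ℕ} (hle : m ≤ n),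
      (Ideal.Quotient.factorPow (I.map ψ) hle).comp (g n) = g m := by
    intro m n hle
    ext x
    obtain ⟨k, a, ha⟩ := h.surj n x
    refine (hu k m).mul_left_cancel ?_
    rw [hg m x k a (Ideal.pow_le_pow_right hle ha)]
    have := congr(Ideal.Quotient.factorPow (I.map ψ) hle $(hg n x k a ha))
    rwa [map_mul, map_pow] at this
  refine ⟨IsAdicComplete.liftRingHom (I.map ψ) g hcomp, RingHom.ext fun a => sub_eq_zero.1
    (((isAdicComplete_iff_seq _).1 h2).1 _ fun n => ?_)⟩
  rw [← Ideal.Quotient.eq]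
  have e1 := IsAdicComplete.mk_liftRingHom (I.map ψ) g hcomp n (φ a)
  have e2 := hg n (φ a) 0 a (by simp)
  rw [pow_zero, one_mul] at e2
  exact e1.trans e2

/-- Two completed localizations of a ring away from the same element are isomorphic. -/
theorem bijective (h : IsAdicLocalization I f φ) {ψ : A →+* L'} (h' : IsAdicLocalization I f ψ)
    {χ : L →+* L'} (hχ : χ.comp φ = ψ) : Function.Bijective χ := by
  obtain ⟨ξ, hξ⟩ := h'.exists_lift (ψ := φ) h.isUnit h.complete
  have e1 : ξ.comp χ = RingHom.id L := by
    refine h.hom_ext ?_ ?_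
    · rw [RingHom.comp_assoc, hχ, hξ, RingHom.id_comp]
    · rw [RingHom.comp_assoc, hχ, hξ]
      exact h.complete
  have e2 : χ.comp ξ = RingHom.id L' := by
    refine h'.hom_ext ?_ ?_
    · rw [RingHom.comp_assoc, hξ, hχ, RingHom.id_comp]
    · rw [RingHom.comp_assoc, hξ, hχ]
      exact h'.complete
  exact ⟨Function.LeftInverse.injective fun x => congr($e1 x),
    Function.RightInverse.surjective fun x => congr($e2 x)⟩

/-- If elements of `L` can be approximated by fractions `a / f ^ m`, then elements of `K L` can be
approximated by fractions with `a ∈ K`, relative to `K L`. -/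
theorem _root_.exists_approx_of_mem_map
    (h : ∀ n x, ∃ m a, φ f ^ m * x - φ a ∈ I.map φ ^ n) (K : Ideal A) (N : ℕ) {x : L}
    (hx : x ∈ K.map φ) :
    ∃ m, ∃ b ∈ K, φ f ^ m * x - φ b ∈ K.map φ * I.map φ ^ N := by
  induction hx using Submodule.span_induction with
  | mem x hx =>
    obtain ⟨b, hb, rfl⟩ := hx
    exact ⟨0, b, hb, by simp⟩
  | zero => exact ⟨0, 0, zero_mem _, by simp⟩
  | add x y _ _ hx hy =>
    obtain ⟨m, b, hb, hx⟩ := hx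
    obtain ⟨n, c, hc, hy⟩ := hy
    refine ⟨m + n, f ^ n * b + f ^ m * c,
      K.add_mem (K.mul_mem_left _ hb) (K.mul_mem_left _ hc), ?_⟩
    have := Ideal.add_mem _ (Ideal.mul_mem_left _ (φ f ^ n) hx)
      (Ideal.mul_mem_left _ (φ f ^ m) hy)
    convert this using 1
    simp only [map_add, map_mul, map_pow]
    ring
  | smul r x _ hx =>
    obtain ⟨m, b, hb, hx⟩ := hx
    obtain ⟨n, c, hr⟩ := h N r
    refine ⟨m + n, c * b, K.mul_mem_left _ hb, ?_⟩
    have := Ideal.add_mem _ (Ideal.mul_mem_left _ (φ f ^ n * r) hx)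
      (Ideal.mul_mem_mul (Ideal.mem_map_of_mem φ hb) hr)
    convert this using 1
    simp only [map_mul, smul_eq_mul]
    ring

/-- An element of `A` that lies in `K L` for an open ideal `K` of `A` lies in `K` after
multiplication by a power of `f`. -/
theorem exists_pow_mul_mem (h : IsAdicLocalization I f φ) {K : Ideal A} {N : ℕ} (hK : I ^ N ≤ K)
    {a : A} (ha : φ a ∈ K.map φ) : ∃ m, f ^ m * a ∈ K := by
  obtain ⟨m, b, hb, h1⟩ := exists_approx_of_mem_map h.surj K N ha
  replace h1 := Ideal.mul_le_right h1
  rw [← map_pow, ← map_mul, ← map_sub] at h1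
  obtain ⟨n, hn⟩ := h.inj N _ h1
  refine ⟨n + m, ?_⟩
  have := K.add_mem (hK hn) (K.mul_mem_left (f ^ n) hb)
  convert this using 1
  ring

/-- Completed localizations only depend on the adic topology. -/
theorem of_pow_le (h : IsAdicLocalization I f φ) {I' : Ideal A} {k l : ℕ} (h1 : I ^ k ≤ I')
    (h2 : I' ^ l ≤ I) : IsAdicLocalization I' f φ := by
  have e1 (n : ℕ) : I ^ (k * n) ≤ I' ^ n := by
    rw [pow_mul]
    exact Ideal.pow_right_mono h1 n
  have e2 (n : ℕ) : I.map φ ^ (k * n) ≤ I'.map φ ^ n := by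
    rw [← Ideal.map_pow, ← Ideal.map_pow]
    exact Ideal.map_mono (e1 n)
  refine ⟨h.isUnit, h.complete.of_pow_le (k := k) (l := l) ?_ ?_, fun n x => ?_, fun n a ha => ?_⟩
  · rw [← Ideal.map_pow]
    exact Ideal.map_mono h1
  · rw [← Ideal.map_pow]
    exact Ideal.map_mono h2
  · obtain ⟨m, a, ha⟩ := h.surj (k * n) x
    exact ⟨m, a, e2 n ha⟩
  · rw [← Ideal.map_pow] at ha
    exact h.exists_pow_mul_mem (e1 n) ha

/-- Transitivity of completed localizations: `L` is a completed localization of `A`, and `L'` is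
the completed localization of `A` away from `f * a`, where `a` approximates `h` up to a power of
`f`. -/
theorem of_comp (hφ : IsAdicLocalization I f φ) {h : L} {ψ : L →+* L'}
    (H : ∀ n m a, φ f ^ m * h - φ a ∈ I.map φ ^ (n + 1) →
      IsAdicLocalization I (f * a) (ψ.comp φ)) :
    IsAdicLocalization (I.map φ) h ψ := by
  have hmap : (I.map φ).map ψ = I.map (ψ.comp φ) := Ideal.map_map _ _
  -- if `a` approximates `f ^ m * h`, then `(f * a) ^ k` approximates `f ^ (k * (m + 1)) * h ^ k`
  have happ {n m a} (k : ℕ) (ha : φ f ^ m * h - φ a ∈ I.map φ ^ n) :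
      (φ f ^ (m + 1)) ^ k * h ^ k - φ (f * a) ^ k ∈ I.map φ ^ n := by
    have h1 := Ideal.mul_mem_left _ (φ f) ha
    rw [← mul_pow]
    obtain ⟨c, hc⟩ := sub_dvd_pow_sub_pow (φ f ^ (m + 1) * h) (φ (f * a)) k
    rw [hc]
    refine Ideal.mul_mem_right _ _ ?_
    convert h1 using 1
    rw [map_mul]
    ring
  refine ⟨?_, ?_, fun n x => ?_, fun n x hx => ?_⟩
  · obtain ⟨m, a, ha⟩ := hφ.surj 1 h
    have h1 := H 0 m a ha
    have h2 := map_mem (ψ := ψ.comp φ) rfl (happ 1 ha)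
    rw [pow_one, pow_one, pow_one] at h2
    have h2' := h2
    rw [pow_one, ← neg_mem_iff, ← map_neg, neg_sub, map_sub] at h2
    have h3 : IsUnit (ψ (φ f ^ (m + 1) * h)) := by
      refine isUnit_of_sub_mem_of_isAdicComplete h1.complete h1.isUnit ?_
      rw [pow_one, map_sub] at h2'
      exact h2'
    rw [map_mul] at h3
    exact isUnit_of_mul_isUnit_right h3
  · obtain ⟨m, a, ha⟩ := hφ.surj 1 h
    rw [hmap]
    exact (H 0 m a ha).complete
  · obtain ⟨m, a, ha⟩ := hφ.surj (n + 1) h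
    obtain ⟨k, b, hb⟩ := (H n m a ha).surj n x
    obtain ⟨v, hv⟩ := (hφ.isUnit.pow (m + 1)).pow k
    refine ⟨k, (v⁻¹).1 * φ b, ?_⟩
    rw [hmap]
    have h1 := Ideal.mul_mem_right x _ (map_mem (ψ := ψ.comp φ) rfl
      (Ideal.pow_le_pow_right n.le_succ (happ k ha)))
    have h2 := Ideal.mul_mem_left _ (ψ (v⁻¹).1) (Ideal.add_mem _ h1 hb)
    convert h2 using 1
    have e : ψ (v⁻¹).1 * ψ v.1 = 1 := by rw [← map_mul, Units.inv_mul, map_one]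
    have e2 : ψ (φ f ^ (m + 1)) ^ k = ψ v.1 := by rw [hv, map_pow ψ _ k]
    simp only [map_sub, map_mul, map_pow, RingHom.comp_apply] at e2 ⊢
    rw [e2]
    linear_combination (-(ψ h ^ k * x)) * e
  · obtain ⟨m, a, ha⟩ := hφ.surj (n + 1) h
    obtain ⟨k, b, hb⟩ := hφ.surj n x
    rw [hmap] at hx
    have h1 : ψ.comp φ b ∈ I.map (ψ.comp φ) ^ n := by
      have h1 := map_mem (ψ := ψ.comp φ) rfl hb
      have h2 := Ideal.sub_mem _ (Ideal.mul_mem_left _ (ψ (φ f ^ k)) hx) h1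
      convert h2 using 1
      rw [map_sub, map_mul, sub_sub_cancel]
      rfl
    obtain ⟨l, hl⟩ := (H n m a ha).inj n b h1
    refine ⟨l, (((hφ.isUnit.pow (m + 1)).pow l).mul (hφ.isUnit.pow k)).mul_mem_iff.1 ?_⟩
    have h3 : φ ((f * a) ^ l * b) ∈ I.map φ ^ n := by
      rw [← Ideal.map_pow]
      exact Ideal.mem_map_of_mem _ hl
    have h4 := Ideal.mul_mem_right (φ b) _ (Ideal.pow_le_pow_right n.le_succ (happ l ha))
    have h5 := Ideal.mul_mem_left _ ((φ f ^ (m + 1)) ^ l * h ^ l) hb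
    have h6 := Ideal.add_mem _ h5 (Ideal.add_mem _ h4 h3)
    convert h6 using 1
    simp only [map_mul, map_pow]
    ring

end Basic

end IsAdicLocalization

/-! ### Gluing completed localizations along two basic open sets -/

section MayerVietoris

variable {R R₁ R₂ P : Type*} [CommRing R] [CommRing R₁] [CommRing R₂] [CommRing P]
  {p₁ : R₁ →+* P} {p₂ : R₂ →+* P} {I₁ : Ideal R₁} {I₂ : Ideal R₂} {f₁ : R₁} {f₂ : R₂}

/-- If `f₁` and `f₂` had the same image, the coprime powers `(1 - f₁) ^ m` and `f₂ ^ n` would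
generate the unit ideal of `P`. In general the same identity holds up to a multiple of `p₁ f₁ - p₂
f₂`. -/
theorem exists_partition (p₁ : R₁ →+* P) (p₂ : R₂ →+* P) (f₁ : R₁) (f₂ : R₂) (m n : ℕ) :
    ∃ (b₁ : R₁) (a₂ : R₂) (w : P), p₁ (b₁ * (1 - f₁) ^ m) + p₂ (a₂ * f₂ ^ n) +
      (p₁ f₁ - p₂ f₂) * w = 1 := by
  -- in the identity `α * X ^ n + β * (1 - X) ^ m = 1` over `ℤ`, evaluate the first summand at `f₂`
  -- and the second one at `f₁`
  have hc : IsCoprime ((Polynomial.X : Polynomial ℤ) ^ n) ((1 - Polynomial.X) ^ m) :=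
    IsCoprime.pow ⟨1, 1, by ring⟩
  obtain ⟨α, β, h⟩ := hc
  have he {S : Type _} [CommRing S] (x : S) :
      α.eval₂ (Int.castRingHom S) x * x ^ n + β.eval₂ (Int.castRingHom S) x * (1 - x) ^ m = 1 := by
    have := congr(Polynomial.eval₂ (Int.castRingHom S) x $h)
    simpa [Polynomial.eval₂_mul, Polynomial.eval₂_pow, Polynomial.eval₂_sub] using this
  obtain ⟨w, hw⟩ := Polynomial.sub_dvd_eval_sub (p₁ f₁) (p₂ f₂)
    ((α * Polynomial.X ^ n).map (Int.castRingHom P))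
  refine ⟨β.eval₂ (Int.castRingHom _) f₁, α.eval₂ (Int.castRingHom _) f₂, w, ?_⟩
  have h1 := he (p₁ f₁)
  rw [← hw]
  simp only [Polynomial.eval_map, Polynomial.eval₂_mul, Polynomial.eval₂_X_pow, map_mul, map_pow,
    Polynomial.hom_eval₂, map_sub, map_one,
    show p₁.comp (Int.castRingHom R₁) = Int.castRingHom P from Subsingleton.elim _ _,
    show p₂.comp (Int.castRingHom R₂) = Int.castRingHom P from Subsingleton.elim _ _]
  linear_combination h1

/-- If the elements of `K` come from `K₁` and from `K₂` modulo `K'` after multiplication by powers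
of `1 - f₁` and of `f₂`, then they are sums of an element from `K₁` and one from `K₂` modulo `K'`.
The elements `f₁` and `f₂` need only agree up to an element `y` which is nilpotent on `K / K'`: a
partition of unity then splits `z` up to a multiple of `y * z`. -/
theorem exists_split {K K' : Ideal P} {K₁ : Ideal R₁} {K₂ : Ideal R₂}
    (h1 : ∀ z ∈ K, ∃ m, ∃ r ∈ K₁, p₁ (1 - f₁) ^ m * z - p₁ r ∈ K')
    (h2 : ∀ z ∈ K, ∃ m, ∃ r ∈ K₂, p₂ f₂ ^ m * z - p₂ r ∈ K')
    {M : ℕ} (hM : ∀ z ∈ K, (p₁ f₁ - p₂ f₂) ^ M * z ∈ K') {z : P} (hz : z ∈ K) :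
    ∃ r₁ ∈ K₁, ∃ r₂ ∈ K₂, z - (p₁ r₁ + p₂ r₂) ∈ K' := by
  -- downward induction: `exists_partition` trades the claim for `k` against that for `k + 1`
  have key : ∀ k ≤ M, ∀ z ∈ K, ∃ r₁ ∈ K₁, ∃ r₂ ∈ K₂,
      (p₁ f₁ - p₂ f₂) ^ k * z - (p₁ r₁ + p₂ r₂) ∈ K' := by
    intro k hk
    induction hk using Nat.decreasingInduction with
    | self => exact fun z hz => ⟨0, zero_mem _, 0, zero_mem _, by simpa using hM z hz⟩
    | of_succ k hk ih =>
      intro z hz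
      have hz' : (p₁ f₁ - p₂ f₂) ^ k * z ∈ K := K.mul_mem_left _ hz
      obtain ⟨m, r₁, hr₁, e1⟩ := h1 _ hz'
      obtain ⟨n, r₂, hr₂, e2⟩ := h2 _ hz'
      obtain ⟨b₁, a₂, w, h⟩ := exists_partition p₁ p₂ f₁ f₂ m n
      obtain ⟨s₁, hs₁, s₂, hs₂, e3⟩ := ih (w * z) (K.mul_mem_left _ hz)
      refine ⟨b₁ * r₁ + s₁, K₁.add_mem (K₁.mul_mem_left _ hr₁) hs₁, a₂ * r₂ + s₂,
        K₂.add_mem (K₂.mul_mem_left _ hr₂) hs₂, ?_⟩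
      have := K'.add_mem (K'.add_mem (K'.mul_mem_left (p₁ b₁) e1) (K'.mul_mem_left (p₂ a₂) e2)) e3
      convert this using 1
      simp only [map_add, map_mul, map_pow] at h ⊢
      linear_combination (-((p₁ f₁ - p₂ f₂) ^ k * z)) * h
  simpa using key 0 (Nat.zero_le M) z hz

/-- The first step in the construction of the splitting of `exists_split_pow` by successive
approximation. -/
theorem exists_split_pow_succ (hI : I₁.map p₁ = I₂.map p₂)
    (H₁ : IsAdicLocalization I₁ (1 - f₁) p₁) (H₂ : IsAdicLocalization I₂ f₂ p₂) {M : ℕ}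
    (hM : (p₁ f₁ - p₂ f₂) ^ M ∈ I₁.map p₁) (n : ℕ) {z : P} (hz : z ∈ I₁.map p₁ ^ n) :
    ∃ r₁ ∈ I₁ ^ n, ∃ r₂ ∈ I₂ ^ n, z - (p₁ r₁ + p₂ r₂) ∈ I₁.map p₁ ^ (n + 1) := by
  refine exists_split (K := I₁.map p₁ ^ n) (f₁ := f₁) (f₂ := f₂) (M := M) ?_ ?_ ?_ hz
  · intro z hz
    rw [← Ideal.map_pow] at hz
    obtain ⟨m, b, hb, h⟩ := exists_approx_of_mem_map H₁.surj _ 1 hz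
    refine ⟨m, b, hb, ?_⟩
    rwa [Ideal.map_pow, ← pow_add] at h
  · intro z hz
    rw [hI, ← Ideal.map_pow] at hz
    obtain ⟨m, b, hb, h⟩ := exists_approx_of_mem_map H₂.surj _ 1 hz
    refine ⟨m, b, hb, ?_⟩
    rwa [Ideal.map_pow, ← pow_add, ← hI] at h
  · intro z hz
    rw [pow_succ']
    exact Ideal.mul_mem_mul hM hz

/-- The vanishing of the first Čech cohomology of the powers of the ideal of definition, for a
covering by two basic open sets. -/
theorem exists_split_pow (hI : I₁.map p₁ = I₂.map p₂) (c₁ : IsAdicComplete I₁ R₁)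
    (c₂ : IsAdicComplete I₂ R₂) (H₁ : IsAdicLocalization I₁ (1 - f₁) p₁)
    (H₂ : IsAdicLocalization I₂ f₂ p₂) {M : ℕ} (hM : (p₁ f₁ - p₂ f₂) ^ M ∈ I₁.map p₁) (n : ℕ)
    {z : P} (hz : z ∈ I₁.map p₁ ^ n) : ∃ r₁ ∈ I₁ ^ n, ∃ r₂ ∈ I₂ ^ n, z = p₁ r₁ + p₂ r₂ := by
  have step (k : ℕ) (y : (I₁.map p₁ ^ (n + k) : Ideal P)) :
      ∃ (y' : (I₁.map p₁ ^ (n + (k + 1)) : Ideal P)) (c : R₁ × R₂), c.1 ∈ I₁ ^ (n + k) ∧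
        c.2 ∈ I₂ ^ (n + k) ∧ y.1 = y'.1 + (p₁ c.1 + p₂ c.2) := by
    obtain ⟨r₁, h1, r₂, h2, h⟩ := exists_split_pow_succ hI H₁ H₂ hM (n + k) y.2
    exact ⟨⟨_, h⟩, (r₁, r₂), h1, h2, by simp⟩
  choose nxt c hc₁ hc₂ hnxt using step
  let y : (k : ℕ) → (I₁.map p₁ ^ (n + k) : Ideal P) :=
    fun k => Nat.rec ⟨z, hz⟩ (fun k y => nxt k y) k
  let s₁ (k : ℕ) : R₁ := ∑ l ∈ Finset.range k, (c l (y l)).1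
  let s₂ (k : ℕ) : R₂ := ∑ l ∈ Finset.range k, (c l (y l)).2
  have hs₁ (k : ℕ) : s₁ (k + 1) - s₁ k ∈ I₁ ^ k := by
    simp only [s₁, Finset.sum_range_succ, add_sub_cancel_left]
    exact Ideal.pow_le_pow_right (Nat.le_add_left k n) (hc₁ k (y k))
  have hs₂ (k : ℕ) : s₂ (k + 1) - s₂ k ∈ I₂ ^ k := by
    simp only [s₂, Finset.sum_range_succ, add_sub_cancel_left]
    exact Ideal.pow_le_pow_right (Nat.le_add_left k n) (hc₂ k (y k))
  obtain ⟨l₁, hl₁⟩ := ((isAdicComplete_iff_seq _).1 c₁).2 s₁ hs₁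
  obtain ⟨l₂, hl₂⟩ := ((isAdicComplete_iff_seq _).1 c₂).2 s₂ hs₂
  have hy (k : ℕ) : z = (y k).1 + (p₁ (s₁ k) + p₂ (s₂ k)) := by
    induction k with
    | zero => simp [s₁, s₂, y]
    | succ k ih =>
      rw [ih, hnxt k (y k)]
      simp only [s₁, s₂, Finset.sum_range_succ, map_add]
      change _ = (nxt k (y k)).1 + _
      ring
  refine ⟨l₁, ?_, l₂, ?_, sub_eq_zero.1
    (((isAdicComplete_iff_seq _).1 H₁.complete).1 _ fun k => ?_)⟩
  · have h1 : s₁ n ∈ I₁ ^ n := Ideal.sum_mem _ fun l _ =>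
      Ideal.pow_le_pow_right (Nat.le_add_right n l) (hc₁ l (y l))
    simpa using (I₁ ^ n).add_mem (hl₁ n) h1
  · have h1 : s₂ n ∈ I₂ ^ n := Ideal.sum_mem _ fun l _ =>
      Ideal.pow_le_pow_right (Nat.le_add_right n l) (hc₂ l (y l))
    simpa using (I₂ ^ n).add_mem (hl₂ n) h1
  · have e1 : p₁ (l₁ - s₁ k) ∈ I₁.map p₁ ^ k := by
      rw [← Ideal.map_pow]
      exact Ideal.mem_map_of_mem _ (hl₁ k)
    have e2 : p₂ (l₂ - s₂ k) ∈ I₁.map p₁ ^ k := by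
      rw [hI, ← Ideal.map_pow]
      exact Ideal.mem_map_of_mem _ (hl₂ k)
    have e3 := Ideal.pow_le_pow_right (Nat.le_add_left k n) (y k).2
    have := Ideal.sub_mem _ (Ideal.sub_mem _ e3 e1) e2
    convert this using 1
    rw [hy k, map_sub, map_sub]
    ring

end MayerVietoris

/-- A ring `R` that is glued from rings `R₁` and `R₂`, which play the role of the sections over the
basic open sets defined by `f` and by `1 - f`, along a common completed localization `P`. -/
structure IsAdicGluing {R R₁ R₂ P : Type*} [CommRing R] [CommRing R₁] [CommRing R₂] [CommRing P]
    (q₁ : R →+* R₁) (q₂ : R →+* R₂) (p₁ : R₁ →+* P) (p₂ : R₂ →+* P) (I₁ : Ideal R₁)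
    (I₂ : Ideal R₂) (f : R) : Prop where
  comm : ∀ x, p₁ (q₁ x) = p₂ (q₂ x)
  inj : ∀ x, q₁ x = 0 → q₂ x = 0 → x = 0
  exact : ∀ r₁ r₂, p₁ r₁ = p₂ r₂ → ∃ x, q₁ x = r₁ ∧ q₂ x = r₂
  map_eq : I₁.map p₁ = I₂.map p₂
  complete₁ : IsAdicComplete I₁ R₁
  complete₂ : IsAdicComplete I₂ R₂
  isUnit₁ : IsUnit (q₁ f)
  isUnit₂ : IsUnit (q₂ (1 - f))
  loc₁ : IsAdicLocalization I₁ (q₁ (1 - f)) p₁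
  loc₂ : IsAdicLocalization I₂ (q₂ f) p₂

namespace IsAdicGluing

variable {R R₁ R₂ P : Type*} [CommRing R] [CommRing R₁] [CommRing R₂] [CommRing P]
  {q₁ : R →+* R₁} {q₂ : R →+* R₂} {p₁ : R₁ →+* P} {p₂ : R₂ →+* P} {I₁ : Ideal R₁}
  {I₂ : Ideal R₂} {f : R}

/-- Gluing data are symmetric, with the roles of `f` and `1 - f` exchanged. -/
theorem symm (H : IsAdicGluing q₁ q₂ p₁ p₂ I₁ I₂ f) :
    IsAdicGluing q₂ q₁ p₂ p₁ I₂ I₁ (1 - f) where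
  comm x := (H.comm x).symm
  inj x h1 h2 := H.inj x h2 h1
  exact r₁ r₂ h := by
    obtain ⟨x, h1, h2⟩ := H.exact r₂ r₁ h.symm
    exact ⟨x, h2, h1⟩
  map_eq := H.map_eq.symm
  complete₁ := H.complete₂
  complete₂ := H.complete₁
  isUnit₁ := H.isUnit₂
  isUnit₂ := by
    rw [sub_sub_cancel]
    exact H.isUnit₁
  loc₁ := by
    rw [sub_sub_cancel]
    exact H.loc₂
  loc₂ := H.loc₁

/-- The filtration of `R` by the ideals of elements lying in `I₁ ^ n` and in `I₂ ^ n`. -/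
def fil (_ : IsAdicGluing q₁ q₂ p₁ p₂ I₁ I₂ f) (n : ℕ) : Ideal R :=
  (I₁ ^ n).comap q₁ ⊓ (I₂ ^ n).comap q₂

theorem mem_fil (H : IsAdicGluing q₁ q₂ p₁ p₂ I₁ I₂ f) {n : ℕ} {x : R} :
    x ∈ H.fil n ↔ q₁ x ∈ I₁ ^ n ∧ q₂ x ∈ I₂ ^ n :=
  Iff.rfl

theorem symm_fil (H : IsAdicGluing q₁ q₂ p₁ p₂ I₁ I₂ f) (n : ℕ) : H.symm.fil n = H.fil n :=
  inf_comm _ _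

/-- The vanishing of the Čech cohomology `exists_split_pow` for gluing data. -/
theorem split (H : IsAdicGluing q₁ q₂ p₁ p₂ I₁ I₂ f) (n : ℕ) {z : P} (hz : z ∈ I₁.map p₁ ^ n) :
    ∃ r₁ ∈ I₁ ^ n, ∃ r₂ ∈ I₂ ^ n, z = p₁ r₁ + p₂ r₂ := by
  refine exists_split_pow (f₁ := q₁ f) (f₂ := q₂ f) H.map_eq H.complete₁ H.complete₂ ?_ H.loc₂
    (M := 1) ?_ n hz
  · have := H.loc₁
    rwa [map_sub, map_one] at this
  · rw [H.comm, sub_self, pow_one]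
    exact zero_mem _

/-- Up to a power of `f`, an element of `I₁ ^ n` is approximated by an element of `R`: it is
approximated over the intersection by an element of `I₂ ^ n`, and the error is split into
contributions of both sides. -/
theorem exists_approx (H : IsAdicGluing q₁ q₂ p₁ p₂ I₁ I₂ f) {n k : ℕ} (hk : n ≤ k) {r : R₁}
    (hr : r ∈ I₁ ^ n) : ∃ m, ∃ c ∈ H.fil n, q₁ f ^ m * r - q₁ c ∈ I₁ ^ k := by
  have h1 : p₁ r ∈ (I₂ ^ n).map p₂ := by
    rw [Ideal.map_pow, ← H.map_eq, ← Ideal.map_pow]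
    exact Ideal.mem_map_of_mem _ hr
  obtain ⟨m, s, hs, h2⟩ := exists_approx_of_mem_map H.loc₂.surj (I₂ ^ n) k h1
  replace h2 := Ideal.mul_le_right h2
  rw [← H.map_eq] at h2
  obtain ⟨z₁, hz₁, z₂, hz₂, hz⟩ := H.split k h2
  obtain ⟨c, hc₁, hc₂⟩ := H.exact (q₁ f ^ m * r - z₁) (s + z₂) (by
    rw [map_sub, map_mul, map_pow, map_add, H.comm]
    linear_combination hz)
  refine ⟨m, c, H.mem_fil.2 ⟨?_, ?_⟩, ?_⟩
  · rw [hc₁]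
    exact Ideal.sub_mem _ (Ideal.mul_mem_left _ _ hr) (Ideal.pow_le_pow_right hk hz₁)
  · rw [hc₂]
    exact Ideal.add_mem _ hs (Ideal.pow_le_pow_right hk hz₂)
  · rw [hc₁, sub_sub_cancel]
    exact hz₁

/-- The ideal of elements of `R` lying in both ideals of definition generates `I₁`, by approximation
and Nakayama's lemma. -/
theorem map_fil_one (H : IsAdicGluing q₁ q₂ p₁ p₂ I₁ I₂ f) (hI : I₁.FG) :
    (H.fil 1).map q₁ = I₁ := by
  refine le_antisymm (Ideal.map_le_iff_le_comap.2 fun x hx => ?_) ?_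
  · have := (H.mem_fil.1 hx).1
    rwa [pow_one] at this
  · refine Submodule.le_of_le_smul_of_le_jacobson_bot hI H.complete₁.le_jacobson_bot ?_
    intro r hr
    obtain ⟨m, c, hc, h⟩ := H.exists_approx (n := 1) one_le_two (r := r) (by rwa [pow_one])
    refine (H.isUnit₁.pow m).mul_mem_iff.1 ?_
    rw [← sub_add_cancel (q₁ f ^ m * r) (q₁ c)]
    rw [pow_two] at h
    exact Submodule.add_mem _ (Submodule.mem_sup_right h)
      (Submodule.mem_sup_left (Ideal.mem_map_of_mem _ hc))

/-- The ideals of definition `I₁` and `I₂` come from a finitely generated ideal of `R`. -/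
theorem exists_ideal (H : IsAdicGluing q₁ q₂ p₁ p₂ I₁ I₂ f) (h₁ : I₁.FG) (h₂ : I₂.FG) :
    ∃ I : Ideal R, I.FG ∧ I.map q₁ = I₁ ∧ I.map q₂ = I₂ := by
  have e1 := H.map_fil_one h₁
  have e2 := H.symm.map_fil_one h₂
  rw [H.symm_fil] at e2
  obtain ⟨K, hK, hK', hK₁⟩ := Ideal.exists_fg_le_map_eq (φ := q₁) (K := H.fil 1) (by rwa [e1])
  obtain ⟨L, hL, hL', hL₂⟩ := Ideal.exists_fg_le_map_eq (φ := q₂) (K := H.fil 1) (by rwa [e2])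
  refine ⟨K ⊔ L, Submodule.FG.sup hK' hL', ?_, ?_⟩
  · rw [Ideal.map_sup, hK₁, e1, sup_eq_left]
    exact (Ideal.map_mono hL).trans e1.le
  · rw [Ideal.map_sup, hL₂, e2, sup_eq_right]
    exact (Ideal.map_mono hK).trans e2.le

theorem exists_pow_mul_mem_fil (H : IsAdicGluing q₁ q₂ p₁ p₂ I₁ I₂ f) {n : ℕ} {x : R}
    (hx : q₁ x ∈ I₁ ^ n) : ∃ m, f ^ m * x ∈ H.fil n := by
  have h1 : p₂ (q₂ x) ∈ I₂.map p₂ ^ n := by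
    rw [← H.comm, ← H.map_eq, ← Ideal.map_pow]
    exact Ideal.mem_map_of_mem _ hx
  obtain ⟨m, hm⟩ := H.loc₂.inj n _ h1
  refine ⟨m, H.mem_fil.2 ⟨?_, ?_⟩⟩
  · rw [map_mul]
    exact Ideal.mul_mem_left _ _ hx
  · rwa [map_mul, map_pow]

/-- Up to a power of `f`, an element of the filtration is congruent to an element of `I ^ n` modulo
the next step of the filtration. -/
theorem exists_pow_mul_mem_sup (H : IsAdicGluing q₁ q₂ p₁ p₂ I₁ I₂ f) {I : Ideal R}
    (h₁ : I.map q₁ = I₁) {n : ℕ} {x : R} (hx : x ∈ H.fil n) :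
    ∃ m, f ^ m * x ∈ I ^ n ⊔ H.fil (n + 1) := by
  have h1 : q₁ x ∈ (I ^ n).map q₁ := by
    rw [Ideal.map_pow, h₁]
    exact (H.mem_fil.1 hx).1
  obtain ⟨m, c, hc, h2⟩ := exists_approx_of_mem_map (f := f) (I := I) (fun k x => by
    obtain ⟨m, c, -, hc⟩ := H.exists_approx (Nat.zero_le k) (r := x) (by simp)
    exact ⟨m, c, by rwa [h₁]⟩) (I ^ n) 1 h1
  rw [Ideal.map_pow, ← pow_add, h₁, ← map_pow, ← map_mul, ← map_sub] at h2
  obtain ⟨l, hl⟩ := H.exists_pow_mul_mem_fil h2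
  refine ⟨l + m, ?_⟩
  have := Submodule.add_mem_sup (Ideal.mul_mem_left (I ^ n) (f ^ l) hc) hl
  convert this using 1
  ring

section

variable (H : IsAdicGluing q₁ q₂ p₁ p₂ I₁ I₂ f) {I : Ideal R} (hI : I.FG) (h₁ : I.map q₁ = I₁)
  (h₂ : I.map q₂ = I₂)

include H

theorem fil_antitone : Antitone H.fil := fun _ _ h => inf_le_inf
  (Ideal.comap_mono (Ideal.pow_le_pow_right h)) (Ideal.comap_mono (Ideal.pow_le_pow_right h))

theorem eq_zero_of_mem_fil (x : R) (hx : ∀ n, x ∈ H.fil n) : x = 0 :=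
  H.inj x (((isAdicComplete_iff_seq _).1 H.complete₁).1 _ fun n => (hx n).1)
    (((isAdicComplete_iff_seq _).1 H.complete₂).1 _ fun n => (hx n).2)

/-- The ring `R` is complete for the filtration, as limits in `R₁` and `R₂` glue. -/
theorem exists_limit (s : ℕ → R) (hs : ∀ n, s (n + 1) - s n ∈ H.fil n) :
    ∃ l, ∀ n, l - s n ∈ H.fil n := by
  obtain ⟨l₁, hl₁⟩ := ((isAdicComplete_iff_seq _).1 H.complete₁).2 (fun n => q₁ (s n)) fun n => by
    rw [← map_sub]
    exact (hs n).1
  obtain ⟨l₂, hl₂⟩ := ((isAdicComplete_iff_seq _).1 H.complete₂).2 (fun n => q₂ (s n)) fun n => by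
    rw [← map_sub]
    exact (hs n).2
  obtain ⟨l, rfl, rfl⟩ := H.exact l₁ l₂ (sub_eq_zero.1
    (((isAdicComplete_iff_seq _).1 H.loc₁.complete).1 _ fun n => by
      have e1 : p₁ (l₁ - q₁ (s n)) ∈ I₁.map p₁ ^ n := by
        rw [← Ideal.map_pow]
        exact Ideal.mem_map_of_mem _ (hl₁ n)
      have e2 : p₂ (l₂ - q₂ (s n)) ∈ I₁.map p₁ ^ n := by
        rw [H.map_eq, ← Ideal.map_pow]
        exact Ideal.mem_map_of_mem _ (hl₂ n)
      have := Ideal.sub_mem _ e1 e2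
      convert this using 1
      rw [map_sub, map_sub, H.comm]
      ring))
  refine ⟨l, fun n => H.mem_fil.2 ?_⟩
  rw [map_sub, map_sub]
  exact ⟨hl₁ n, hl₂ n⟩

include h₁ h₂

theorem pow_le_fil (n : ℕ) : I ^ n ≤ H.fil n := by
  refine le_inf ?_ ?_
  · rw [← Ideal.map_le_iff_le_comap, Ideal.map_pow, h₁]
  · rw [← Ideal.map_le_iff_le_comap, Ideal.map_pow, h₂]

/-- The associated graded ring of the filtration is generated by the powers of `I`: this holds after
multiplication by powers of `f` and of `1 - f`, which generate the unit ideal. -/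
theorem fil_le_sup (n : ℕ) : H.fil n ≤ I ^ n ⊔ H.fil (n + 1) := by
  intro x hx
  obtain ⟨a, ha⟩ := H.exists_pow_mul_mem_sup h₁ hx
  obtain ⟨b, hb⟩ := H.symm.exists_pow_mul_mem_sup h₂ (by rwa [H.symm_fil])
  rw [H.symm_fil] at hb
  obtain ⟨α, β, h⟩ : IsCoprime (f ^ a) ((1 - f) ^ b) := IsCoprime.pow ⟨1, 1, by ring⟩
  have := Submodule.add_mem _ (Ideal.mul_mem_left _ α ha) (Ideal.mul_mem_left _ β hb)
  convert this using 1
  linear_combination (-x) * h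

include hI

theorem fil_eq_pow (n : ℕ) : H.fil n = I ^ n :=
  eq_pow_of_complete_filtration hI H.fil_antitone (H.pow_le_fil h₁ h₂) (H.fil_le_sup h₁ h₂)
    H.eq_zero_of_mem_fil H.exists_limit n

theorem isAdicComplete : IsAdicComplete I R :=
  isAdicComplete_of_complete_filtration hI H.fil_antitone (H.pow_le_fil h₁ h₂) (H.fil_le_sup h₁ h₂)
    H.eq_zero_of_mem_fil H.exists_limit

/-- Completed localizations away from `h` glue. -/
theorem isAdicLocalization {R' R₁' R₂' P' : Type*} [CommRing R'] [CommRing R₁'] [CommRing R₂']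
    [CommRing P'] {q₁' : R' →+* R₁'} {q₂' : R' →+* R₂'} {p₁' : R₁' →+* P'} {p₂' : R₂' →+* P'}
    {t : R →+* R'} {t₁ : R₁ →+* R₁'} {t₂ : R₂ →+* R₂'} {tP : P →+* P'} {h : R}
    (H' : IsAdicGluing q₁' q₂' p₁' p₂' (I₁.map t₁) (I₂.map t₂) (t f))
    (e₁ : ∀ x, q₁' (t x) = t₁ (q₁ x)) (e₂ : ∀ x, q₂' (t x) = t₂ (q₂ x))
    (d₁ : ∀ x, p₁' (t₁ x) = tP (p₁ x)) (d₂ : ∀ x, p₂' (t₂ x) = tP (p₂ x))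
    (L₁ : IsAdicLocalization I₁ (q₁ h) t₁) (L₂ : IsAdicLocalization I₂ (q₂ h) t₂)
    (LP : IsAdicLocalization (I₁.map p₁) (p₁ (q₁ h)) tP) (hu : IsUnit (t h)) :
    IsAdicLocalization I h t := by
  have h₁' : (I.map t).map q₁' = I₁.map t₁ := by
    rw [← h₁, Ideal.map_map, Ideal.map_map]
    congr 1
    ext x
    exact e₁ x
  have h₂' : (I.map t).map q₂' = I₂.map t₂ := by
    rw [← h₂, Ideal.map_map, Ideal.map_map]
    congr 1
    ext x
    exact e₂ x
  have hP : (I₁.map t₁).map p₁' = (I₁.map p₁).map tP := by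
    rw [Ideal.map_map, Ideal.map_map]
    congr 1
    ext x
    exact d₁ x
  refine ⟨hu, H'.isAdicComplete (hI.map t) h₁' h₂', fun n x => ?_, fun n a ha => ?_⟩
  · obtain ⟨m₁, a₁, ha₁⟩ := L₁.surj n (q₁' x)
    obtain ⟨m₂, a₂, ha₂⟩ := L₂.surj n (q₂' x)
    have hz : tP (p₁ (q₁ h ^ m₂ * a₁) - p₂ (q₂ h ^ m₁ * a₂)) ∈ (I₁.map p₁).map tP ^ n := by
      rw [← hP]
      have c₁ := Ideal.mul_mem_left _ (p₁' (t₁ (q₁ h)) ^ m₂) (Ideal.mem_map_of_mem p₁' ha₁)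
      have c₂ := Ideal.mul_mem_left _ (p₂' (t₂ (q₂ h)) ^ m₁) (Ideal.mem_map_of_mem p₂' ha₂)
      rw [Ideal.map_pow] at c₁ c₂
      rw [← H'.map_eq] at c₂
      have := Ideal.sub_mem _ c₂ c₁
      convert this using 1
      simp only [map_sub, map_mul, map_pow, ← d₁, ← d₂, ← e₁, ← e₂, H'.comm]
      ring
    obtain ⟨l, hl⟩ := LP.inj n _ hz
    obtain ⟨z₁, hz₁, z₂, hz₂, hz⟩ := H.split n hl
    obtain ⟨c, hc₁, hc₂⟩ := H.exact (q₁ h ^ l * (q₁ h ^ m₂ * a₁) - z₁)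
      (q₂ h ^ l * (q₂ h ^ m₁ * a₂) + z₂) (by
        simp only [map_sub, map_mul, map_pow, map_add, H.comm] at hz ⊢
        linear_combination hz)
    refine ⟨l + m₁ + m₂, c, ?_⟩
    rw [← H'.fil_eq_pow (hI.map t) h₁' h₂', H'.mem_fil]
    constructor
    · have e := Ideal.add_mem _ (Ideal.mul_mem_left _ (t₁ (q₁ h) ^ (l + m₂)) ha₁)
        (Ideal.pow_right_mono le_rfl n (by
          rw [← Ideal.map_pow]
          exact Ideal.mem_map_of_mem t₁ hz₁))
      convert e using 1
      simp only [map_sub, map_mul, map_pow, e₁, hc₁]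
      ring
    · have e := Ideal.sub_mem _ (Ideal.mul_mem_left _ (t₂ (q₂ h) ^ (l + m₁)) ha₂)
        (Ideal.pow_right_mono le_rfl n (by
          rw [← Ideal.map_pow]
          exact Ideal.mem_map_of_mem t₂ hz₂))
      convert e using 1
      simp only [map_sub, map_mul, map_pow, map_add, e₂, hc₂]
      ring
  · rw [← H'.fil_eq_pow (hI.map t) h₁' h₂', H'.mem_fil, e₁, e₂] at ha
    obtain ⟨m₁, hm₁⟩ := L₁.inj n _ ha.1
    obtain ⟨m₂, hm₂⟩ := L₂.inj n _ ha.2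
    refine ⟨m₁ + m₂, ?_⟩
    rw [← H.fil_eq_pow hI h₁ h₂, H.mem_fil, map_mul, map_mul, map_pow, map_pow]
    constructor
    · rw [pow_add, mul_comm (q₁ h ^ m₁), mul_assoc]
      exact Ideal.mul_mem_left _ _ hm₁
    · rw [pow_add, mul_assoc]
      exact Ideal.mul_mem_left _ _ hm₂

end

end IsAdicGluing

/-- Changing the ideal of definition of `R₂`, its extension to the completed localization `P` of
both `R₁` and `R₂` becomes equal to the extension of the ideal of definition of `R₁`. -/
theorem exists_ideal_map_eq {R₁ R₂ P : Type*} [CommRing R₁] [CommRing R₂] [CommRing P]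
    {p₁ : R₁ →+* P} {p₂ : R₂ →+* P} {I₁ : Ideal R₁} {I₂ : Ideal R₂} {f₂ : R₂}
    (H₂ : IsAdicLocalization I₂ f₂ p₂) (h₁ : I₁.FG) (h₂ : I₂.FG) {a b : ℕ}
    (ha : I₁.map p₁ ^ a ≤ I₂.map p₂) (hb : I₂.map p₂ ^ b ≤ I₁.map p₁) :
    ∃ J : Ideal R₂, J.FG ∧ J.map p₂ = I₁.map p₁ ∧ (∃ k, I₂ ^ k ≤ J) ∧ ∃ l, J ^ l ≤ I₂ := by
  -- intersecting with the radical makes `K` topologically nilpotent, and does not change `K P`,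
  -- because `I₁` and `I₂` have the same radical in `P`
  let K : Ideal R₂ := (I₁.map p₁).comap p₂ ⊓ I₂.radical
  have hK : K.map p₂ = I₁.map p₁ := by
    refine le_antisymm (Ideal.map_le_iff_le_comap.2 inf_le_left) ?_
    refine Submodule.le_of_le_smul_of_le_jacobson_bot (h₁.map p₁) H₂.complete.le_jacobson_bot ?_
    intro x hx
    obtain ⟨m, s, hs⟩ := H₂.surj (1 + b) x
    rw [pow_add, pow_one] at hs
    have hs' := Ideal.mul_mono_right hb hs
    have h3 : p₂ s ∈ I₁.map p₁ := by
      have := Ideal.sub_mem _ (Ideal.mul_mem_left _ (p₂ f₂ ^ m) hx) (Ideal.mul_le_right hs')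
      rwa [sub_sub_cancel] at this
    have h4 : p₂ (s ^ (a + 1)) ∈ I₂.map p₂ := by
      rw [map_pow]
      exact ha (Ideal.pow_le_pow_right a.le_succ (Ideal.pow_mem_pow h3 _))
    obtain ⟨k, hk⟩ := H₂.exists_pow_mul_mem (N := 1) (pow_one I₂).le h4
    have h5 : f₂ ^ k * s ∈ K := by
      refine ⟨?_, a + 1, ?_⟩
      · change p₂ (f₂ ^ k * s) ∈ I₁.map p₁
        rw [map_mul]
        exact Ideal.mul_mem_left _ _ h3
      · convert I₂.mul_mem_left ((f₂ ^ k) ^ a) hk using 1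
        ring
    refine (H₂.isUnit.pow (k + m)).mul_mem_iff.1 ?_
    rw [smul_eq_mul]
    have h6 := Submodule.add_mem_sup (Ideal.mem_map_of_mem p₂ h5)
      (Ideal.mul_mem_left _ (p₂ f₂ ^ k) hs')
    convert h6 using 1
    rw [map_mul, map_pow]
    ring
  obtain ⟨K', hK', hfg, hK''⟩ := Ideal.exists_fg_le_map_eq (φ := p₂) (K := K) (by
    rw [hK]
    exact h₁.map p₁)
  -- adding a power of `I₂` that is contained in `I₁` over `P` makes the ideal open
  have hfg' : (K' ⊔ I₂ ^ (b + 1)).FG := Submodule.FG.sup hfg (h₂.pow)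
  refine ⟨K' ⊔ I₂ ^ (b + 1), hfg', ?_, ⟨b + 1, le_sup_right⟩, ?_⟩
  · rw [Ideal.map_sup, hK'', hK, Ideal.map_pow, sup_eq_left]
    exact (Ideal.pow_le_pow_right b.le_succ).trans hb
  · refine Ideal.exists_pow_le_of_le_radical_of_fg (sup_le (hK'.trans inf_le_right) ?_) hfg'
    exact (Ideal.pow_le_self b.succ_ne_zero).trans Ideal.le_radical

/-! ### Fibre products of adically complete rings -/

/-- A commutative square of rings which is a fibre product. -/
structure IsFibreProduct {A R B C : Type*} [CommRing A] [CommRing R] [CommRing B] [CommRing C]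
    (a : A →+* R) (b : A →+* B) (u : R →+* C) (v : B →+* C) : Prop where
  comm : ∀ x, u (a x) = v (b x)
  inj : ∀ x, a x = 0 → b x = 0 → x = 0
  exact : ∀ r s, u r = v s → ∃ x, a x = r ∧ b x = s

namespace IsFibreProduct

variable {A R B C : Type*} [CommRing A] [CommRing R] [CommRing B] [CommRing C]
  {a : A →+* R} {b : A →+* B} {u : R →+* C} {v : B →+* C} {w : A}

/-- As `a w` maps to zero in `C`, all multiples of `a w` come from `A`. -/
theorem mem_span_pow (H : IsFibreProduct a b u v) (hw : b w = 0) {n : ℕ} {x : A}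
    (hb : b x = 0) (ha : a x ∈ Ideal.span {a w} ^ (n + 1)) : x ∈ Ideal.span {w} ^ n := by
  rw [Ideal.span_singleton_pow, Ideal.mem_span_singleton] at ha ⊢
  obtain ⟨s, hs⟩ := ha
  obtain ⟨c, hc, hc'⟩ := H.exact (a w * s) 0 (by
    rw [map_mul, H.comm, hw, map_zero, zero_mul])
  refine ⟨c, sub_eq_zero.1 (H.inj _ ?_ ?_)⟩
  · rw [map_sub, map_mul, map_pow, hs, hc]
    ring
  · rw [map_sub, map_mul, hc', hb, mul_zero, sub_zero]

theorem map_mem_span_pow {n : ℕ} {x : A} (h : x ∈ Ideal.span {w} ^ n) :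
    a x ∈ Ideal.span {a w} ^ n := by
  have := Ideal.mem_map_of_mem a h
  rwa [Ideal.map_pow, Ideal.map_span, Set.image_singleton] at this

theorem map_eq_zero_of_mem (hw : b w = 0) {n : ℕ} {x : A} (h : x ∈ Ideal.span {w} ^ (n + 1)) :
    b x = 0 := by
  rw [Ideal.span_singleton_pow, Ideal.mem_span_singleton] at h
  obtain ⟨c, rfl⟩ := h
  rw [map_mul, map_pow, hw, pow_succ, mul_zero, zero_mul]

/-- The fibre product inherits completeness from `R`: in `B`, where `w` vanishes, Cauchy sequences
are eventually constant. -/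
theorem isAdicComplete (H : IsFibreProduct a b u v) (hw : b w = 0)
    (hR : IsAdicComplete (Ideal.span {a w}) R) : IsAdicComplete (Ideal.span {w}) A := by
  obtain ⟨h1, h2⟩ := (isAdicComplete_iff_seq _).1 hR
  refine (isAdicComplete_iff_seq _).2 ⟨fun x hx => H.inj x (h1 _ fun n => map_mem_span_pow (hx n))
    (map_eq_zero_of_mem hw (hx 1)), fun s hs => ?_⟩
  obtain ⟨l, hl⟩ := h2 (fun n => a (s n)) fun n => by
    rw [← map_sub]
    exact map_mem_span_pow (hs n)
  have hb (n : ℕ) : b (s (n + 1)) = b (s 1) := by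
    induction n with
    | zero => rfl
    | succ n ih =>
      rw [← ih, ← sub_eq_zero, ← map_sub]
      exact map_eq_zero_of_mem hw (hs (n + 1))
  have huw : u (a w) = 0 := by rw [H.comm, hw, map_zero]
  obtain ⟨x, rfl, hx⟩ := H.exact l (b (s 1)) (by
    rw [← H.comm, ← sub_eq_zero, ← map_sub]
    have := hl 1
    rw [pow_one, Ideal.mem_span_singleton] at this
    obtain ⟨c, hc⟩ := this
    rw [hc, map_mul, huw, zero_mul])
  refine ⟨x, fun n => ?_⟩
  have e : x - s (n + 1) ∈ Ideal.span {w} ^ n := by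
    refine H.mem_span_pow hw ?_ ?_
    · rw [map_sub, hx, hb n, sub_self]
    · rw [map_sub]
      exact hl (n + 1)
  have := Ideal.add_mem _ e (hs n)
  rwa [sub_add_sub_cancel] at this

/-- If `v` is injective and `R / √(a w) ⊆ C`, then the kernel of `A → B` is the radical of `(w)`. -/
theorem ker_eq_radical (H : IsFibreProduct a b u v) (hv : Function.Injective v) (hw : b w = 0)
    (hu : RingHom.ker u = (Ideal.span {a w}).radical) :
    RingHom.ker b = (Ideal.span {w}).radical := by
  ext x
  constructor
  · intro hx
    have h1 : a x ∈ (Ideal.span {a w}).radical := by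
      rw [← hu, RingHom.mem_ker, H.comm, RingHom.mem_ker.1 hx, map_zero]
    obtain ⟨n, hn⟩ := h1
    refine ⟨n * 2 + 1, ?_⟩
    rw [← pow_one (Ideal.span {w})]
    refine H.mem_span_pow hw ?_ ?_
    · rw [map_pow, RingHom.mem_ker.1 hx, pow_succ, mul_zero]
    · rw [map_pow, pow_succ (a x), pow_mul]
      exact Ideal.mul_mem_right _ _ (Ideal.pow_mem_pow hn 2)
  · rintro ⟨n, hn⟩
    rw [Ideal.mem_span_singleton] at hn
    obtain ⟨c, hc⟩ := hn
    have h2 : a x ∈ (Ideal.span {a w}).radical := ⟨n, by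
      rw [← map_pow, hc, map_mul]
      exact Ideal.mul_mem_right _ _ (Ideal.mem_span_singleton_self _)⟩
    rw [← hu, RingHom.mem_ker, H.comm] at h2
    exact hv (h2.trans (map_zero v).symm)

/-- Completed localizations are compatible with fibre products. -/
theorem isAdicLocalization {A' R' B' C' : Type*} [CommRing A'] [CommRing R'] [CommRing B']
    [CommRing C'] {a' : A' →+* R'} {b' : A' →+* B'} {u' : R' →+* C'} {v' : B' →+* C'}
    (H : IsFibreProduct a b u v) (H' : IsFibreProduct a' b' u' v')
    {t : A →+* A'} {tR : R →+* R'} {tB : B →+* B'} {tC : C →+* C'}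
    (ea : ∀ x, a' (t x) = tR (a x)) (eb : ∀ x, b' (t x) = tB (b x))
    (eu : ∀ x, u' (tR x) = tC (u x)) (ev : ∀ x, v' (tB x) = tC (v x)) (hw : b w = 0) {f : A}
    (LR : IsAdicLocalization (Ideal.span {a w}) (a f) tR) (LB : IsAdicLocalization ⊥ (b f) tB)
    (LC : IsAdicLocalization ⊥ (v (b f)) tC) (hu : IsUnit (t f)) :
    IsAdicLocalization (Ideal.span {w}) f t := by
  have hw' : b' (t w) = 0 := by rw [eb, hw, map_zero]
  have hR : (Ideal.span {a w}).map tR = Ideal.span {a' (t w)} := by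
    rw [Ideal.map_span, Set.image_singleton, ea]
  have hA : (Ideal.span {w}).map t = Ideal.span {t w} := by
    rw [Ideal.map_span, Set.image_singleton]
  have zB {x : B} (hx : tB x = 0) : ∃ m, b f ^ m * x = 0 := by
    obtain ⟨m, hm⟩ := LB.inj 1 x (by rw [hx]; exact zero_mem _)
    rw [pow_one] at hm
    exact ⟨m, hm⟩
  have surj : ∀ n x, ∃ m c, t f ^ m * x - t c ∈ Ideal.span {t w} ^ n ∧
      a' (t f ^ m * x - t c) ∈ Ideal.span {a' (t w)} ^ (n + 1) := by
    intro n x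
    obtain ⟨m₁, r, hr⟩ := LR.surj (n + 1) (a' x)
    obtain ⟨m₂, s, hs⟩ := LB.surj 1 (b' x)
    rw [Ideal.map_bot, pow_one, Ideal.mem_bot, sub_eq_zero] at hs
    have h1 : u' (tR (a f) ^ m₁ * a' x) = u' (tR r) := by
      rw [hR, pow_succ] at hr
      rw [← sub_eq_zero, ← map_sub]
      obtain ⟨c, hc⟩ := Ideal.mem_span_singleton.1 (Ideal.mul_le_right hr)
      rw [hc, map_mul, H'.comm, hw', map_zero, zero_mul]
    have h2 : tC (u (a f ^ m₂ * r) - v (b f ^ m₁ * s)) = 0 := by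
      rw [map_sub, ← eu, ← ev]
      simp only [map_mul, ← h1, ← hs]
      simp only [map_pow, ← ea, ← eb, H'.comm]
      ring
    obtain ⟨l, hl⟩ := LC.inj 1 _ (by rw [h2]; exact zero_mem _)
    rw [pow_one, Ideal.mem_bot] at hl
    obtain ⟨c, hc, hc'⟩ := H.exact (a f ^ l * (a f ^ m₂ * r)) (b f ^ l * (b f ^ m₁ * s)) (by
      rw [← sub_eq_zero, ← hl]
      simp only [map_mul, map_pow, H.comm]
      ring)
    have h3 : a' (t f ^ (l + m₁ + m₂) * x - t c) ∈ Ideal.span {a' (t w)} ^ (n + 1) := by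
      rw [hR] at hr
      convert Ideal.mul_mem_left _ (tR (a f) ^ (l + m₂)) hr using 1
      simp only [map_sub, map_mul, map_pow, ea, hc]
      ring
    refine ⟨l + m₁ + m₂, c, H'.mem_span_pow hw' ?_ h3, h3⟩
    simp only [map_sub, map_mul, map_pow, eb, hc', ← hs]
    ring
  refine ⟨hu, ?_, fun n x => ?_, fun n x hx => ?_⟩
  · rw [hA]
    refine H'.isAdicComplete hw' ?_
    rw [← hR]
    exact LR.complete
  · obtain ⟨m, c, h, -⟩ := surj n x
    rw [hA]
    exact ⟨m, c, h⟩
  · rw [hA, Ideal.span_singleton_pow, Ideal.mem_span_singleton] at hx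
    obtain ⟨y, hy⟩ := hx
    obtain ⟨m, c, h, h'⟩ := surj 1 y
    have e1 : t (f ^ m * x - w ^ n * c) = t w ^ n * (t f ^ m * y - t c) := by
      simp only [map_sub, map_mul, map_pow, hy]
      ring
    have e2 : tR (a (f ^ m * x - w ^ n * c)) ∈ (Ideal.span {a w}).map tR ^ (n + 1) := by
      rw [← ea, e1, map_mul, map_pow, hR, pow_add]
      exact Ideal.mul_mem_mul (Ideal.pow_mem_pow (Ideal.mem_span_singleton_self _) n)
        (Ideal.pow_le_pow_right one_le_two h')
    have e3 : tB (b (f ^ m * x - w ^ n * c)) = 0 := by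
      rw [← eb, e1, map_mul, map_eq_zero_of_mem hw' (n := 0) h, mul_zero]
    obtain ⟨k, hk⟩ := LR.inj _ _ e2
    obtain ⟨l, hl⟩ := zB e3
    have e4 : f ^ (k + l) * (f ^ m * x - w ^ n * c) ∈ Ideal.span {w} ^ n := by
      refine H.mem_span_pow hw ?_ ?_
      · rw [map_mul, map_pow, pow_add, mul_assoc, hl, mul_zero]
      · rw [map_mul, map_pow, pow_add (a f), mul_comm (a f ^ k), mul_assoc]
        exact Ideal.mul_mem_left _ _ hk
    refine ⟨k + l + m, ?_⟩
    have e5 : w ^ n ∈ Ideal.span {w} ^ n := Ideal.pow_mem_pow (Ideal.mem_span_singleton_self _) n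
    convert Ideal.add_mem _ e4 (Ideal.mul_mem_left _ (f ^ (k + l) * c) e5) using 1
    ring

end IsFibreProduct

/-! ### Adic topologies -/

theorem isTopologicalRing_adicTopology {L : Type*} [CommRing L] (I : Ideal L) :
    @IsTopologicalRing L I.adicTopology _ :=
  (Ideal.adic_basis I).toRing_subgroups_basis.toRingFilterBasis.isTopologicalRing

/-- A ring topology is determined by its neighbourhoods of zero. -/
theorem eq_adicTopology {L : Type*} [CommRing L] {I : Ideal L} {t : TopologicalSpace L}
    (ht : @IsTopologicalRing L t _)
    (h : (@nhds L t 0).HasBasis (fun _ : ℕ => True) fun n => ((I ^ n : Ideal L) : Set L)) :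
    t = I.adicTopology := by
  refine @IsTopologicalAddGroup.ext L _ t I.adicTopology ?_ ?_ ?_
  · let _ := t
    exact ht.to_topologicalAddGroup
  · let _ := I.adicTopology
    have := isTopologicalRing_adicTopology I
    infer_instance
  · exact h.eq_of_same_basis (Ideal.hasBasis_nhds_zero_adic I)

/-- Ideals that define the same adic topology contain powers of each other. -/
theorem exists_pow_le_of_adicTopology_eq {L : Type*} [CommRing L] {I I' : Ideal L}
    (h : I.adicTopology = I'.adicTopology) : ∃ k, I ^ k ≤ I' := by
  have h1 : ((I' : Ideal L) : Set L) ∈ @nhds L I.adicTopology 0 := by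
    rw [h]
    have := (Ideal.hasBasis_nhds_zero_adic I').mem_of_mem (i := 1) trivial
    rwa [pow_one] at this
  obtain ⟨k, -, hk⟩ := (Ideal.hasBasis_nhds_zero_adic I).mem_iff.1 h1
  exact ⟨k, hk⟩

theorem adicTopology_eq_of_pow_le {L : Type*} [CommRing L] {I I' : Ideal L} {k l : ℕ}
    (h1 : I ^ k ≤ I') (h2 : I' ^ l ≤ I) : I.adicTopology = I'.adicTopology := by
  refine eq_adicTopology (isTopologicalRing_adicTopology I) ?_
  refine (Ideal.hasBasis_nhds_zero_adic I).to_hasBasis (fun n _ => ⟨l * n, trivial, ?_⟩)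
    fun n _ => ⟨k * n, trivial, ?_⟩
  · rw [pow_mul]
    exact Ideal.pow_right_mono h2 n
  · rw [pow_mul]
    exact Ideal.pow_right_mono h1 n

theorem hasBasis_nhds_zero_induced {L L' : Type*} [CommRing L] [CommRing L'] (φ : L →+* L')
    {t : TopologicalSpace L'} {F : ℕ → Ideal L'}
    (h : (@nhds L' t 0).HasBasis (fun _ : ℕ => True) fun n => (F n : Set L')) :
    (@nhds L (t.induced φ) 0).HasBasis (fun _ : ℕ => True)
      fun n => ((F n).comap φ : Set L) := by
  rw [nhds_induced, map_zero]
  exact h.comap φ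

theorem hasBasis_nhds_zero_inf {L : Type*} [CommRing L] {t t' : TopologicalSpace L}
    {F F' : ℕ → Ideal L} (hF : Antitone F) (hF' : Antitone F')
    (h : (@nhds L t 0).HasBasis (fun _ : ℕ => True) fun n => (F n : Set L))
    (h' : (@nhds L t' 0).HasBasis (fun _ : ℕ => True) fun n => (F' n : Set L)) :
    (@nhds L (t ⊓ t') 0).HasBasis (fun _ : ℕ => True)
      fun n => ((F n ⊓ F' n : Ideal L) : Set L) := by
  rw [nhds_inf (t₁ := t) (t₂ := t')]
  refine (h.inf h').to_hasBasis (fun n _ => ⟨max n.1 n.2, trivial, ?_⟩)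
    fun n _ => ⟨(n, n), ⟨trivial, trivial⟩, subset_rfl⟩
  exact Set.inter_subset_inter (hF (le_max_left _ _)) (hF' (le_max_right _ _))

/-- The coarsest topology for which a sequence of homomorphisms to discrete rings is continuous. -/
theorem iInf_induced_bot_eq_adicTopology {L : Type*} [CommRing L] {I : Ideal L} {Q : ℕ → Type*}
    [∀ n, CommRing (Q n)] (g : ∀ n, L →+* Q n) (hg : ∀ n, RingHom.ker (g n) = I ^ (n + 1)) :
    ⨅ n, (⊥ : TopologicalSpace (Q n)).induced (g n) = I.adicTopology := by
  refine eq_adicTopology (isTopologicalRing_iInf _ fun n => isTopologicalRing_induced _ _ ?_) ?_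
  · let _ : TopologicalSpace (Q n) := ⊥
    have : DiscreteTopology (Q n) := ⟨rfl⟩
    infer_instance
  · have h (n : ℕ) : @nhds L ((⊥ : TopologicalSpace (Q n)).induced (g n)) 0 =
        Filter.principal ((I ^ (n + 1) : Ideal L) : Set L) := by
      let _ : TopologicalSpace (Q n) := ⊥
      have : DiscreteTopology (Q n) := ⟨rfl⟩
      rw [nhds_induced, map_zero, nhds_discrete, Filter.comap_pure, ← hg]
      rfl
    rw [nhds_iInf]
    simp_rw [h]
    refine (Filter.hasBasis_iInf_principal (directed_of_isDirected_le ?_)).to_hasBasis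
      (fun n _ => ⟨n + 1, trivial, subset_rfl⟩)
      fun n _ => ⟨n, trivial, Ideal.pow_le_pow_right n.le_succ⟩
    exact fun m n hmn => Ideal.pow_le_pow_right (Nat.add_le_add_right hmn 1)

/-- The topology of the glued ring as a subring of `R₁ × R₂` is the adic one. -/
theorem IsAdicGluing.induced_inf_induced_eq {R R₁ R₂ P : Type*} [CommRing R] [CommRing R₁]
    [CommRing R₂] [CommRing P] {q₁ : R →+* R₁} {q₂ : R →+* R₂} {p₁ : R₁ →+* P} {p₂ : R₂ →+* P}
    {I₁ : Ideal R₁} {I₂ : Ideal R₂} {f : R} (H : IsAdicGluing q₁ q₂ p₁ p₂ I₁ I₂ f) {I : Ideal R}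
    (hI : I.FG) (h₁ : I.map q₁ = I₁) (h₂ : I.map q₂ = I₂) :
    I₁.adicTopology.induced q₁ ⊓ I₂.adicTopology.induced q₂ = I.adicTopology := by
  refine eq_adicTopology ?_ ?_
  · rw [inf_eq_iInf]
    refine isTopologicalRing_iInf _ fun b => ?_
    cases b
    · exact isTopologicalRing_induced _ _ (isTopologicalRing_adicTopology _)
    · exact isTopologicalRing_induced _ _ (isTopologicalRing_adicTopology _)
  · simp_rw [← H.fil_eq_pow hI h₁ h₂]
    exact hasBasis_nhds_zero_inf
      (fun _ _ h => Ideal.comap_mono (Ideal.pow_le_pow_right h))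
      (fun _ _ h => Ideal.comap_mono (Ideal.pow_le_pow_right h))
      (hasBasis_nhds_zero_induced q₁ (Ideal.hasBasis_nhds_zero_adic I₁))
      (hasBasis_nhds_zero_induced q₂ (Ideal.hasBasis_nhds_zero_adic I₂))

/-- The topology of the fibre product as a subring of `R × B`, with `B` discrete, is the `(w)`-adic
one. -/
theorem IsFibreProduct.induced_inf_induced_eq {A R B C : Type*} [CommRing A] [CommRing R]
    [CommRing B] [CommRing C] {a : A →+* R} {b : A →+* B} {u : R →+* C} {v : B →+* C} {w : A}
    (H : IsFibreProduct a b u v) (hw : b w = 0) :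
    (Ideal.span {a w}).adicTopology.induced a ⊓ (⊥ : TopologicalSpace B).induced b =
      (Ideal.span {w}).adicTopology := by
  have hB : (@nhds B ⊥ 0).HasBasis (fun _ : ℕ => True) fun _ => ((⊥ : Ideal B) : Set B) := by
    let _ : TopologicalSpace B := ⊥
    have : DiscreteTopology B := ⟨rfl⟩
    rw [nhds_discrete]
    refine ⟨fun s => ?_⟩
    simp
  refine eq_adicTopology ?_ ?_
  · rw [inf_eq_iInf]
    refine isTopologicalRing_iInf _ fun b => ?_
    cases b
    · refine isTopologicalRing_induced _ _ ?_
      let _ : TopologicalSpace B := ⊥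
      have : DiscreteTopology B := ⟨rfl⟩
      infer_instance
    · exact isTopologicalRing_induced _ _ (isTopologicalRing_adicTopology _)
  · refine (hasBasis_nhds_zero_inf
      (fun _ _ h => Ideal.comap_mono (Ideal.pow_le_pow_right h)) antitone_const
      (hasBasis_nhds_zero_induced a (Ideal.hasBasis_nhds_zero_adic _))
      (hasBasis_nhds_zero_induced b hB)).to_hasBasis (fun n _ => ⟨n + 1, trivial, ?_⟩)
      fun n _ => ⟨n + 1, trivial, ?_⟩
    · intro x hx
      exact ⟨map_mem_span_pow (Ideal.pow_le_pow_right n.le_succ hx), map_eq_zero_of_mem hw hx⟩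
    · rintro x ⟨hx, hx'⟩
      exact H.mem_span_pow hw hx' hx

/-! ### The structure sheaf of a formal spectrum -/

section Spf

variable (A : Type u) [CommRing A] (I : Ideal A)

instance : Limits.PreservesColimitsOfShape ℕ
    (LocallyRingedSpace.forgetToSheafedSpace.{u} ⋙ SheafedSpace.forgetToPresheafedSpace) := by
  have h1 : Limits.PreservesColimitsOfSize.{0, 0} LocallyRingedSpace.forgetToSheafedSpace.{u} :=
    Limits.preservesColimitsOfSize_shrink.{0, u, 0, u} _
  have h2 : Limits.PreservesColimitsOfShape ℕ LocallyRingedSpace.forgetToSheafedSpace.{u} := h1.1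
  infer_instance

instance : Limits.PreservesColimitsOfShape ℕ (LocallyRingedSpace.forgetToTop.{u}) := by
  have : LocallyRingedSpace.forgetToTop.{u} =
    (LocallyRingedSpace.forgetToSheafedSpace.{u} ⋙ SheafedSpace.forgetToPresheafedSpace) ⋙ PresheafedSpace.forget _ := rfl
  rw [this]
  infer_instance

/-- The transition morphism `Spec (A / I ^ (m + 1)) → Spec (A / I ^ (n + 1))`. -/
noncomputable abbrev thickeningMap {m n : ℕ} (h : m ≤ n) : thickening A I m ⟶ thickening A I n :=
  Spec.map (CommRingCat.ofHom (Ideal.Quotient.factor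
    (Ideal.pow_le_pow_right (Nat.add_le_add_right h 1) : I ^ (n + 1) ≤ I ^ (m + 1))))

theorem thickeningMap_spfι {m n : ℕ} (h : m ≤ n) :
    (thickeningMap A I h).toLRSHom ≫ spfι A I n = spfι A I m :=
  Limits.colimit.w (thickeningDiagram A I) (homOfLE h)

/-- The thickenings of `Spec (A / I)` all have the same points. -/
theorem thickeningMap_isHomeomorph {m n : ℕ} (h : m ≤ n) :
    IsHomeomorph (thickeningMap A I h) := by
  refine PrimeSpectrum.isHomeomorph_comap _ (fun x => ⟨1, one_pos, ?_⟩) ?_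
  · obtain ⟨y, rfl⟩ := Ideal.Quotient.mk_surjective x
    rw [pow_one]
    exact ⟨Ideal.Quotient.mk _ y, rfl⟩
  · intro x hx
    obtain ⟨y, rfl⟩ := Ideal.Quotient.mk_surjective x
    have hy : y ∈ I ^ (m + 1) := Ideal.Quotient.eq_zero_iff_mem.1 hx
    refine ⟨n + 1, ?_⟩
    rw [← map_pow]
    refine Ideal.Quotient.eq_zero_iff_mem.2 ?_
    exact Ideal.pow_mem_pow (Ideal.pow_le_self m.succ_ne_zero hy) _

/-- In a sequential diagram of isomorphisms, the maps to the colimit are isomorphisms. -/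
theorem isIso_colimitCocone_ι_of_isIso {C : Type*} [Category C] {D : ℕ ⥤ C} {c : Limits.Cocone D}
    (hc : Limits.IsColimit c) (h : ∀ {m n : ℕ} (f : m ⟶ n), IsIso (D.map f)) (n : ℕ) :
    IsIso (c.ι.app n) := by
  have h0 (n : ℕ) : IsIso (D.map (homOfLE n.zero_le)) := h _
  let s : Limits.Cocone D := ⟨D.obj 0, ⟨fun n => inv (D.map (homOfLE n.zero_le)), fun m n f => by
    change _ = inv (D.map (homOfLE m.zero_le)) ≫ 𝟙 (D.obj 0)
    rw [IsIso.comp_inv_eq, Category.comp_id, IsIso.eq_inv_comp, ← D.map_comp]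
    rfl⟩⟩
  have h1 (n : ℕ) : c.ι.app n = inv (D.map (homOfLE n.zero_le)) ≫ c.ι.app 0 := by
    rw [IsIso.eq_inv_comp, c.w]
  have h2 : IsIso (c.ι.app 0) := by
    refine ⟨hc.desc s, ?_, ?_⟩
    · rw [hc.fac]
      change inv (D.map (𝟙 0)) = _
      simp
    · refine hc.hom_ext fun n => ?_
      rw [hc.fac_assoc]
      exact (h1 n).symm.trans (Category.comp_id _).symm
  rw [h1]
  infer_instance

/-- `Spf A` has the same points as each of the thickenings. -/
theorem isHomeomorph_spfι (n : ℕ) : IsHomeomorph (spfι A I n).base := by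
  have := isIso_colimitCocone_ι_of_isIso (Limits.isColimitOfPreserves
    LocallyRingedSpace.forgetToTop.{u} (Limits.colimit.isColimit (thickeningDiagram A I)))
    (fun {m n} f => by
      rw [TopCat.isIso_iff_isHomeomorph]
      exact thickeningMap_isHomeomorph A I (leOfHom f)) n
  exact (TopCat.isIso_iff_isHomeomorph _).1 this

open PresheafedSpace in
/-- Sections of a colimit of presheafed spaces are determined by their pullbacks to the diagram. -/
theorem PresheafedSpace.colimit_ext {J : Type} [SmallCategory J]
    (F : J ⥤ PresheafedSpace.{_, _, u} CommRingCat.{u}) [Limits.HasColimit F]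
    [Limits.HasColimitsOfShape J TopCat.{u}]
    (U : Opens (Limits.colimit F).carrier) (s : (Limits.colimit F).presheaf.obj (op U))
    (h : ∀ j, (Limits.colimit.ι F j).c.app (op U) s = 0) : s = 0 := by
  have h1 : (colimitPresheafObjIsoComponentwiseLimit F U).hom s = 0 := by
    refine Limits.Concrete.limit_ext (componentwiseDiagram F U) _ _ fun j => ?_
    refine Eq.trans ?_ ((h j.unop).trans
      (map_zero (Limits.limit.π (componentwiseDiagram F U) j).hom).symm)
    exact congr($(colimitPresheafObjIsoComponentwiseLimit_hom_π F U j.unop) s)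
  have h2 := congr((colimitPresheafObjIsoComponentwiseLimit F U).inv $h1)
  simpa using h2

/-- A compatible family of sections over a diagram of presheafed spaces comes from a section of the
colimit. -/
theorem PresheafedSpace.colimit_exists {J : Type} [SmallCategory J]
    (F : J ⥤ PresheafedSpace.{_, _, u} CommRingCat.{u}) [Limits.HasColimit F]
    [Limits.HasColimitsOfShape J TopCat.{u}]
    (U : Opens (Limits.colimit F).carrier)
    (s : ∀ j, (F.obj j).presheaf.obj (op ((Opens.map (Limits.colimit.ι F j).base).obj U)))
    (h : ∀ (j k : Jᵒᵖ) (f : j ⟶ k),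
      (PresheafedSpace.componentwiseDiagram F U).map f (s j.unop) = s k.unop) :
    ∃ t, ∀ j, (Limits.colimit.ι F j).c.app (op U) t = s j := by
  let e := Limits.isLimitOfPreserves (forget CommRingCat)
    (Limits.limit.isLimit (PresheafedSpace.componentwiseDiagram F U))
  let x := (Limits.Types.isLimitEquivSections e).symm ⟨fun j => s j.unop, fun {j k} f => h j k f⟩
  have hx (j : J) : (Limits.limit.π (PresheafedSpace.componentwiseDiagram F U) (op j)) x = s j :=
    Limits.Types.isLimitEquivSections_symm_apply e _ (op j)
  refine ⟨(PresheafedSpace.colimitPresheafObjIsoComponentwiseLimit F U).inv x, fun j => ?_⟩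
  rw [← hx j]
  exact congr($(PresheafedSpace.colimitPresheafObjIsoComponentwiseLimit_inv_ι_app F U j) x)

/-- Equal morphisms act equally on sections, up to the restriction map between the preimages. -/
theorem PresheafedSpace.c_app_eq_of_eq {X Y : PresheafedSpace.{_, _, u} CommRingCat.{u}}
    {f g : X ⟶ Y} (h : f = g) (U : Opens Y.carrier) (s : Y.presheaf.obj (op U)) :
    f.c.app (op U) s = X.presheaf.map (homOfLE (show (Opens.map f.base).obj U ≤
      (Opens.map g.base).obj U by rw [h])).op (g.c.app (op U) s) := by
  subst h
  exact congr($((X.presheaf.map_id _).symm) (f.c.app (op U) s))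

theorem TopCat.Presheaf.map_map_homOfLE {X : TopCat.{u}} (P : X.Presheaf CommRingCat.{u})
    {U V W : Opens X} (h : U ≤ V) (h' : V ≤ W) (s : P.obj (op W)) :
    P.map (homOfLE h).op (P.map (homOfLE h').op s) = P.map (homOfLE (h.trans h')).op s := by
  rw [← CommRingCat.comp_apply, ← P.map_comp]
  rfl

theorem TopCat.Presheaf.map_homOfLE_refl {X : TopCat.{u}} (P : X.Presheaf CommRingCat.{u})
    {U : Opens X} (h : U ≤ U) (s : P.obj (op U)) : P.map (homOfLE h).op s = s :=
  congr($(P.map_id _) s)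

section

variable {J : Type} [SmallCategory J] (F : J ⥤ PresheafedSpace.{_, _, u} CommRingCat.{u})
  [Limits.HasColimit F] [Limits.HasColimitsOfShape J TopCat.{u}]
  {Z : PresheafedSpace.{_, _, u} CommRingCat.{u}} (e : Z ≅ Limits.colimit F)
  (i : ∀ j, F.obj j ⟶ Z) (hi : ∀ j, Limits.colimit.ι F j ≫ e.inv = i j)

include hi

/-- The lemma `PresheafedSpace.colimit_ext` for a space isomorphic to the colimit. -/
theorem PresheafedSpace.isoColimit_ext {U : Opens Z.carrier} (s : Z.presheaf.obj (op U))
    (h : ∀ j, (i j).c.app (op U) s = 0) : s = 0 := by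
  have h1 : e.inv.c.app (op U) s = 0 := by
    refine PresheafedSpace.colimit_ext F _ _ fun j => ?_
    refine (PresheafedSpace.c_app_eq_of_eq (hi j) U s).trans ?_
    rw [h j]
    exact map_zero (CommRingCat.Hom.hom _)
  have := PresheafedSpace.c_isIso_of_iso e.inv
  have : IsIso (e.inv.c.app (op U)) := inferInstance
  have h2 := congr(inv (e.inv.c.app (op U)) $h1)
  rw [← CommRingCat.comp_apply, IsIso.hom_inv_id] at h2
  exact h2.trans (map_zero (CommRingCat.Hom.hom _))

/-- The lemma `PresheafedSpace.colimit_exists` for a space isomorphic to the colimit. -/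
theorem PresheafedSpace.isoColimit_exists {U : Opens Z.carrier}
    (s : ∀ j, (F.obj j).presheaf.obj (op ((Opens.map (i j).base).obj U)))
    (h : ∀ (j k : J) (f : j ⟶ k) (hle : (Opens.map (i j).base).obj U ≤
      (Opens.map (F.map f).base).obj ((Opens.map (i k).base).obj U)),
      (F.obj j).presheaf.map (homOfLE hle).op ((F.map f).c.app _ (s k)) = s j) :
    ∃ t : Z.presheaf.obj (op U), ∀ j, (i j).c.app (op U) t = s j := by
  have hw (j : J) : (Opens.map (Limits.colimit.ι F j).base).obj ((Opens.map e.inv.base).obj U) =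
      (Opens.map (i j).base).obj U := by
    rw [← hi]
    rfl
  have := PresheafedSpace.c_isIso_of_iso e.inv
  have : IsIso (e.inv.c.app (op U)) := inferInstance
  have hc (j k : Jᵒᵖ) (f : j ⟶ k) : (PresheafedSpace.componentwiseDiagram F
      ((Opens.map e.inv.base).obj U)).map f
        ((F.obj j.unop).presheaf.map (homOfLE (hw j.unop).le).op (s j.unop)) =
      (F.obj k.unop).presheaf.map (homOfLE (hw k.unop).le).op (s k.unop) := by
    have hle : (Opens.map (i k.unop).base).obj U ≤
        (Opens.map (F.map f.unop).base).obj ((Opens.map (i j.unop).base).obj U) := by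
      rw [← hi, ← hi, ← Limits.colimit.w F f.unop]
      exact le_rfl
    rw [← h _ _ f.unop hle]
    have h1 := congr($((F.map f.unop).c.naturality (homOfLE (hw j.unop).le).op) (s j.unop))
    refine (congrArg ((F.obj k.unop).presheaf.map _) h1).trans ?_
    refine ((F.obj k.unop).presheaf.map_map_homOfLE ?_ ?_ _).trans
      ((F.obj k.unop).presheaf.map_map_homOfLE _ _ _).symm
  obtain ⟨t, ht⟩ := PresheafedSpace.colimit_exists F ((Opens.map e.inv.base).obj U)
    (fun j => (F.obj j).presheaf.map (homOfLE (hw j).le).op (s j)) hc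
  refine ⟨inv (e.inv.c.app (op U)) t, fun j => ?_⟩
  refine (PresheafedSpace.c_app_eq_of_eq (hi j).symm U _).trans ?_
  have h1 : e.inv.c.app (op U) (inv (e.inv.c.app (op U)) t) = t := by
    rw [← CommRingCat.comp_apply, IsIso.inv_hom_id]
    rfl
  refine (congrArg _ ((congrArg ((Limits.colimit.ι F j).c.app _) h1).trans (ht j))).trans ?_
  exact ((F.obj j).presheaf.map_map_homOfLE _ _ _).trans
    ((F.obj j).presheaf.map_homOfLE_refl le_rfl _)

end

/-- The isomorphism of `Spf A` with the colimit of the thickenings in presheafed spaces. -/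
noncomputable def spfIsoColimit : (spfLRS A I).toPresheafedSpace ≅
    Limits.colimit (thickeningDiagram A I ⋙
      (LocallyRingedSpace.forgetToSheafedSpace.{u} ⋙ SheafedSpace.forgetToPresheafedSpace)) :=
  preservesColimitIso (LocallyRingedSpace.forgetToSheafedSpace.{u} ⋙
    SheafedSpace.forgetToPresheafedSpace) (thickeningDiagram A I)

theorem ι_spfIsoColimit_inv (n : ℕ) :
    Limits.colimit.ι (thickeningDiagram A I ⋙ (LocallyRingedSpace.forgetToSheafedSpace.{u} ⋙
      SheafedSpace.forgetToPresheafedSpace)) n ≫ (spfIsoColimit A I).inv = (spfι A I n).toHom :=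
  ι_preservesColimitIso_inv (LocallyRingedSpace.forgetToSheafedSpace.{u} ⋙
    SheafedSpace.forgetToPresheafedSpace) (thickeningDiagram A I) n

theorem spf_ext {U : Opens (spfLRS A I).toTopCat} (s : (spfLRS A I).presheaf.obj (op U))
    (h : ∀ n, (spfι A I n).c.app (op U) s = 0) : s = 0 :=
  PresheafedSpace.isoColimit_ext _ (spfIsoColimit A I) (fun n => (spfι A I n).toHom)
    (ι_spfIsoColimit_inv A I) s h

/-- Sections of the structure sheaf of `Spf A` are compatible families of sections of the structure
sheaves of the thickenings. -/
theorem spf_exists {U : Opens (spfLRS A I).toTopCat}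
    (s : ∀ n, (thickening A I n).presheaf.obj (op ((Opens.map (spfι A I n).base).obj U)))
    (h : ∀ m n (hmn : m ≤ n) (hle : (Opens.map (spfι A I m).base).obj U ≤
      (Opens.map (thickeningMap A I hmn).base).obj ((Opens.map (spfι A I n).base).obj U)),
      (thickening A I m).presheaf.map (homOfLE hle).op
        ((thickeningMap A I hmn).c.app _ (s n)) = s m) :
    ∃ t : (spfLRS A I).presheaf.obj (op U), ∀ n, (spfι A I n).c.app (op U) t = s n :=
  PresheafedSpace.isoColimit_exists _ (spfIsoColimit A I) (fun n => (spfι A I n).toHom)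
    (ι_spfIsoColimit_inv A I) s fun m n f hle => h m n (leOfHom f) hle

end Spf

/-! ### Completed localizations as limits -/

namespace IsAdicLocalization

/-- A ring `L` which is the limit of the localizations `Q n` of `A / I ^ (n + 1)` away from `f` is
the completed localization of `A` away from `f`. -/
theorem of_limit {A L : Type*} [CommRing A] [CommRing L] {I : Ideal A} (hI : I.FG) {f : A}
    {φ : A →+* L} (hu : IsUnit (φ f)) {Q : ℕ → Type*} [∀ n, CommRing (Q n)] (g : ∀ n, L →+* Q n)
    (hs : ∀ n (y : Q n), ∃ m a, g n (φ f) ^ m * y = g n (φ a))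
    (hz : ∀ n a, g n (φ a) = 0 ↔ ∃ m, f ^ m * a ∈ I ^ (n + 1))
    (hg : ∀ n x, g (n + 1) x = 0 → g n x = 0) (hext : ∀ x, (∀ n, g n x = 0) → x = 0)
    (hlim : ∀ s : ℕ → L, (∀ n, g n (s (n + 1)) = g n (s n)) → ∃ l, ∀ n, g n l = g n (s n)) :
    IsAdicLocalization I f φ ∧ ∀ n, RingHom.ker (g n) = I.map φ ^ (n + 1) := by
  -- the filtration by the kernels of `L → Q n` satisfies `eq_pow_of_complete_filtration`
  let F : ℕ → Ideal L := fun n => match n with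
    | 0 => ⊤
    | n + 1 => RingHom.ker (g n)
  have hF : Antitone F := antitone_nat_of_succ_le fun n => by
    cases n with
    | zero => exact le_top
    | succ n => exact hg n
  have h1 (n : ℕ) : I.map φ ^ n ≤ F n := by
    cases n with
    | zero => exact le_top
    | succ n =>
      rw [← Ideal.map_pow, Ideal.map_le_iff_le_comap]
      intro a ha
      exact (hz n a).2 ⟨0, by rwa [pow_zero, one_mul]⟩
  -- an element of `L` agrees with a fraction `a / f ^ m` modulo `F n`
  have hsF (n : ℕ) (x : L) : ∃ m a, φ f ^ m * x - φ a ∈ F n := by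
    cases n with
    | zero => exact ⟨0, 0, trivial⟩
    | succ n =>
      obtain ⟨m, a, h⟩ := hs n (g n x)
      refine ⟨m, a, ?_⟩
      change g n _ = 0
      rw [map_sub, map_mul, map_pow, h, sub_self]
  have hzF (n : ℕ) (a : A) : φ a ∈ F n → ∃ m, f ^ m * a ∈ I ^ n := by
    cases n with
    | zero => exact fun _ => ⟨0, by simp⟩
    | succ n => exact (hz n a).1
  have h2 (n : ℕ) : F n ≤ I.map φ ^ n ⊔ F (n + 1) := by
    intro x hx
    obtain ⟨m, a, ha⟩ := hsF (n + 1) x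
    have ha' : φ a ∈ F n := by
      have := Ideal.sub_mem _ (Ideal.mul_mem_left _ (φ f ^ m) hx) (hF n.le_succ ha)
      rwa [sub_sub_cancel] at this
    obtain ⟨k, hk⟩ := hzF n a ha'
    refine ((hu.pow (k + m)).mul_mem_iff).1 (Submodule.mem_sup.2
      ⟨φ (f ^ k * a), ?_, φ f ^ k * (φ f ^ m * x - φ a), Ideal.mul_mem_left _ _ ha, ?_⟩)
    · rw [← Ideal.map_pow]
      exact Ideal.mem_map_of_mem _ hk
    · rw [map_mul, map_pow]
      ring
  have h3 (x : L) (hx : ∀ n, x ∈ F n) : x = 0 := hext x fun n => hx (n + 1)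
  have h4 (s : ℕ → L) (hs : ∀ n, s (n + 1) - s n ∈ F n) : ∃ l, ∀ n, l - s n ∈ F n := by
    obtain ⟨l, hl⟩ := hlim (fun n => s (n + 1)) fun n => by
      have := hs (n + 1)
      exact sub_eq_zero.1 ((map_sub (g n) _ _).symm.trans this)
    refine ⟨l, fun n => ?_⟩
    cases n with
    | zero => trivial
    | succ n => exact (map_sub (g n) _ _).trans (sub_eq_zero.2 (hl n))
  have h5 := eq_pow_of_complete_filtration (hI.map φ) hF h1 h2 h3 h4
  refine ⟨⟨hu, isAdicComplete_of_complete_filtration (hI.map φ) hF h1 h2 h3 h4, fun n x => ?_,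
    fun n a ha => ?_⟩, fun n => h5 (n + 1)⟩
  · rw [← h5]
    exact hsF n x
  · rw [← h5] at ha
    exact hzF n a ha

theorem _root_.IsAdicComplete.of_ringEquiv {L L' : Type*} [CommRing L] [CommRing L'] {I : Ideal L}
    (h : IsAdicComplete I L) (e : L ≃+* L') : IsAdicComplete (I.map (e : L →+* L')) L' := by
  have hm (n : ℕ) (x : L') : x ∈ I.map (e : L →+* L') ^ n ↔ e.symm x ∈ I ^ n := by
    rw [← Ideal.map_pow]
    constructor
    · intro hx
      obtain ⟨y, hy, rfl⟩ := (Ideal.mem_map_iff_of_surjective (e : L →+* L') e.surjective).1 hx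
      simpa using hy
    · intro hx
      simpa using Ideal.mem_map_of_mem (e : L →+* L') hx
  obtain ⟨h1, h2⟩ := (isAdicComplete_iff_seq I).1 h
  refine (isAdicComplete_iff_seq _).2 ⟨fun x hx => ?_, fun s hs => ?_⟩
  · simpa using h1 (e.symm x) fun n => (hm n x).1 (hx n)
  · obtain ⟨l, hl⟩ := h2 (fun n => e.symm (s n)) fun n => by
      rw [← map_sub]
      exact (hm n _).1 (hs n)
    refine ⟨e l, fun n => (hm n _).2 ?_⟩
    simpa using hl n

/-- Completed localizations are invariant under isomorphisms. -/
theorem of_ringEquiv {A A' L L' : Type*} [CommRing A] [CommRing A'] [CommRing L] [CommRing L']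
    {I : Ideal A} {f : A} {φ : A →+* L} (h : IsAdicLocalization I f φ) (σ : A ≃+* A')
    (τ : L ≃+* L') {φ' : A' →+* L'} (hφ : ∀ a, φ' (σ a) = τ (φ a)) :
    IsAdicLocalization (I.map (σ : A →+* A')) (σ f) φ' := by
  have hc : φ'.comp (σ : A →+* A') = (τ : L →+* L').comp φ := RingHom.ext hφ
  have hmap : (I.map (σ : A →+* A')).map φ' = (I.map φ).map (τ : L →+* L') := by
    rw [Ideal.map_map, Ideal.map_map, hc]
  have hm (n : ℕ) (x : L) (hx : x ∈ I.map φ ^ n) :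
      τ x ∈ (I.map (σ : A →+* A')).map φ' ^ n := by
    rw [hmap, ← Ideal.map_pow]
    exact Ideal.mem_map_of_mem (τ : L →+* L') hx
  refine ⟨?_, ?_, fun n x => ?_, fun n a ha => ?_⟩
  · rw [hφ]
    exact h.isUnit.map τ
  · rw [hmap]
    exact h.complete.of_ringEquiv τ
  · obtain ⟨m, a, ha⟩ := h.surj n (τ.symm x)
    refine ⟨m, σ a, ?_⟩
    rw [hφ, hφ]
    simpa using hm n _ ha
  · obtain ⟨b, rfl⟩ := σ.surjective a
    rw [hφ, hmap, ← Ideal.map_pow] at ha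
    obtain ⟨y, hy, hyb⟩ := (Ideal.mem_map_iff_of_surjective (τ : L →+* L') τ.surjective).1 ha
    obtain ⟨m, hm⟩ := h.inj n b (τ.injective hyb ▸ hy)
    refine ⟨m, ?_⟩
    rw [← map_pow, ← map_mul, ← Ideal.map_pow]
    exact Ideal.mem_map_of_mem (σ : A →+* A') hm

/-- An adically complete ring is its own completed localization away from `1`. -/
theorem of_isAdicComplete {A : Type*} [CommRing A] {I : Ideal A} (h : IsAdicComplete I A) :
    IsAdicLocalization I 1 (RingHom.id A) where
  isUnit := isUnit_one
  complete := by rwa [Ideal.map_id]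
  surj n x := ⟨0, x, by simp⟩
  inj n a ha := ⟨0, by rw [Ideal.map_id, RingHom.id_apply] at ha; rwa [pow_zero, one_mul]⟩

/-- A localization away from an element is a completed localization for the zero ideal. -/
theorem of_isLocalization {A L : Type*} [CommRing A] [CommRing L] [Algebra A L] (f : A)
    [IsLocalization.Away f L] : IsAdicLocalization ⊥ f (algebraMap A L) where
  isUnit := IsLocalization.Away.algebraMap_isUnit f
  complete := by
    rw [Ideal.map_bot]
    infer_instance
  surj n x := by
    obtain ⟨m, a, h⟩ := IsLocalization.Away.surj f x
    refine ⟨m, a, ?_⟩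
    rw [mul_comm, h, sub_self]
    exact zero_mem _
  inj n a ha := by
    cases n with
    | zero => exact ⟨0, by simp⟩
    | succ n =>
      rw [Ideal.map_bot, Ideal.bot_pow n.succ_ne_zero, Ideal.mem_bot] at ha
      obtain ⟨⟨_, m, rfl⟩, hm⟩ := (IsLocalization.map_eq_zero_iff (.powers f) L a).1 ha
      exact ⟨m, by rw [hm]; exact zero_mem _⟩

end IsAdicLocalization

/-! ### Restriction maps and basic open sets -/

/-- The restriction map of a presheaf of rings. -/
abbrev TopCat.Presheaf.resHom {X : TopCat.{u}} (P : X.Presheaf CommRingCat.{u}) {U V : Opens X}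
    (h : V ≤ U) : P.obj (op U) →+* P.obj (op V) :=
  (P.map (homOfLE h).op).hom

namespace AlgebraicGeometry.LocallyRingedSpace

variable {X Y Z : LocallyRingedSpace.{u}}

/-- The map `𝒪_Y(U) → 𝒪_X(V)` given by a morphism `X → Y` and an open set `V` contained in the
inverse image of `U`. -/
def appLE (f : X ⟶ Y) {U : Opens Y.toTopCat} {V : Opens X.toTopCat}
    (h : V ≤ (Opens.map f.base).obj U) :
    Y.presheaf.obj (op U) →+* X.presheaf.obj (op V) :=
  (X.presheaf.resHom h).comp (f.c.app (op U)).hom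

theorem res_appLE (f : X ⟶ Y) {U : Opens Y.toTopCat} {V V' : Opens X.toTopCat}
    (h : V ≤ (Opens.map f.base).obj U) (h' : V' ≤ V) (s : Y.presheaf.obj (op U)) :
    X.presheaf.resHom h' (appLE f h s) = appLE f (h'.trans h) s :=
  X.presheaf.map_map_homOfLE h' h _

theorem appLE_res (f : X ⟶ Y) {U U' : Opens Y.toTopCat} {V : Opens X.toTopCat}
    (h : V ≤ (Opens.map f.base).obj U) (h' : U ≤ U') (s : Y.presheaf.obj (op U')) :
    appLE f h (Y.presheaf.resHom h' s) = appLE f (fun _ hx => h' (h hx)) s := by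
  have h1 := congr($(f.c.naturality (homOfLE h').op) s)
  refine (congrArg (X.presheaf.resHom h) h1).trans ?_
  exact X.presheaf.map_map_homOfLE h (fun x hx => h' hx) _

theorem appLE_comp (f : X ⟶ Y) (g : Y ⟶ Z) {U : Opens Z.toTopCat} {V : Opens Y.toTopCat}
    {W : Opens X.toTopCat} (h : V ≤ (Opens.map g.base).obj U) (h' : W ≤ (Opens.map f.base).obj V)
    (s : Z.presheaf.obj (op U)) :
    appLE (f ≫ g) (fun _ hx => h (h' hx)) s = appLE f h' (appLE g h s) :=
  (appLE_res f h' h _).symm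

theorem appLE_congr {f g : X ⟶ Y} (hfg : f = g) {U : Opens Y.toTopCat} {V : Opens X.toTopCat}
    (h : V ≤ (Opens.map f.base).obj U) (s : Y.presheaf.obj (op U)) :
    appLE f h s = appLE g (hfg ▸ h) s := by
  subst hfg
  rfl

theorem appLE_le_rfl (f : X ⟶ Y) {U : Opens Y.toTopCat} (s : Y.presheaf.obj (op U)) :
    appLE f le_rfl s = f.c.app (op U) s :=
  X.presheaf.map_homOfLE_refl le_rfl _

theorem basicOpen_res (X : LocallyRingedSpace.{u}) {U V : Opens X.toTopCat} (h : V ≤ U)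
    (s : X.presheaf.obj (op U)) : X.toRingedSpace.basicOpen (X.presheaf.resHom h s) =
      V ⊓ X.toRingedSpace.basicOpen s :=
  RingedSpace.basicOpen_res X.toRingedSpace (homOfLE h).op s

theorem basicOpen_appLE (f : X ⟶ Y) {U : Opens Y.toTopCat} {V : Opens X.toTopCat}
    (h : V ≤ (Opens.map f.base).obj U) (s : Y.presheaf.obj (op U)) :
    X.toRingedSpace.basicOpen (appLE f h s) =
      V ⊓ (Opens.map f.base).obj (Y.toRingedSpace.basicOpen s) := by
  refine (basicOpen_res X h _).trans ?_
  rw [preimage_basicOpen]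

theorem isUnit_res (X : LocallyRingedSpace.{u}) {U W : Opens X.toTopCat} (h : W ≤ U)
    (s : X.presheaf.obj (op U)) (hW : W ≤ X.toRingedSpace.basicOpen s) :
    IsUnit (X.presheaf.resHom h s) := by
  have h1 := (RingedSpace.isUnit_res_basicOpen X.toRingedSpace s).map (X.presheaf.resHom hW)
  exact (X.presheaf.map_map_homOfLE hW _ s) ▸ h1

end AlgebraicGeometry.LocallyRingedSpace

open LocallyRingedSpace

/-- The global section of the structure sheaf of `Spec R` given by an element of `R`, restricted to
an open set. -/
noncomputable def specConst (R : CommRingCat.{u})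
    (V : Opens (Spec R).toLocallyRingedSpace.toTopCat) :
    R →+* (Spec R).toLocallyRingedSpace.presheaf.obj (op V) :=
  ((Spec R).toLocallyRingedSpace.presheaf.resHom le_top).comp (Scheme.ΓSpecIso R).inv.hom

theorem isAdicLocalization_specConst (R : CommRingCat.{u}) (f : R)
    (V : Opens (Spec R).toLocallyRingedSpace.toTopCat) (hV : V = PrimeSpectrum.basicOpen f) :
    IsAdicLocalization ⊥ f (specConst R V) := by
  subst hV
  exact @IsAdicLocalization.of_isLocalization R _ _ _
    (StructureSheaf.openAlgebra R (op (PrimeSpectrum.basicOpen f))) f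
    (StructureSheaf.IsLocalization.to_basicOpen R f)

theorem basicOpen_specConst (R : CommRingCat.{u}) (f : R)
    (V : Opens (Spec R).toLocallyRingedSpace.toTopCat) :
    (Spec R).toLocallyRingedSpace.toRingedSpace.basicOpen (specConst R V f) =
      V ⊓ PrimeSpectrum.basicOpen f := by
  refine (LocallyRingedSpace.basicOpen_res _ le_top _).trans ?_
  exact congrArg (V ⊓ ·) (basicOpen_eq_of_affine f)

theorem appLE_specConst {R S : CommRingCat.{u}} (φ : R ⟶ S)
    {U : Opens (Spec R).toLocallyRingedSpace.toTopCat}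
    {V : Opens (Spec S).toLocallyRingedSpace.toTopCat}
    (h : V ≤ (Opens.map (Spec.map φ).toLRSHom.base).obj U) (r : R) :
    appLE (Spec.map φ).toLRSHom h (specConst R U r) = specConst S V (φ r) := by
  refine (appLE_res _ _ _ _).trans ?_
  exact congrArg ((Spec S).toLocallyRingedSpace.presheaf.resHom le_top)
    congr($(Scheme.ΓSpecIso_inv_naturality φ) r).symm

section Spf

variable (A : Type u) [CommRing A] (I : Ideal A)

/-- The morphism `Spf A → Spec A`. -/
noncomputable def spfToSpec : spfLRS A I ⟶ (Spec (CommRingCat.of A)).toLocallyRingedSpace :=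
  Limits.colimit.desc (thickeningDiagram A I) ⟨_, ⟨fun n => (Spec.map (CommRingCat.ofHom
    (Ideal.Quotient.mk (I ^ (n + 1))))).toLRSHom, fun m n h => by
      refine Eq.trans ?_ (Category.comp_id _).symm
      change (Spec.map _).toLRSHom ≫ (Spec.map _).toLRSHom = _
      rw [← Scheme.Hom.comp_toLRSHom, ← Spec.map_comp]
      rfl⟩⟩

theorem spfι_spfToSpec (n : ℕ) : spfι A I n ≫ spfToSpec A I =
    (Spec.map (CommRingCat.ofHom (Ideal.Quotient.mk (I ^ (n + 1))))).toLRSHom :=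
  Limits.colimit.ι_desc _ n

/-- The section of the structure sheaf of `Spf A` given by an element of `A`. -/
noncomputable def spfConst (W : Opens (spfLRS A I).toTopCat) :
    A →+* (spfLRS A I).presheaf.obj (op W) :=
  (appLE (spfToSpec A I) (U := ⊤) (V := W) (fun _ _ => trivial)).comp
    (specConst (CommRingCat.of A) ⊤)

theorem res_spfConst {W W' : Opens (spfLRS A I).toTopCat} (h : W' ≤ W) (a : A) :
    (spfLRS A I).presheaf.resHom h (spfConst A I W a) = spfConst A I W' a :=
  res_appLE (spfToSpec A I) (U := ⊤) (fun _ _ => trivial) h (specConst (CommRingCat.of A) ⊤ a)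

theorem appLE_spfι_spfConst (n : ℕ) {W : Opens (spfLRS A I).toTopCat}
    {V : Opens (thickening A I n).toLocallyRingedSpace.toTopCat}
    (h : V ≤ (Opens.map (spfι A I n).base).obj W) (a : A) :
    appLE (spfι A I n) h (spfConst A I W a) =
      specConst _ V (Ideal.Quotient.mk (I ^ (n + 1)) a) := by
  refine (appLE_comp (spfι A I n) (spfToSpec A I) (U := ⊤) (fun _ _ => trivial) h
    (specConst (CommRingCat.of A) ⊤ a)).symm.trans ?_
  refine (appLE_congr (spfι_spfToSpec A I n) (U := ⊤) (fun _ _ => trivial) _).trans ?_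
  exact appLE_specConst (CommRingCat.ofHom (Ideal.Quotient.mk (I ^ (n + 1)))) (U := ⊤)
    (fun _ _ => trivial) a

end Spf

/-! ### Sections over basic open sets of a formal spectrum -/

theorem AlgebraicGeometry.LocallyRingedSpace.appLE_app {X Y Z : LocallyRingedSpace.{u}}
    {f : X ⟶ Y} {g : Y ⟶ Z} {k : X ⟶ Z} (hk : f ≫ g = k) (W : Opens Z.toTopCat)
    (h : (Opens.map k.base).obj W ≤ (Opens.map f.base).obj ((Opens.map g.base).obj W))
    (s : Z.presheaf.obj (op W)) :
    appLE f h (g.c.app (op W) s) = k.c.app (op W) s := by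
  subst hk
  exact (X.presheaf.map_homOfLE_refl h _)

section Spf

variable (A : Type u) [CommRing A] (I : Ideal A)

theorem spfι_preimage_basicOpen (n : ℕ) (f : A) (W W' : Opens (spfLRS A I).toTopCat)
    (hW : W = (spfLRS A I).toRingedSpace.basicOpen (spfConst A I W' f)) :
    (Opens.map (spfι A I n).base).obj W =
      (Opens.map (spfι A I n).base).obj W' ⊓
        PrimeSpectrum.basicOpen (Ideal.Quotient.mk (I ^ (n + 1)) f) := by
  subst hW
  have h1 := basicOpen_appLE (spfι A I n) (V := (Opens.map (spfι A I n).base).obj W') le_rfl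
    (spfConst A I W' f)
  rw [appLE_spfι_spfConst, basicOpen_specConst] at h1
  rw [h1]
  refine (inf_eq_right.2 ?_).symm
  intro x hx
  exact RingedSpace.basicOpen_le (spfLRS A I).toRingedSpace (spfConst A I W' f) hx

theorem appLE_thickeningMap {m n : ℕ} (hmn : m ≤ n) (W : Opens (spfLRS A I).toTopCat)
    (h : (Opens.map (spfι A I m).base).obj W ≤
      (Opens.map (thickeningMap A I hmn).toLRSHom.base).obj ((Opens.map (spfι A I n).base).obj W))
    (s : (spfLRS A I).presheaf.obj (op W)) :
    appLE (thickeningMap A I hmn).toLRSHom h ((spfι A I n).c.app (op W) s) =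
      (spfι A I m).c.app (op W) s :=
  appLE_app (thickeningMap_spfι A I hmn) W h s

variable {I}

/-- Over the basic open set `D(f)`, the sections of the structure sheaf of `Spf A` form the
completed localization `L` of `A` away from `f`, and those vanishing on `Spec (A / I ^ (n + 1))`
form the ideal `I ^ (n + 1) L`. -/
theorem spf_isAdicLocalization_and_ker (hI : I.FG) (f : A) (W : Opens (spfLRS A I).toTopCat)
    (hW : W = (spfLRS A I).toRingedSpace.basicOpen (spfConst A I ⊤ f)) :
    IsAdicLocalization I f (spfConst A I W) ∧ ∀ n, RingHom.ker ((spfι A I n).c.app (op W)).hom =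
      I.map (spfConst A I W) ^ (n + 1) := by
  have hV (n : ℕ) : (Opens.map (spfι A I n).base).obj W =
      PrimeSpectrum.basicOpen (Ideal.Quotient.mk (I ^ (n + 1)) f) :=
    (spfι_preimage_basicOpen A I n f W ⊤ hW).trans (top_inf_eq _)
  have hloc (n : ℕ) := isAdicLocalization_specConst
    (CommRingCat.of (A ⧸ I ^ (n + 1))) (Ideal.Quotient.mk (I ^ (n + 1)) f) _ (hV n)
  have hc (n : ℕ) (a : A) : (spfι A I n).c.app (op W) (spfConst A I W a) =
      specConst (CommRingCat.of (A ⧸ I ^ (n + 1))) _ (Ideal.Quotient.mk (I ^ (n + 1)) a) :=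
    (appLE_le_rfl _ _).symm.trans (appLE_spfι_spfConst A I n le_rfl a)
  have htr {m n : ℕ} (hmn : m ≤ n) : (Opens.map (spfι A I m).base).obj W ≤
      (Opens.map (thickeningMap A I hmn).toLRSHom.base).obj
        ((Opens.map (spfι A I n).base).obj W) := by
    rw [← thickeningMap_spfι A I hmn]
    exact le_rfl
  refine IsAdicLocalization.of_limit hI ?_ (fun n => ((spfι A I n).c.app (op W)).hom) ?_ ?_ ?_ ?_ ?_
  · rw [← res_spfConst A I le_top]
    exact isUnit_res _ _ _ hW.le
  · intro n y
    obtain ⟨m, b, hb⟩ := (hloc n).surj 1 y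
    obtain ⟨a, rfl⟩ := Ideal.Quotient.mk_surjective b
    refine ⟨m, a, ?_⟩
    rw [Ideal.map_bot, pow_one, Ideal.mem_bot, sub_eq_zero] at hb
    exact ((congrArg (· ^ m * y) (hc n f)).trans hb).trans (hc n a).symm
  · intro n a
    refine (Eq.congr_left (hc n a)).trans ⟨fun h => ?_, fun ⟨m, hm⟩ => ?_⟩
    · obtain ⟨m, hm⟩ := (hloc n).inj 1 (Ideal.Quotient.mk (I ^ (n + 1)) a)
        (by rw [h]; exact zero_mem _)
      rw [pow_one, Ideal.mem_bot, ← map_pow, ← map_mul] at hm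
      exact ⟨m, Ideal.Quotient.eq_zero_iff_mem.1 hm⟩
    · have h1 := congrArg (specConst (CommRingCat.of (A ⧸ I ^ (n + 1)))
        ((Opens.map (spfι A I n).base).obj W)) (Ideal.Quotient.eq_zero_iff_mem.2 hm)
      rw [map_zero, map_mul, map_pow, map_mul, map_pow] at h1
      exact (((hloc n).isUnit.pow m).mul_right_eq_zero).1 h1
  · intro n x hx
    refine (appLE_thickeningMap A I n.le_succ W (htr _) x).symm.trans ?_
    exact (congrArg _ hx).trans (map_zero _)
  · exact fun x hx => spf_ext A I x hx
  · intro s hs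
    have hst {m n : ℕ} (hmn : m ≤ n) :
        (spfι A I m).c.app (op W) (s n) = (spfι A I m).c.app (op W) (s m) := by
      induction n, hmn using Nat.le_induction with
      | base => rfl
      | succ n hmn ih =>
        refine Eq.trans ?_ ih
        refine (appLE_thickeningMap A I hmn W (htr _) _).symm.trans ?_
        exact (congrArg _ (hs n)).trans (appLE_thickeningMap A I hmn W (htr _) _)
    refine spf_exists A I (fun n => (spfι A I n).c.app (op W) (s n)) fun m n hmn hle => ?_
    exact (appLE_thickeningMap A I hmn W hle (s n)).trans (hst hmn)

/-- Sections over a quasi-compact open set carry the discrete topology. -/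
theorem pseudoDiscrete_eq_bot (X : LocallyRingedSpace.{u}) {W : Opens X.toTopCat}
    (hW : IsCompact (W : Set X.toTopCat)) : pseudoDiscrete X W = ⊥ := by
  refine eq_bot_iff.2 ((iInf_le _ ⟨W, le_rfl, hW⟩).trans (le_of_eq ?_))
  have : ((X.presheaf.map (homOfLE le_rfl).op).hom :
      X.presheaf.obj (op W) → X.presheaf.obj (op W)) = _root_.id :=
    funext fun s => X.presheaf.map_homOfLE_refl le_rfl s
  exact (congrArg (fun g => @TopologicalSpace.induced _ _ g ⊥) this).trans (@induced_id _ ⊥)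

/-- The sections of the structure sheaf of `Spf A` over `D(f)`, as a limit of discrete rings, carry
the adic topology. -/
theorem spf_top_eq (hI : I.FG) (f : A) (W : Opens (spfLRS A I).toTopCat)
    (hW : W = (spfLRS A I).toRingedSpace.basicOpen (spfConst A I ⊤ f)) :
    (Spf A I).top W = (I.map (spfConst A I W)).adicTopology := by
  rw [← iInf_induced_bot_eq_adicTopology (fun n => ((spfι A I n).c.app (op W)).hom)
    (spf_isAdicLocalization_and_ker A hI f W hW).2]
  refine iInf_congr fun n => ?_
  rw [pseudoDiscrete_eq_bot]
  have hV : (Opens.map (spfι A I n).base).obj W =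
      PrimeSpectrum.basicOpen (Ideal.Quotient.mk (I ^ (n + 1)) f) :=
    (spfι_preimage_basicOpen A I n f W ⊤ hW).trans (top_inf_eq _)
  rw [hV]
  exact PrimeSpectrum.isCompact_basicOpen _

end Spf

/-! ### Adic open subsets -/

/-- The open subset `U` of `X` behaves like the formal spectrum of `A = 𝒪_X(U)` with the `I`-adic
topology, except that nothing is said about its points: over every basic open set `D(f)`, `f ∈ A`,
the ring of sections is the completed localization of `A` away from `f`, with the `I`-adic
topology. -/
structure TopLRS.IsAdicOpen (X : TopLRS.{u}) (U : Opens X.toTopCat) (I : Ideal (X.sec U)) :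
    Prop where
  fg : I.FG
  loc : ∀ (f : X.sec U) (W : Opens X.toTopCat) (h : W ≤ U), W = X.toRingedSpace.basicOpen f →
    IsAdicLocalization I f (X.presheaf.resHom h)
  top_eq : ∀ (f : X.sec U) (W : Opens X.toTopCat) (h : W ≤ U), W = X.toRingedSpace.basicOpen f →
    X.top W = (I.map (X.presheaf.resHom h)).adicTopology

theorem TopCat.Presheaf.resHom_refl {X : TopCat.{u}} (P : X.Presheaf CommRingCat.{u})
    {U : Opens X} (h : U ≤ U) : P.resHom h = RingHom.id _ :=
  RingHom.ext fun s => P.map_homOfLE_refl h s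

theorem TopCat.Presheaf.resHom_comp {X : TopCat.{u}} (P : X.Presheaf CommRingCat.{u})
    {U V W : Opens X} (h : U ≤ V) (h' : V ≤ W) :
    (P.resHom h).comp (P.resHom h') = P.resHom (h.trans h') :=
  RingHom.ext fun s => P.map_map_homOfLE h h' s

namespace TopLRS.IsAdicOpen

variable {X : TopLRS.{u}} {U : Opens X.toTopCat} {I : Ideal (X.sec U)}

theorem isAdicComplete (H : X.IsAdicOpen U I) : IsAdicComplete I (X.sec U) := by
  have h := (H.loc 1 U le_rfl (RingedSpace.basicOpen_of_isUnit X.toRingedSpace isUnit_one).symm)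
  have h1 := h.complete
  rwa [TopCat.Presheaf.resHom_refl, Ideal.map_id] at h1

theorem top_eq_self (H : X.IsAdicOpen U I) : X.top U = I.adicTopology := by
  have h := (H.top_eq 1 U le_rfl
    (RingedSpace.basicOpen_of_isUnit X.toRingedSpace isUnit_one).symm)
  rwa [TopCat.Presheaf.resHom_refl, Ideal.map_id] at h

/-- The ideal may be replaced by another ideal of definition. -/
theorem of_pow_le (H : X.IsAdicOpen U I) {I' : Ideal (X.sec U)} (hI' : I'.FG) {k l : ℕ}
    (h1 : I ^ k ≤ I') (h2 : I' ^ l ≤ I) : X.IsAdicOpen U I' where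
  fg := hI'
  loc f W h hW := (H.loc f W h hW).of_pow_le h1 h2
  top_eq f W h hW := (H.top_eq f W h hW).trans (adicTopology_eq_of_pow_le
    (by rw [← Ideal.map_pow]; exact Ideal.map_mono h1)
    (by rw [← Ideal.map_pow]; exact Ideal.map_mono h2))

end TopLRS.IsAdicOpen

namespace AlgebraicGeometry.LocallyRingedSpace

variable {X Y : LocallyRingedSpace.{u}}

/-- Sections over an open subset of the image of an open immersion are sections on the source. -/
theorem bijective_appLE (f : X ⟶ Y) (hf : LocallyRingedSpace.IsOpenImmersion f)
    {U : Opens Y.toTopCat} (hU : (U : Set Y.toTopCat) ⊆ Set.range f.base) {V : Opens X.toTopCat}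
    (h : V = (Opens.map f.base).obj U) : Function.Bijective (appLE f h.le) := by
  subst h
  have h1 := PresheafedSpace.IsOpenImmersion.isIso_of_subset f.toHom U hU
  have h2 := ConcreteCategory.bijective_of_isIso (f.c.app (op U))
  exact (iff_of_eq (congrArg Function.Bijective (funext (appLE_le_rfl f)))).2 h2

/-- The sections over an open subset of the image of an open immersion. -/
noncomputable def appEquiv (f : X ⟶ Y) (hf : LocallyRingedSpace.IsOpenImmersion f)
    {U : Opens Y.toTopCat} (hU : (U : Set Y.toTopCat) ⊆ Set.range f.base) {V : Opens X.toTopCat}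
    (h : V = (Opens.map f.base).obj U) :
    Y.presheaf.obj (op U) ≃+* X.presheaf.obj (op V) :=
  RingEquiv.ofBijective (appLE f h.le) (bijective_appLE f hf hU h)

end AlgebraicGeometry.LocallyRingedSpace

/-- The topology on the sections over an open subset of the image of an open immersion. -/
theorem TopLRS.IsOpenImmersion.top_eq {Z X : TopLRS.{u}} {f : Z ⟶ X}
    (hf : TopLRS.IsOpenImmersion f) {U : Opens X.toTopCat}
    (hU : (U : Set X.toTopCat) ⊆ Set.range (TopLRS.Hom.base f)) {V : Opens Z.toTopCat}
    (h : V = (Opens.map (TopLRS.Hom.base f)).obj U) :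
    X.top U = (Z.top V).induced (appLE (TopLRS.Hom.hom f) h.le) := by
  subst h
  refine (hf.2 U hU).trans ?_
  congr 1
  exact (funext (appLE_le_rfl (TopLRS.Hom.hom f))).symm

theorem induced_adicTopology {R R' : Type*} [CommRing R] [CommRing R'] (e : R ≃+* R')
    (I : Ideal R) : (I.map (e : R →+* R')).adicTopology.induced e = I.adicTopology := by
  refine eq_adicTopology (isTopologicalRing_induced (e : R →+* R') _
    (isTopologicalRing_adicTopology _)) ?_
  have h (n : ℕ) : (I.map (e : R →+* R') ^ n).comap (e : R →+* R') = I ^ n := by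
    rw [← Ideal.map_pow]
    exact Ideal.comap_map_of_bijective (e : R →+* R') e.bijective
  have h1 := hasBasis_nhds_zero_induced (e : R →+* R')
    (I.map (e : R →+* R')).hasBasis_nhds_zero_adic
  simp_rw [h] at h1
  exact h1

/-- Adic open sets are transported along open immersions. -/
theorem TopLRS.IsAdicOpen.of_isOpenImmersion {Z X : TopLRS.{u}} {f : Z ⟶ X}
    (hf : TopLRS.IsOpenImmersion f) {U : Opens X.toTopCat}
    (hU : (U : Set X.toTopCat) ⊆ Set.range (TopLRS.Hom.base f)) {V : Opens Z.toTopCat}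
    (h : V = (Opens.map (TopLRS.Hom.base f)).obj U) {J : Ideal (Z.sec V)} (H : Z.IsAdicOpen V J) :
    X.IsAdicOpen U (J.map ((appEquiv (TopLRS.Hom.hom f) hf.1 hU h).symm : _ →+* _)) := by
  have key (g : Z.sec V) (W : Opens X.toTopCat)
      (hW : W = X.toRingedSpace.basicOpen ((appEquiv (TopLRS.Hom.hom f) hf.1 hU h).symm g)) :
      (Opens.map (TopLRS.Hom.base f)).obj W = Z.toRingedSpace.basicOpen g := by
    have h1 := basicOpen_appLE (TopLRS.Hom.hom f) h.le
      ((appEquiv (TopLRS.Hom.hom f) hf.1 hU h).symm g)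
    rw [← hW] at h1
    have h2 : appLE (TopLRS.Hom.hom f) h.le
      ((appEquiv (TopLRS.Hom.hom f) hf.1 hU h).symm g) = g :=
      (appEquiv (TopLRS.Hom.hom f) hf.1 hU h).apply_symm_apply g
    rw [h2] at h1
    rw [h1, h]
    refine (inf_eq_right.2 fun x hx => ?_).symm
    rw [hW] at hx
    exact RingedSpace.basicOpen_le X.toRingedSpace _ hx
  have hcomp {W : Opens X.toTopCat} (hW : W ≤ U) (hWV : (Opens.map (TopLRS.Hom.base f)).obj W ≤ V)
      (g : Z.sec V) : X.presheaf.resHom hW ((appEquiv (TopLRS.Hom.hom f) hf.1 hU h).symm g) =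
        (appEquiv (TopLRS.Hom.hom f) hf.1 (fun _ hx => hU (hW hx)) rfl).symm
          (Z.presheaf.resHom hWV g) := by
    refine ((RingEquiv.symm_apply_eq _).2 ?_).symm
    obtain ⟨s, rfl⟩ := (appEquiv (TopLRS.Hom.hom f) hf.1 hU h).surjective g
    rw [RingEquiv.symm_apply_apply]
    exact (res_appLE (TopLRS.Hom.hom f) h.le hWV s).trans
      (appLE_res (TopLRS.Hom.hom f) le_rfl hW s).symm
  refine ⟨H.fg.map _, fun s W hW hWs => ?_, fun s W hW hWs => ?_⟩
  · obtain ⟨g, rfl⟩ := (appEquiv (TopLRS.Hom.hom f) hf.1 hU h).symm.surjective s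
    have hWg := key g W hWs
    have hWV : (Opens.map (TopLRS.Hom.base f)).obj W ≤ V := by
      rw [hWg]
      exact RingedSpace.basicOpen_le Z.toRingedSpace _
    exact (H.loc g _ hWV hWg).of_ringEquiv (appEquiv (TopLRS.Hom.hom f) hf.1 hU h).symm
      (appEquiv (TopLRS.Hom.hom f) hf.1 (fun _ hx => hU (hW hx)) rfl).symm (hcomp hW hWV)
  · obtain ⟨g, rfl⟩ := (appEquiv (TopLRS.Hom.hom f) hf.1 hU h).symm.surjective s
    have hWg := key g W hWs
    have hWV : (Opens.map (TopLRS.Hom.base f)).obj W ≤ V := by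
      rw [hWg]
      exact RingedSpace.basicOpen_le Z.toRingedSpace _
    have hWU : (W : Set X.toTopCat) ⊆ Set.range (TopLRS.Hom.base f) := fun _ hx => hU (hW hx)
    refine (hf.top_eq hWU rfl).trans ?_
    rw [H.top_eq g _ hWV hWg]
    have h1 : (J.map ((appEquiv (TopLRS.Hom.hom f) hf.1 hU h).symm : _ →+* _)).map
        (X.presheaf.resHom hW) = (J.map (Z.presheaf.resHom hWV)).map
          ((appEquiv (TopLRS.Hom.hom f) hf.1 hWU rfl).symm : _ →+* _) := by
      rw [Ideal.map_map, Ideal.map_map]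
      congr 1
      exact RingHom.ext (hcomp hW hWV)
    rw [h1, ← induced_adicTopology (appEquiv (TopLRS.Hom.hom f) hf.1 hWU rfl)]
    congr 2
    rw [Ideal.map_map]
    refine Eq.trans (Ideal.map_id _).symm (congrArg (Ideal.map · _) ?_)
    exact RingHom.ext fun x => ((appEquiv (TopLRS.Hom.hom f) hf.1 hWU rfl).apply_symm_apply x).symm

section Spf

variable {A : Type u} [CommRing A] {I : Ideal A}

theorem bijective_spfConst (hI : I.FG) (hA : IsAdicComplete I A) :
    Function.Bijective (spfConst A I ⊤) :=
  (IsAdicLocalization.of_isAdicComplete hA).bijective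
    (spf_isAdicLocalization_and_ker A hI 1 ⊤ (by
      rw [map_one]
      exact (RingedSpace.basicOpen_of_isUnit (spfLRS A I).toRingedSpace isUnit_one).symm)).1 rfl

/-- The ring `A` is the ring of global sections of `Spf A`. -/
noncomputable def spfEquiv (hI : I.FG) (hA : IsAdicComplete I A) : A ≃+* (Spf A I).sec ⊤ :=
  RingEquiv.ofBijective (spfConst A I ⊤) (bijective_spfConst hI hA)

/-- All of `Spf A` is an adic open set. -/
theorem isAdicOpen_spf (hI : I.FG) (hA : IsAdicComplete I A) :
    (Spf A I).IsAdicOpen ⊤ (I.map (spfEquiv hI hA : A →+* (Spf A I).sec ⊤)) := by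
  refine ⟨hI.map _, fun s W hW hWs => ?_, fun s W hW hWs => ?_⟩
  · obtain ⟨f, rfl⟩ := (spfEquiv hI hA).surjective s
    exact (spf_isAdicLocalization_and_ker A hI f W hWs).1.of_ringEquiv (spfEquiv hI hA)
      (RingEquiv.refl _) (res_spfConst A I hW)
  · obtain ⟨f, rfl⟩ := (spfEquiv hI hA).surjective s
    refine (spf_top_eq A hI f W hWs).trans ?_
    rw [Ideal.map_map]
    congr 2
    exact (RingHom.ext (res_spfConst A I hW)).symm

end Spf

/-! ### Affine charts -/

theorem specConst_top_bijective (R : CommRingCat.{u})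
    {V : Opens (Spec R).toLocallyRingedSpace.toTopCat} (hV : V = ⊤) :
    Function.Bijective (specConst R V) := by
  subst hV
  have h := ConcreteCategory.bijective_of_isIso (Scheme.ΓSpecIso R).inv
  refine (iff_of_eq (congrArg Function.Bijective (funext fun r => ?_))).2 h
  exact (Spec R).toLocallyRingedSpace.presheaf.map_homOfLE_refl le_top _

/-- The reduction map `Spec (A / √I) → Spf A` on sections coming from `A`. -/
theorem appLE_spfRed (A : Type u) [CommRing A] (I : Ideal A) {W : Opens (spfLRS A I).toTopCat}
    {V : Opens (Spec (CommRingCat.of (A ⧸ I.radical))).toLocallyRingedSpace.toTopCat}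
    (h : V ≤ (Opens.map (TopLRS.Hom.base (spfRed A I))).obj W) (a : A) :
    appLE (TopLRS.Hom.hom (spfRed A I)) h (spfConst A I W a) =
      specConst (CommRingCat.of (A ⧸ I.radical)) V (Ideal.Quotient.mk I.radical a) := by
  have hle : I ^ (0 + 1) ≤ I.radical :=
    (Ideal.pow_le_self (Nat.succ_ne_zero 0)).trans Ideal.le_radical
  refine (appLE_comp (Spec.map (CommRingCat.ofHom (Ideal.Quotient.factor hle))).toLRSHom (spfι A I 0) (V := (Opens.map (spfι A I 0).base).obj W)
      le_rfl h (spfConst A I W a)).trans ?_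
  refine (congrArg _ (appLE_spfι_spfConst A I 0 le_rfl a)).trans ?_
  exact (appLE_specConst (CommRingCat.ofHom (Ideal.Quotient.factor hle)) h
    (Ideal.Quotient.mk (I ^ (0 + 1)) a)).trans
      (congrArg (specConst (CommRingCat.of (A ⧸ I.radical)) V) (Ideal.Quotient.factor_mk hle a))

theorem PrimeSpectrum.isHomeomorph_comap_factor {A : Type*} [CommRing A] {J K : Ideal A}
    (h : J ≤ K) (h' : K ≤ J.radical) : IsHomeomorph (comap (Ideal.Quotient.factor h)) := by
  refine isHomeomorph_comap _ (fun x => ⟨1, one_pos, ?_⟩) fun x hx => ?_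
  · obtain ⟨y, rfl⟩ := Ideal.Quotient.mk_surjective x
    exact ⟨Ideal.Quotient.mk _ y, (pow_one _).symm⟩
  · obtain ⟨y, rfl⟩ := Ideal.Quotient.mk_surjective x
    obtain ⟨n, hn⟩ := h' (Ideal.Quotient.eq_zero_iff_mem.1 hx)
    refine ⟨n, ?_⟩
    rw [← map_pow]
    exact Ideal.Quotient.eq_zero_iff_mem.2 hn

theorem AlgebraicGeometry.LocallyRingedSpace.isHomeomorph_base_comp {X Y Z : LocallyRingedSpace.{u}}
    (f : X ⟶ Y) (g : Y ⟶ Z) (hf : IsHomeomorph f.base) (hg : IsHomeomorph g.base) :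
    IsHomeomorph (f ≫ g).base :=
  hg.comp hf

theorem AlgebraicGeometry.Scheme.isHomeomorph_toLRSHom_base {X Y : Scheme.{u}} (f : X ⟶ Y)
    (hf : IsHomeomorph f) : IsHomeomorph f.toLRSHom.base :=
  hf

/-- `Spf A` has the same points as `Spec (A / √I)`. -/
theorem isHomeomorph_spfRed (A : Type u) [CommRing A] (I : Ideal A) :
    IsHomeomorph (TopLRS.Hom.base (spfRed A I)) := by
  have hle : I ^ (0 + 1) ≤ I.radical :=
    (Ideal.pow_le_self (Nat.succ_ne_zero 0)).trans Ideal.le_radical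
  have h1 : IsHomeomorph (Spec.map (CommRingCat.ofHom (Ideal.Quotient.factor hle))) :=
    PrimeSpectrum.isHomeomorph_comap_factor hle
      (Ideal.radical_mono ((zero_add 1).symm ▸ (pow_one I).ge))
  exact isHomeomorph_base_comp _ (spfι A I 0) (Scheme.isHomeomorph_toLRSHom_base _ h1)
    (isHomeomorph_spfι A I 0)

namespace AffineChart

variable {X : TopLRS.{u}} (c : AffineChart X)

/-- The open subset of `X` covered by the chart. -/
def opens : Opens X.toTopCat :=
  ⟨c.range, c.isOpenImmersion.1.base_open.isOpen_range⟩

theorem top_eq_preimage_opens : ⊤ = (Opens.map (TopLRS.Hom.base c.hom)).obj c.opens :=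
  le_antisymm (fun x _ => Set.mem_range_self (f := TopLRS.Hom.base c.hom) x) le_top

/-- The ring of sections over an affine chart. -/
noncomputable def ringEquiv : c.A ≃+* X.sec c.opens :=
  (spfEquiv c.fg c.complete).trans (appEquiv (TopLRS.Hom.hom c.hom) c.isOpenImmersion.1
    (U := c.opens) subset_rfl c.top_eq_preimage_opens).symm

theorem appLE_ringEquiv {V : Opens (Spf c.A c.I).toTopCat}
    (h : V ≤ (Opens.map (TopLRS.Hom.base c.hom)).obj c.opens) (a : c.A) :
    appLE (TopLRS.Hom.hom c.hom) h (c.ringEquiv a) = spfConst c.A c.I V a := by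
  refine (res_appLE (TopLRS.Hom.hom c.hom) (V := ⊤) c.top_eq_preimage_opens.le le_top
    (c.ringEquiv a)).symm.trans ?_
  refine Eq.trans (congrArg _ ?_) (res_spfConst c.A c.I le_top a)
  exact (appEquiv (TopLRS.Hom.hom c.hom) c.isOpenImmersion.1
    (U := c.opens) subset_rfl c.top_eq_preimage_opens).apply_symm_apply _

/-- The image of an affine chart is an adic open set. -/
theorem isAdicOpen : X.IsAdicOpen c.opens (c.I.map (c.ringEquiv : c.A →+* X.sec c.opens)) := by
  have h := (isAdicOpen_spf c.fg c.complete).of_isOpenImmersion c.isOpenImmersion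
    (U := c.opens) subset_rfl c.top_eq_preimage_opens
  rwa [Ideal.map_map] at h

end AffineChart

/-- The open subset `U` of `X` is affine with ring of sections the `I`-adically complete ring
`𝒪_X(U)`, and its reduced special fibre is an open subscheme of the scheme `T`. -/
structure TopLRS.IsAffineAdicOpen {T : Scheme.{u}} {X : TopLRS.{u}} (i : schemeTop T ⟶ X)
    (U : Opens X.toTopCat) (I : Ideal (X.sec U)) : Prop extends X.IsAdicOpen U I where
  isAffineOpen : IsAffineOpen (X := T) ((Opens.map (TopLRS.Hom.base i)).obj U)
  surjective : Function.Surjective ((TopLRS.Hom.hom i).c.app (op U)).hom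
  ker_eq : RingHom.ker ((TopLRS.Hom.hom i).c.app (op U)).hom = I.radical

/-- The image of an affine chart is an affine adic open set if the reduced special fibre is `Spec (A
/ √I)` over it. -/
theorem AffineChart.isAffineAdicOpen {T : Scheme.{u}} {X : TopLRS.{u}} {i : schemeTop T ⟶ X}
    (c : AffineChart X) (k : Spec (CommRingCat.of (c.A ⧸ c.I.radical)) ⟶ T) (hk : IsOpenImmersion k)
    (hki : schemeTopMap k ≫ i = spfRed c.A c.I ≫ c.hom)
    (hr : Set.range k = TopLRS.Hom.base i ⁻¹' c.range) :
    TopLRS.IsAffineAdicOpen i c.opens (c.I.map (c.ringEquiv : c.A →+* X.sec c.opens)) := by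
  have hV : ⊤ = (Opens.map k.toLRSHom.base).obj ((Opens.map (TopLRS.Hom.base i)).obj c.opens) :=
    le_antisymm (fun x _ => hr.subset (Set.mem_range_self (f := k) x)) le_top
  have hb := bijective_appLE k.toLRSHom hk (U := (Opens.map (TopLRS.Hom.base i)).obj c.opens)
    hr.symm.subset hV
  have hs := specConst_top_bijective (CommRingCat.of (c.A ⧸ c.I.radical)) rfl
  have h (a : c.A) : appLE k.toLRSHom hV.le
      ((TopLRS.Hom.hom i).c.app (op c.opens) (c.ringEquiv a)) =
        specConst (CommRingCat.of (c.A ⧸ c.I.radical)) ⊤ (Ideal.Quotient.mk _ a) := by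
    refine (congrArg _ (appLE_le_rfl (TopLRS.Hom.hom i) _).symm).trans ?_
    refine (appLE_comp k.toLRSHom (TopLRS.Hom.hom i) le_rfl hV.le _).symm.trans ?_
    refine (appLE_congr (congrArg TopLRS.Hom.hom hki) _ _).trans ?_
    refine (appLE_comp (TopLRS.Hom.hom (spfRed c.A c.I)) (TopLRS.Hom.hom c.hom) (V := ⊤)
      c.top_eq_preimage_opens.le le_top _).trans ?_
    refine (congrArg _ (c.appLE_ringEquiv _ a)).trans ?_
    exact appLE_spfRed c.A c.I le_top a
  refine ⟨c.isAdicOpen, ?_, fun t => ?_, ?_⟩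
  · have : (Opens.map (TopLRS.Hom.base i)).obj c.opens = k.opensRange := Opens.ext hr.symm
    rw [this]
    exact isAffineOpen_opensRange k
  · obtain ⟨b, hb'⟩ := hs.2 (appLE k.toLRSHom hV.le t)
    obtain ⟨a, rfl⟩ := Ideal.Quotient.mk_surjective b
    exact ⟨c.ringEquiv a, hb.1 ((h a).trans hb')⟩
  · ext x
    obtain ⟨a, rfl⟩ := c.ringEquiv.surjective x
    have h1 : c.ringEquiv a ∈ RingHom.ker ((TopLRS.Hom.hom i).c.app (op c.opens)).hom ↔
        a ∈ c.I.radical := by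
      refine Iff.trans ?_ Ideal.Quotient.eq_zero_iff_mem
      refine Iff.trans ?_ (map_eq_zero_iff _ hs.1)
      refine Iff.trans ?_ (Eq.congr_left (h a))
      exact (map_eq_zero_iff _ hb.1).symm
    rw [h1, Ideal.mem_radical_iff, Ideal.mem_radical_iff]
    refine exists_congr fun n => ?_
    rw [← map_pow]
    refine ⟨fun h => Ideal.mem_map_of_mem _ h, fun h => ?_⟩
    obtain ⟨y, hy, hya⟩ := (Ideal.mem_map_of_equiv c.ringEquiv _).1 h
    exact c.ringEquiv.injective hya ▸ hy

/-! ### Morphisms and open immersions on a basis -/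

/-- For an open immersion (or any morphism), continuity and strictness of the maps on sections can
be checked on a basis of open subsets of the image. -/
theorem TopLRS.continuous_and_top_eq_of_basis {Z X : TopLRS.{u}}
    (f : Z.toLocallyRingedSpace ⟶ X.toLocallyRingedSpace) {κ : Type u} (B : κ → Opens X.toTopCat)
    (hB : ∀ (z : Z.toTopCat) (V : Opens X.toTopCat), f.base z ∈ V → ∃ k, f.base z ∈ B k ∧ B k ≤ V)
    (h : ∀ k, X.top (B k) = (Z.top ((Opens.map f.base).obj (B k))).induced
      (f.c.app (op (B k))).hom) (V : Opens X.toTopCat) :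
    @Continuous _ _ (X.top V) (Z.top ((Opens.map f.base).obj V)) (f.c.app (op V)).hom ∧
    ((V : Set X.toTopCat) ⊆ Set.range f.base →
      X.top V = (Z.top ((Opens.map f.base).obj V)).induced (f.c.app (op V)).hom) := by
  let κ' := {k // B k ≤ V}
  have hZ := Z.top_eq_iInf ((Opens.map f.base).obj V)
    (fun k : κ' => (Opens.map f.base).obj (B k.1)) (fun k _ hx => k.2 hx) fun z hz => by
      obtain ⟨k, hk, hkV⟩ := hB z V hz
      exact Opens.mem_iSup.2 ⟨⟨k, hkV⟩, hk⟩
  have hX (k : κ') : X.top V ≤ (X.top (B k.1)).induced (X.presheaf.resHom k.2) := by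
    have := X.top_eq_iInf (κ := ULift Bool) V (fun b => cond b.down V (B k.1))
      (fun b => by rcases b with ⟨_ | _⟩; exacts [k.2, le_rfl])
      (fun x hx => Opens.mem_iSup.2 ⟨⟨true⟩, hx⟩)
    exact this.trans_le (iInf_le _ (⟨false⟩ : ULift Bool))
  have hc (k : κ') : (Z.presheaf.resHom (show (Opens.map f.base).obj (B k.1) ≤
      (Opens.map f.base).obj V from fun _ hx => k.2 hx)) ∘ (f.c.app (op V)).hom =
        (f.c.app (op (B k.1))).hom ∘ X.presheaf.resHom k.2 :=
    funext fun s => congr($(f.c.naturality (homOfLE k.2).op) s).symm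
  have hind : (Z.top ((Opens.map f.base).obj V)).induced (f.c.app (op V)).hom =
      ⨅ k : κ', (X.top (B k.1)).induced (X.presheaf.resHom k.2) := by
    rw [hZ, induced_iInf]
    refine iInf_congr fun k => ?_
    rw [h k.1, induced_compose, induced_compose]
    exact congrArg (fun g => TopologicalSpace.induced g _) (hc k)
  refine ⟨continuous_iff_le_induced.2 ?_, fun hV => ?_⟩
  · rw [hind]
    exact le_iInf hX
  · rw [hind]
    refine X.top_eq_iInf V (fun k : κ' => B k.1) (fun k => k.2) fun x hx => ?_
    obtain ⟨z, rfl⟩ := hV hx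
    obtain ⟨k, hk, hkV⟩ := hB z V hx
    exact Opens.mem_iSup.2 ⟨⟨k, hkV⟩, hk⟩

/-- Morphisms with the same underlying map agree if they agree on sections over a basis. -/
theorem AlgebraicGeometry.LocallyRingedSpace.hom_ext_of_basis {Z X : LocallyRingedSpace.{u}}
    {p q : Z ⟶ X} (hpq : p.base = q.base) {κ : Type*} (B : κ → Opens X.toTopCat)
    (hB : ∀ (z : Z.toTopCat) (V : Opens X.toTopCat), p.base z ∈ V → ∃ k, p.base z ∈ B k ∧ B k ≤ V)
    (h : ∀ k (W : Opens Z.toTopCat) (h : W ≤ (Opens.map p.base).obj (B k))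
      (h' : W ≤ (Opens.map q.base).obj (B k)), appLE p h = appLE q h') : p = q := by
  obtain ⟨⟨b, pc⟩, hp⟩ := p
  obtain ⟨⟨b', qc⟩, hq⟩ := q
  obtain rfl : b = b' := hpq
  suffices pc = qc by
    subst this
    rfl
  refine NatTrans.ext (funext fun V => ?_)
  refine CommRingCat.hom_ext (RingHom.ext fun s => ?_)
  let κ' := {k // B k ≤ V.unop}
  refine TopCat.Sheaf.eq_of_locally_eq' Z.sheaf (fun k : κ' => (Opens.map b).obj (B k.1))
    ((Opens.map b).obj V.unop) (fun k => homOfLE fun _ hx => k.2 hx) ?_ _ _ fun k => ?_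
  · intro z hz
    obtain ⟨k, hk, hkV⟩ := hB z V.unop hz
    exact Opens.mem_iSup.2 ⟨⟨k, hkV⟩, hk⟩
  · have h1 := congr($(pc.naturality (homOfLE k.2).op) s)
    have h2 := congr($(qc.naturality (homOfLE k.2).op) s)
    refine h1.symm.trans (Eq.trans ?_ h2)
    have h3 := congr($(h k.1 ((Opens.map b).obj (B k.1)) le_rfl le_rfl)
      (X.presheaf.resHom k.2 s))
    refine Eq.trans ?_ (h3.trans ?_)
    · exact (appLE_le_rfl (X := Z) (Y := X) ⟨⟨b, pc⟩, hp⟩ _).symm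
    · exact (appLE_le_rfl (X := Z) (Y := X) ⟨⟨b, qc⟩, hq⟩ _)

/-- An affine open subset of a scheme as the spectrum of a ring isomorphic to its ring of
sections. -/
theorem AlgebraicGeometry.IsAffineOpen.exists_spec {T : Scheme.{u}} {U : T.Opens}
    (hU : IsAffineOpen U) {R : CommRingCat.{u}} (e : Γ(T, U) ≃+* R) :
    ∃ k : Spec R ⟶ T, IsOpenImmersion k ∧ Set.range k = U ∧
      ∀ (V : Opens (Spec R).toLocallyRingedSpace.toTopCat)
        (h : V ≤ (Opens.map k.toLRSHom.base).obj U) (s : Γ(T, U)),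
        appLE k.toLRSHom h s = specConst R V (e s) := by
  let φ : Γ(T, U) ≅ R := e.toCommRingCatIso
  have h1 (W : Opens (Spec Γ(T, U)).toLocallyRingedSpace.toTopCat)
      (h : W ≤ (Opens.map hU.fromSpec.toLRSHom.base).obj U) (s : Γ(T, U)) :
      appLE hU.fromSpec.toLRSHom h s = specConst Γ(T, U) W s := by
    have h2 := congr((Spec Γ(T, U)).toLocallyRingedSpace.presheaf.resHom h
      ($(hU.fromSpec_app_self) s))
    refine Eq.trans ?_ (h2.trans ?_)
    · rfl
    · exact TopCat.Presheaf.map_map_homOfLE (Spec Γ(T, U)).toLocallyRingedSpace.presheaf h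
        le_top _
  refine ⟨Spec.map φ.hom ≫ hU.fromSpec, inferInstance, ?_, fun V h s => ?_⟩
  · rw [Scheme.Hom.comp_base, TopCat.coe_comp, Set.range_comp,
      (Spec.map φ.hom).surjective.range_eq, Set.image_univ, hU.range_fromSpec]
  · refine (appLE_comp (Spec.map φ.hom).toLRSHom hU.fromSpec.toLRSHom le_rfl h s).trans ?_
    exact (congrArg _ (h1 _ le_rfl s)).trans (appLE_specConst φ.hom h s)

/-! ### Adic open subsets are formal spectra -/

section Spf

variable (A : Type u) [CommRing A] (I : Ideal A)

theorem spfRed_preimage_basicOpen (a : A) :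
    (Opens.map (TopLRS.Hom.base (spfRed A I))).obj
      ((spfLRS A I).toRingedSpace.basicOpen (spfConst A I ⊤ a)) =
        PrimeSpectrum.basicOpen (Ideal.Quotient.mk I.radical a) := by
  have h := basicOpen_appLE (TopLRS.Hom.hom (spfRed A I)) (U := ⊤) (V := ⊤) le_top
    (spfConst A I ⊤ a)
  refine (top_inf_eq _).symm.trans (h.symm.trans ?_)
  refine (congrArg (RingedSpace.basicOpen _) (appLE_spfRed A I le_top a)).trans ?_
  exact (basicOpen_specConst _ _ _).trans (top_inf_eq _)

/-- The basic open sets defined by elements of `A` form a basis of the topology of `Spf A`. -/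
theorem isBasis_spf : Opens.IsBasis (Set.range fun a : A =>
    (spfLRS A I).toRingedSpace.basicOpen (spfConst A I ⊤ a)) := by
  refine Opens.isBasis_iff_nbhd.2 fun {U x} hx => ?_
  obtain ⟨y, rfl⟩ := (isHomeomorph_spfRed A I).surjective x
  obtain ⟨_, ⟨r, rfl⟩, hy, hr⟩ := PrimeSpectrum.isTopologicalBasis_basic_opens.exists_subset_of_mem_open
    (show y ∈ ((Opens.map (TopLRS.Hom.base (spfRed A I))).obj U : Set _) from hx)
    ((Opens.map (TopLRS.Hom.base (spfRed A I))).obj U).2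
  obtain ⟨a, rfl⟩ := Ideal.Quotient.mk_surjective r
  refine ⟨_, ⟨a, rfl⟩, ?_, fun z hz => ?_⟩
  · exact (SetLike.ext_iff.1 (spfRed_preimage_basicOpen A I a) y).2 hy
  · obtain ⟨w, rfl⟩ := (isHomeomorph_spfRed A I).surjective z
    exact hr ((SetLike.ext_iff.1 (spfRed_preimage_basicOpen A I a) w).1 hz)

end Spf

/-- A morphism of sheaves on a basis of open sets extends to a morphism, which is an isomorphism
if it is one on the basis. -/
theorem TopCat.Sheaf.exists_iso_of_basis {X : TopCat.{u}} {P Q : X.Presheaf CommRingCat.{u}}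
    (hP : P.IsSheaf) (hQ : Q.IsSheaf) {κ : Type u} {B : κ → Opens X}
    (hB : Opens.IsBasis (Set.range B)) (χ : ∀ k, P.obj (op (B k)) →+* Q.obj (op (B k)))
    (hχ : ∀ k, Function.Bijective (χ k))
    (hres : ∀ k l (h : B l ≤ B k) (x), Q.resHom h (χ k x) = χ l (P.resHom h x)) :
    ∃ φ : P ⟶ Q, IsIso φ ∧ ∀ k x, φ.app (op (B k)) x = χ k x := by
  let α : (inducedFunctor B).op ⋙ P ⟶ (inducedFunctor B).op ⋙ Q :=
    { app := fun k => CommRingCat.ofHom (χ k.unop)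
      naturality := fun k l f => CommRingCat.hom_ext (RingHom.ext fun x =>
        (hres k.unop l.unop (leOfHom ((inducedFunctor B).map f.unop)) x).symm) }
  let φ : P ⟶ Q := TopCat.Sheaf.restrictHomEquivHom P ⟨Q, hQ⟩ hB α
  have h1 (k : κ) : φ.app (op (B k)) = CommRingCat.ofHom (χ k) :=
    TopCat.Sheaf.extend_hom_app P ⟨Q, hQ⟩ hB α k
  let P' : TopCat.Sheaf CommRingCat X := ⟨P, hP⟩
  let Q' : TopCat.Sheaf CommRingCat X := ⟨Q, hQ⟩
  let φ' : P' ⟶ Q' := ⟨φ⟩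
  have h2 : IsIso φ' := by
    refine TopCat.Sheaf.isIso_iff_isIso_basis hB fun k => ?_
    change IsIso (φ.app (op (B k)))
    rw [h1]
    exact (RingEquiv.ofBijective (χ k) (hχ k)).toCommRingCatIso.isIso_hom
  exact ⟨φ, inferInstanceAs (IsIso ((TopCat.Sheaf.forget _ _).map φ')), fun k x => congr($(h1 k) x)⟩

/-- An open embedding of spaces and an isomorphism of structure sheaves give an open immersion of
locally ringed spaces. -/
theorem AlgebraicGeometry.LocallyRingedSpace.exists_isOpenImmersion {Z X : LocallyRingedSpace.{u}}
    (α : Z.toTopCat ⟶ X.toTopCat) (hα : Topology.IsOpenEmbedding α)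
    (φ : hα.functor.op ⋙ X.presheaf ⟶ Z.presheaf) (hφ : IsIso φ) :
    ∃ f : Z ⟶ X, LocallyRingedSpace.IsOpenImmersion f ∧ f.base = α ∧
      ∀ (U : Opens X.toTopCat) (V : Opens Z.toTopCat) (h : V ≤ (Opens.map f.base).obj U)
        (h' : hα.functor.obj V ≤ U) (s : X.presheaf.obj (op U)),
        appLE f h s = φ.app (op V) (X.presheaf.resHom h' s) := by
  have hle (U : Opens X.toTopCat) : hα.functor.obj ((Opens.map α).obj U) ≤ U := by
    rintro _ ⟨z, hz, rfl⟩
    exact hz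
  let c : X.presheaf ⟶ (TopCat.Presheaf.pushforward _ α).obj Z.presheaf :=
    { app := fun U => X.presheaf.map (homOfLE (hle U.unop)).op ≫
        φ.app (op ((Opens.map α).obj U.unop))
      naturality := fun U V g => by
        refine CommRingCat.hom_ext (RingHom.ext fun s => ?_)
        have h1 := congr($(φ.naturality ((Opens.map α).op.map g))
          (X.presheaf.map (homOfLE (hle U.unop)).op s))
        refine Eq.trans ?_ h1
        refine congrArg (φ.app (op ((Opens.map α).obj V.unop))) ?_
        refine (X.presheaf.map_map_homOfLE (hle V.unop) (leOfHom g.unop) s).trans ?_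
        exact (X.presheaf.map_map_homOfLE _ (hle U.unop) s).symm }
  let f₀ : Z.toPresheafedSpace ⟶ X.toPresheafedSpace := ⟨α, c⟩
  have hf₀ : PresheafedSpace.IsOpenImmersion f₀ := by
    refine ⟨hα, fun V => ?_⟩
    have h1 : IsIso (φ.app (op ((Opens.map α).obj (hα.functor.obj V)))) := inferInstance
    have h2 : hα.functor.obj ((Opens.map α).obj (hα.functor.obj V)) = hα.functor.obj V := by
      refine le_antisymm (hle _) ?_
      rintro _ ⟨z, hz, rfl⟩
      exact ⟨z, ⟨z, hz, rfl⟩, rfl⟩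
    have h3 : IsIso (X.presheaf.map (homOfLE (hle (hα.functor.obj V))).op) := by
      have : homOfLE (hle (hα.functor.obj V)) = eqToHom h2 := rfl
      rw [this]
      infer_instance
    exact IsIso.comp_isIso' h3 h1
  refine ⟨⟨f₀, fun x => ?_⟩, hf₀, rfl, fun U V h h' s => ?_⟩
  · infer_instance
  · have h1 := congr($(φ.naturality (homOfLE h).op) (X.presheaf.resHom (hle U) s))
    refine h1.symm.trans ?_
    refine congrArg (φ.app (op V)) ?_
    exact X.presheaf.map_map_homOfLE (fun x hx => by
      obtain ⟨z, hz, rfl⟩ := hx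
      exact ⟨z, h hz, rfl⟩) (hle U) s

/-- Every ring under `A / √I` is `I`-adically complete, as `I` generates the zero ideal in it. -/
theorem isAdicComplete_map_of_factors_mk_radical {A B : Type*} [CommRing A] [CommRing B]
    {I : Ideal A} {g : A ⧸ I.radical →+* B} {h : A →+* B} (hg : h = g.comp (Ideal.Quotient.mk _)) :
    IsAdicComplete (I.map h) B := by
  have h1 : I.map h = ⊥ := by
    refine (Ideal.map_eq_bot_iff_le_ker _).2 fun x hx => ?_
    rw [hg]
    exact (congrArg g (Ideal.Quotient.eq_zero_iff_mem.2 (Ideal.le_radical hx))).trans (map_zero g)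
  rw [h1]
  infer_instance

namespace TopLRS

variable {X : TopLRS.{u}} {U : Opens X.toTopCat} {I : Ideal (X.sec U)}

/-- The sheaf of rings on an adic open set is the structure sheaf of a formal spectrum, provided
that the points and basic open sets match. -/
theorem IsAdicOpen.exists_sheaf_iso (H : X.IsAdicOpen U I)
    {α : (spfLRS (X.sec U) I).toTopCat ⟶ X.toTopCat} (hα : Topology.IsOpenEmbedding α)
    (hD : ∀ a : X.sec U, hα.functor.obj ((spfLRS (X.sec U) I).toRingedSpace.basicOpen
      (spfConst (X.sec U) I ⊤ a)) = X.toRingedSpace.basicOpen a) :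
    ∃ φ : hα.functor.op ⋙ X.presheaf ⟶ (spfLRS (X.sec U) I).presheaf, IsIso φ ∧
      ∀ (V : Opens (spfLRS (X.sec U) I).toTopCat) (h : hα.functor.obj V ≤ U) (a : X.sec U),
        φ.app (op V) (X.presheaf.resHom h a) = spfConst (X.sec U) I V a := by
  let B (a : X.sec U) := (spfLRS (X.sec U) I).toRingedSpace.basicOpen (spfConst (X.sec U) I ⊤ a)
  have hB (a : X.sec U) : hα.functor.obj (B a) ≤ U := by
    rw [hD]
    exact RingedSpace.basicOpen_le X.toRingedSpace a
  have hX (a : X.sec U) := H.loc a _ (hB a) (hD a)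
  have hS (a : X.sec U) := (spf_isAdicLocalization_and_ker (X.sec U) H.fg a (B a) rfl).1
  have hχ (a : X.sec U) : ∃ χ : X.sec (hα.functor.obj (B a)) →+*
      (spfLRS (X.sec U) I).presheaf.obj (op (B a)), χ.comp (X.presheaf.resHom (hB a)) =
        spfConst (X.sec U) I (B a) := (hX a).exists_lift (hS a).isUnit (hS a).complete
  choose χ hχ using hχ
  obtain ⟨φ, hφ, hφχ⟩ := TopCat.Sheaf.exists_iso_of_basis
    (P := hα.functor.op ⋙ X.presheaf) (Q := (spfLRS (X.sec U) I).presheaf)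
    (X.toLocallyRingedSpace.restrict hα).IsSheaf (spfLRS (X.sec U) I).IsSheaf
    (isBasis_spf (X.sec U) I) χ (fun a => (hX a).bijective (hS a) (hχ a)) (fun a b h x => by
      have h' : hα.functor.obj (B b) ≤ hα.functor.obj (B a) := hα.functor.monotone h
      have e1 : ((spfLRS (X.sec U) I).presheaf.resHom h).comp (χ a) =
          (χ b).comp (X.presheaf.resHom h') := by
        have e2 : (((spfLRS (X.sec U) I).presheaf.resHom h).comp (χ a)).comp
            (X.presheaf.resHom (hB a)) = spfConst (X.sec U) I (B b) := by
          rw [RingHom.comp_assoc, hχ]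
          exact RingHom.ext (res_spfConst _ _ h)
        have e3 : ((χ b).comp (X.presheaf.resHom h')).comp (X.presheaf.resHom (hB a)) =
            spfConst (X.sec U) I (B b) := by
          rw [RingHom.comp_assoc, TopCat.Presheaf.resHom_comp, hχ]
        refine (hX a).hom_ext (e2.trans e3.symm) ?_
        rw [e2]
        exact (hS b).complete
      exact congr($e1 x))
  refine ⟨φ, hφ, fun V h a => ?_⟩
  have h1 : B 1 = ⊤ := by
    change RingedSpace.basicOpen _ (spfConst _ _ _ 1) = ⊤
    rw [map_one]
    exact RingedSpace.basicOpen_of_isUnit (spfLRS (X.sec U) I).toRingedSpace isUnit_one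
  have h2 : φ.app (op (B 1)) (X.presheaf.resHom (hB 1) a) = spfConst (X.sec U) I (B 1) a :=
    (hφχ 1 _).trans congr($(hχ 1) a)
  have hV : V ≤ B 1 := h1 ▸ le_top
  have h3 := congr($(φ.naturality (homOfLE hV).op) (X.presheaf.resHom (hB 1) a))
  refine Eq.trans ?_ (h3.trans ?_)
  · exact congrArg (φ.app (op V))
      (X.presheaf.map_map_homOfLE (hα.functor.monotone hV) (hB 1) a).symm
  · exact (congrArg ((spfLRS (X.sec U) I).presheaf.resHom hV) h2).trans (res_spfConst _ _ hV a)

/-- An adic open set is the image of an open immersion of a formal spectrum, provided that the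
points and basic open sets match. -/
theorem IsAdicOpen.exists_isOpenImmersion (H : X.IsAdicOpen U I)
    {α : (spfLRS (X.sec U) I).toTopCat ⟶ X.toTopCat} (hα : Topology.IsOpenEmbedding α)
    (hD : ∀ a : X.sec U, hα.functor.obj ((spfLRS (X.sec U) I).toRingedSpace.basicOpen
      (spfConst (X.sec U) I ⊤ a)) = X.toRingedSpace.basicOpen a) :
    ∃ f : Spf (X.sec U) I ⟶ X, TopLRS.IsOpenImmersion f ∧ TopLRS.Hom.base f = α ∧
      ∀ (V : Opens (spfLRS (X.sec U) I).toTopCat)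
        (h : V ≤ (Opens.map (TopLRS.Hom.base f)).obj U) (a : X.sec U),
        appLE (TopLRS.Hom.hom f) h a = spfConst (X.sec U) I V a := by
  obtain ⟨φ, hφ, hφc⟩ := H.exists_sheaf_iso hα hD
  obtain ⟨f, hf, hfα, hfφ⟩ := LocallyRingedSpace.exists_isOpenImmersion (Z := spfLRS (X.sec U) I)
    (X := X.toLocallyRingedSpace) α hα φ hφ
  have hfc (V : Opens (spfLRS (X.sec U) I).toTopCat) (h : V ≤ (Opens.map f.base).obj U)
      (a : X.sec U) : appLE f h a = spfConst (X.sec U) I V a := by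
    have h' : hα.functor.obj V ≤ U := by
      rintro _ ⟨z, hz, rfl⟩
      rw [← hfα]
      exact h hz
    exact (hfφ U V h h' a).trans (hφc V h' a)
  let B (a : X.sec U) : Opens X.toTopCat := X.toRingedSpace.basicOpen a
  have hpre (a : X.sec U) : (Opens.map f.base).obj (B a) =
      (spfLRS (X.sec U) I).toRingedSpace.basicOpen (spfConst (X.sec U) I ⊤ a) := by
    rw [hfα]
    change (Opens.map α).obj (X.toRingedSpace.basicOpen a) = _
    rw [← hD]
    exact Opens.ext (Set.preimage_image_eq _ hα.injective)
  have hr (a : X.sec U) : (B a : Set X.toTopCat) ⊆ Set.range f.base := by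
    rw [hfα]
    exact (congrArg (fun V : Opens X.toTopCat => (V : Set X.toTopCat)) (hD a)).symm.subset.trans
      (Set.image_subset_range _ _)
  have key := TopLRS.continuous_and_top_eq_of_basis (Z := Spf (X.sec U) I) (X := X) f B
    (fun z V hz => by
      obtain ⟨_, ⟨a, rfl⟩, hza, ha⟩ := Opens.isBasis_iff_nbhd.1 (isBasis_spf (X.sec U) I)
        (show z ∈ (Opens.map f.base).obj V from hz)
      refine ⟨a, (SetLike.ext_iff.1 (hpre a) z).2 hza, fun x hx => ?_⟩
      obtain ⟨w, rfl⟩ := hr a hx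
      exact ha ((SetLike.ext_iff.1 (hpre a) w).1 hx)) fun a => by
    have hle : B a ≤ U := RingedSpace.basicOpen_le X.toRingedSpace a
    have ht := spf_top_eq (X.sec U) H.fg a _ (hpre a)
    refine (H.top_eq a (B a) hle rfl).trans
      (Eq.trans ?_ (congrArg (TopologicalSpace.induced (f.c.app (op (B a))).hom) ht.symm))
    have h1 : ((f.c.app (op (B a))).hom : X.sec (B a) → _) =
        appEquiv f hf (hr a) rfl := funext fun x => (appLE_le_rfl f x).symm
    refine Eq.trans ?_ (congrArg (fun g => TopologicalSpace.induced g _) h1.symm)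
    refine (induced_adicTopology (appEquiv f hf (hr a) rfl) _).symm.trans ?_
    congr 2
    rw [Ideal.map_map]
    congr 1
    exact RingHom.ext fun x => (appLE_res f le_rfl hle x).trans (hfc _ _ x)
  exact ⟨TopLRS.Hom.mk f fun V => (key V).1, ⟨hf, fun V hV => (key V).2 hV⟩, hfα, hfc⟩

variable {T : Scheme.{u}} {i : schemeTop T ⟶ X}

/-- An affine adic open set is the image of an affine chart `Spf A → X` with `A` its ring of
sections, over which the reduced special fibre is `Spec (A / √I)`. -/
theorem IsAffineAdicOpen.exists_chart (hi : IsHomeomorph (TopLRS.Hom.base i))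
    (H : IsAffineAdicOpen i U I) :
    ∃ c : AffineChart X, c.range = U ∧
      (∃ e : c.A ≃+* X.sec U, c.I.map (e : c.A →+* X.sec U) = I) ∧
      ∃ k : Spec (CommRingCat.of (c.A ⧸ c.I.radical)) ⟶ T, AlgebraicGeometry.IsOpenImmersion k ∧
        schemeTopMap k ≫ i = spfRed c.A c.I ≫ c.hom ∧
        Set.range k = TopLRS.Hom.base i ⁻¹' c.range := by
  let ψ : X.sec U →+* (schemeTop T).sec ((Opens.map (TopLRS.Hom.base i)).obj U) :=
    ((TopLRS.Hom.hom i).c.app (op U)).hom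
  let e : (schemeTop T).sec ((Opens.map (TopLRS.Hom.base i)).obj U) ≃+* X.sec U ⧸ I.radical :=
    ((Ideal.quotEquivOfEq H.ker_eq.symm).trans
      (RingHom.quotientKerEquivOfSurjective (f := ψ) H.surjective)).symm
  have he (a : X.sec U) : e (ψ a) = Ideal.Quotient.mk _ a := by
    refine (RingEquiv.symm_apply_eq _).2 ?_
    rfl
  obtain ⟨k, hk, hkr, hkc⟩ := H.isAffineOpen.exists_spec
    (R := CommRingCat.of (X.sec U ⧸ I.radical)) e
  have hkic (V : Opens (Spec (CommRingCat.of (X.sec U ⧸ I.radical))).toLocallyRingedSpace.toTopCat)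
      (h : V ≤ (Opens.map (TopLRS.Hom.base (schemeTopMap k ≫ i))).obj U) (a : X.sec U) :
      appLE (TopLRS.Hom.hom (schemeTopMap k ≫ i)) h a =
        specConst (CommRingCat.of (X.sec U ⧸ I.radical)) V (Ideal.Quotient.mk _ a) := by
    refine (appLE_comp k.toLRSHom (TopLRS.Hom.hom i) le_rfl h a).trans ?_
    refine (congrArg _ (appLE_le_rfl (TopLRS.Hom.hom i) a)).trans ?_
    exact (hkc V h (ψ a)).trans (congrArg _ (he a))
  let r := TopLRS.Hom.base (spfRed (X.sec U) I)
  have hr : IsHomeomorph r := isHomeomorph_spfRed (X.sec U) I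
  let β := TopLRS.Hom.base (schemeTopMap k ≫ i)
  have hβ : Topology.IsOpenEmbedding β := hi.isOpenEmbedding.comp k.isOpenEmbedding
  let α : (spfLRS (X.sec U) I).toTopCat ⟶ X.toTopCat := TopCat.ofHom
    ⟨fun z => β (hr.homeomorph.symm z), β.hom.continuous.comp hr.homeomorph.symm.continuous⟩
  have hα : Topology.IsOpenEmbedding α := hβ.comp hr.homeomorph.symm.isOpenEmbedding
  have hαr (y) : α (r y) = β y := congrArg β (hr.homeomorph.symm_apply_apply y)
  have hβD (a : X.sec U) (y) : β y ∈ X.toRingedSpace.basicOpen a ↔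
      y ∈ PrimeSpectrum.basicOpen (Ideal.Quotient.mk I.radical a) := by
    have hβU : ⊤ ≤ (Opens.map β).obj U := fun z _ => hkr.subset (Set.mem_range_self (f := k) z)
    have h1 := basicOpen_appLE (TopLRS.Hom.hom (schemeTopMap k ≫ i)) hβU a
    have h2 := (congrArg (RingedSpace.basicOpen _) (hkic ⊤ hβU a)).symm.trans h1
    have h3 := (basicOpen_specConst _ _ _).symm.trans h2
    exact (SetLike.ext_iff.1 ((top_inf_eq _).symm.trans (h3.trans (top_inf_eq _))) y).symm
  have hrD (a : X.sec U) (y) : r y ∈ (spfLRS (X.sec U) I).toRingedSpace.basicOpen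
      (spfConst (X.sec U) I ⊤ a) ↔ y ∈ PrimeSpectrum.basicOpen (Ideal.Quotient.mk I.radical a) :=
    SetLike.ext_iff.1 (spfRed_preimage_basicOpen (X.sec U) I a) y
  have hUβ {x} (hx : x ∈ U) : ∃ y, β y = x := by
    obtain ⟨t, rfl⟩ := hi.surjective x
    obtain ⟨y, rfl⟩ := hkr.symm.subset hx
    exact ⟨y, rfl⟩
  have hD (a : X.sec U) : hα.functor.obj ((spfLRS (X.sec U) I).toRingedSpace.basicOpen
      (spfConst (X.sec U) I ⊤ a)) = X.toRingedSpace.basicOpen a := by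
    refine Opens.ext (Set.ext fun x => ⟨?_, fun hx => ?_⟩)
    · rintro ⟨z, hz, rfl⟩
      obtain ⟨y, rfl⟩ := hr.surjective z
      change α (r y) ∈ X.toRingedSpace.basicOpen a
      rw [hαr]
      exact (hβD a y).2 ((hrD a y).1 hz)
    · obtain ⟨y, rfl⟩ := hUβ (RingedSpace.basicOpen_le X.toRingedSpace a hx)
      exact ⟨r y, (hrD a y).2 ((hβD a y).1 hx), hαr y⟩
  obtain ⟨f, hf, hfα, hfc⟩ := H.exists_isOpenImmersion hα hD
  have hfr (y) : TopLRS.Hom.base f (r y) = β y := by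
    rw [hfα]
    exact hαr y
  have hrange : Set.range (TopLRS.Hom.base f) = U := by
    ext x
    constructor
    · rintro ⟨z, rfl⟩
      obtain ⟨y, rfl⟩ := hr.surjective z
      rw [hfr]
      exact hkr.subset (Set.mem_range_self (f := k) y)
    · intro hx
      obtain ⟨y, rfl⟩ := hUβ hx
      exact ⟨r y, hfr y⟩
  refine ⟨⟨X.sec U, I, H.fg, H.isAdicComplete, f, hf⟩, hrange, ⟨RingEquiv.refl _, I.map_id⟩, k, hk,
    TopLRS.Hom.ext ?_, ?_⟩
  · refine hom_ext_of_basis (TopCat.hom_ext (ContinuousMap.ext fun y => (hfr y).symm))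
      (fun a : X.sec U => X.toRingedSpace.basicOpen a) (fun y V hy => ?_) fun a W h h' => ?_
    · obtain ⟨_, ⟨a, rfl⟩, hya, ha⟩ := Opens.isBasis_iff_nbhd.1 (isBasis_spf (X.sec U) I)
        (show r y ∈ (Opens.map α).obj V from (congrArg (· ∈ V) (hαr y)).mpr hy)
      refine ⟨a, (hβD a y).2 ((hrD a y).1 hya), fun x hx => ?_⟩
      obtain ⟨w, rfl⟩ := hUβ (RingedSpace.basicOpen_le X.toRingedSpace a hx)
      exact (hαr w) ▸ ha ((hrD a w).2 ((hβD a w).1 hx))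
    · have hle : X.toRingedSpace.basicOpen a ≤ U := RingedSpace.basicOpen_le X.toRingedSpace a
      have e1 : (appLE (TopLRS.Hom.hom (schemeTopMap k ≫ i)) h).comp (X.presheaf.resHom hle) =
          (specConst (CommRingCat.of (X.sec U ⧸ I.radical)) W).comp (Ideal.Quotient.mk _) :=
        RingHom.ext fun b => (appLE_res _ h hle b).trans (hkic W _ b)
      have e2 : (appLE (TopLRS.Hom.hom (spfRed (X.sec U) I ≫ f)) h').comp
          (X.presheaf.resHom hle) =
            (specConst (CommRingCat.of (X.sec U ⧸ I.radical)) W).comp (Ideal.Quotient.mk _) := by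
        refine RingHom.ext fun b => (appLE_res _ h' hle b).trans ?_
        refine (appLE_comp (TopLRS.Hom.hom (spfRed (X.sec U) I)) (TopLRS.Hom.hom f) (U := U)
          le_rfl (fun y hy => hle (h' hy)) b).trans ?_
        exact (congrArg _ (hfc _ le_rfl b)).trans (appLE_spfRed (X.sec U) I _ b)
      exact (H.loc a _ hle rfl).hom_ext (e1.trans e2.symm)
        (isAdicComplete_map_of_factors_mk_radical e1)
  · refine hkr.trans ?_
    exact congrArg (Set.preimage (TopLRS.Hom.base i)) hrange.symm

end TopLRS

/-! ### Radicals in completed localizations -/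

/-- If `C` is the quotient of `A` by `√I`, then the localization of `C` away from `f` is the
quotient of the completed localization `L` of `A` by `√(I L)`. -/
theorem IsAdicLocalization.surjective_and_ker_eq_radical {A L C C' : Type*} [CommRing A]
    [CommRing L] [CommRing C] [CommRing C'] {I : Ideal A} {f : A} {φ : A →+* L}
    (hφ : IsAdicLocalization I f φ) {ψ : A →+* C} (hψ : Function.Surjective ψ)
    (hker : RingHom.ker ψ = I.radical) {t : C →+* C'} (ht : IsAdicLocalization ⊥ (ψ f) t)
    {u : L →+* C'} (hu : ∀ a, u (φ a) = t (ψ a)) :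
    Function.Surjective u ∧ RingHom.ker u = (I.map φ).radical := by
  have ht1 (y : C') : ∃ m a, t (ψ f) ^ m * y = t (ψ a) := by
    obtain ⟨m, c, h⟩ := ht.surj 1 y
    obtain ⟨a, rfl⟩ := hψ c
    rw [Ideal.map_bot, pow_one, Ideal.mem_bot, sub_eq_zero] at h
    exact ⟨m, a, h⟩
  have ht2 (a : A) (h : t (ψ a) = 0) : ∃ m, f ^ m * a ∈ I.radical := by
    obtain ⟨m, hm⟩ := ht.inj 1 (ψ a) (by rw [h]; exact zero_mem _)
    rw [pow_one, Ideal.mem_bot, ← map_pow, ← map_mul] at hm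
    exact ⟨m, hker ▸ hm⟩
  have hrad {a : A} (h : a ∈ I.radical) : u (φ a) = 0 := by
    rw [← hker] at h
    rw [hu, RingHom.mem_ker.1 h, map_zero]
  have hI : I.map φ ≤ RingHom.ker u := by
    rw [Ideal.map_le_iff_le_comap]
    exact fun a ha => hrad (Ideal.le_radical ha)
  refine ⟨fun y => ?_, le_antisymm (fun x hx => ?_) fun x hx => ?_⟩
  · obtain ⟨m, a, h⟩ := ht1 y
    obtain ⟨v, hv⟩ := hφ.isUnit.pow m
    refine ⟨v.inv * φ a, ?_⟩
    rw [map_mul, hu, ← h, ← mul_assoc, ← hu, ← map_pow, ← map_mul, ← hv, v.inv_val, map_one,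
      one_mul]
  · obtain ⟨m, a, h⟩ := hφ.surj 1 x
    rw [pow_one] at h
    have h1 : u (φ a) = 0 := by
      have h2 := hI h
      rw [RingHom.mem_ker, map_sub, map_mul, RingHom.mem_ker.1 hx, mul_zero, zero_sub,
        neg_eq_zero] at h2
      exact h2
    rw [hu] at h1
    obtain ⟨k, n, hn⟩ := ht2 a h1
    have h3 : φ a ∈ (I.map φ).radical := by
      refine ⟨n, ((hφ.isUnit.pow k).pow n).mul_mem_iff.1 ?_⟩
      rw [← mul_pow, ← map_pow, ← map_mul, ← map_pow]
      exact Ideal.mem_map_of_mem _ hn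
    refine ((hφ.isUnit.pow m).mul_mem_iff).1 ?_
    have := Ideal.add_mem _ (Ideal.le_radical h) h3
    rwa [sub_add_cancel] at this
  · obtain ⟨n, hn⟩ := hx
    obtain ⟨m, a, h⟩ := ht1 (u x)
    have h1 : t (ψ (a ^ n)) = 0 := by
      rw [map_pow, map_pow, ← h, mul_pow, ← map_pow u, RingHom.mem_ker.1 (hI hn), mul_zero]
    obtain ⟨k, hk⟩ := ht2 _ h1
    have h2 : f ^ k * a ∈ I.radical := by
      have : (f ^ k * a) ^ (n + 1) ∈ I.radical := by
        have e : (f ^ k * a) ^ (n + 1) = (f ^ k) ^ n * a * (f ^ k * a ^ n) := by ring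
        rw [e]
        exact Ideal.mul_mem_left _ _ hk
      exact (Ideal.radical_isRadical I) ⟨n + 1, this⟩
    have h3 := hrad h2
    rw [hu, map_mul, map_mul, ← h, map_pow, map_pow, ← mul_assoc] at h3
    exact (((ht.isUnit.pow k).mul (ht.isUnit.pow m)).mul_right_eq_zero).1 h3

section

variable {R₁ R₂ P : Type*} [CommRing R₁] [CommRing R₂] [CommRing P] {p₁ : R₁ →+* P} {p₂ : R₂ →+* P}
  {I₁ : Ideal R₁} {I₂ : Ideal R₂} {f₁ : R₁} {f₂ : R₂}

/-- Elements of `√(I₁ P)` are approximated by elements of `√I₁`, up to a power of `f`. -/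
theorem IsAdicLocalization.exists_approx_of_mem_radical {f : R₁}
    (H : IsAdicLocalization I₁ f p₁) {z : P} (hz : z ∈ (I₁.map p₁).radical) :
    ∃ m, ∃ r ∈ I₁.radical, p₁ f ^ m * z - p₁ r ∈ I₁.map p₁ := by
  obtain ⟨m, a, ha⟩ := H.surj 1 z
  rw [pow_one] at ha
  have h1 : p₁ a ∈ (I₁.map p₁).radical := by
    have := Ideal.sub_mem _ (Ideal.mul_mem_left _ (p₁ f ^ m) hz) (Ideal.le_radical ha)
    rwa [sub_sub_cancel] at this
  obtain ⟨n, hn⟩ := h1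
  obtain ⟨k, hk⟩ := H.inj 1 (a ^ n) (by rwa [map_pow, pow_one])
  rw [pow_one] at hk
  refine ⟨m + k, f ^ k * a, ⟨n + 1, ?_⟩, ?_⟩
  · have e : (f ^ k * a) ^ (n + 1) = (f ^ k) ^ n * a * (f ^ k * a ^ n) := by ring
    rw [e]
    exact Ideal.mul_mem_left _ _ hk
  · have e : p₁ f ^ (m + k) * z - p₁ (f ^ k * a) = p₁ f ^ k * (p₁ f ^ m * z - p₁ a) := by
      rw [map_mul, map_pow]
      ring
    rw [e]
    exact Ideal.mul_mem_left _ _ ha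

/-- Elements of `√(I₁ P)` are sums of elements of `√I₁` and `√I₂`. -/
theorem exists_split_radical (hI : I₁.map p₁ = I₂.map p₂) (c₁ : IsAdicComplete I₁ R₁)
    (c₂ : IsAdicComplete I₂ R₂) (H₁ : IsAdicLocalization I₁ (1 - f₁) p₁)
    (H₂ : IsAdicLocalization I₂ f₂ p₂) (hM : p₁ f₁ - p₂ f₂ ∈ (I₁.map p₁).radical) {z : P}
    (hz : z ∈ (I₁.map p₁).radical) : ∃ r₁ ∈ I₁.radical, ∃ r₂ ∈ I₂.radical, z = p₁ r₁ + p₂ r₂ := by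
  obtain ⟨M, hM⟩ := hM
  have h1 (z : P) (hz : z ∈ (I₁.map p₁).radical) := H₁.exists_approx_of_mem_radical hz
  have h2 (z : P) (hz : z ∈ (I₁.map p₁).radical) :
      ∃ m, ∃ r ∈ I₂.radical, p₂ f₂ ^ m * z - p₂ r ∈ I₁.map p₁ := by
    rw [hI] at hz ⊢
    exact H₂.exists_approx_of_mem_radical hz
  obtain ⟨r₁, hr₁, r₂, hr₂, h⟩ := exists_split (f₁ := f₁) (f₂ := f₂)
    h1 h2
    (fun z _ => Ideal.mul_mem_right z _ hM) hz
  obtain ⟨s₁, hs₁, s₂, hs₂, h'⟩ := exists_split_pow hI c₁ c₂ H₁ H₂ hM 1 (by rwa [pow_one])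
  rw [pow_one] at hs₁ hs₂
  refine ⟨r₁ + s₁, Ideal.add_mem _ hr₁ (Ideal.le_radical hs₁), r₂ + s₂,
    Ideal.add_mem _ hr₂ (Ideal.le_radical hs₂), ?_⟩
  rw [map_add, map_add]
  linear_combination h'

end

/-! ### Basic open sets of affine adic open sets -/

/-- Sections over `D(f)` in an affine open subset of a scheme, as a completed localization for the
zero ideal. -/
theorem AlgebraicGeometry.IsAffineOpen.isAdicLocalization_res {T : Scheme.{u}} {O : T.Opens}
    (hO : IsAffineOpen O) (f : Γ(T, O)) {W : T.Opens} (h : W ≤ O) (hW : W = T.basicOpen f) :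
    IsAdicLocalization ⊥ f (T.toLocallyRingedSpace.presheaf.resHom h) := by
  subst hW
  exact @IsAdicLocalization.of_isLocalization Γ(T, O) _ _ _
    (Scheme.algebra_section_section_basicOpen f) f (hO.isLocalization_basicOpen f)

namespace TopLRS

variable {X : TopLRS.{u}} {T : Scheme.{u}} {i : schemeTop T ⟶ X}

theorem opens_eq_of_preimage_eq (hi : Function.Surjective (TopLRS.Hom.base i))
    {U V : Opens X.toTopCat} (h : (Opens.map (TopLRS.Hom.base i)).obj U =
      (Opens.map (TopLRS.Hom.base i)).obj V) : U = V := by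
  ext x
  obtain ⟨t, rfl⟩ := hi x
  exact SetLike.ext_iff.1 h t

theorem preimage_basicOpen_app {U : Opens X.toTopCat} (s : X.sec U) :
    (Opens.map (TopLRS.Hom.base i)).obj (X.toRingedSpace.basicOpen s) =
      T.basicOpen (U := (Opens.map (TopLRS.Hom.base i)).obj U)
        ((TopLRS.Hom.hom i).c.app (op U) s) :=
  LocallyRingedSpace.preimage_basicOpen (TopLRS.Hom.hom i) s

theorem basicOpen_eq_of_app_eq (hi : Function.Surjective (TopLRS.Hom.base i))
    {U : Opens X.toTopCat} {s t : X.sec U}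
    (h : (TopLRS.Hom.hom i).c.app (op U) s = (TopLRS.Hom.hom i).c.app (op U) t) :
    X.toRingedSpace.basicOpen s = X.toRingedSpace.basicOpen t := by
  refine opens_eq_of_preimage_eq hi ?_
  rw [preimage_basicOpen_app, preimage_basicOpen_app]
  exact congrArg _ h

/-- The naturality of the map from sections of `X` to sections of its reduced special fibre. -/
theorem app_res {U V : Opens X.toTopCat} (h : V ≤ U) (s : X.sec U) :
    (TopLRS.Hom.hom i).c.app (op V) (X.presheaf.resHom h s) =
      T.toLocallyRingedSpace.presheaf.resHom (fun _ hx => h hx)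
        ((TopLRS.Hom.hom i).c.app (op U) s) :=
  congr($((TopLRS.Hom.hom i).c.naturality (homOfLE h).op) s)

namespace IsAffineAdicOpen

variable {U : Opens X.toTopCat} {I : Ideal (X.sec U)}

theorem of_pow_le (H : IsAffineAdicOpen i U I) {I' : Ideal (X.sec U)} (hI' : I'.FG) {k l : ℕ}
    (h1 : I ^ k ≤ I') (h2 : I' ^ l ≤ I) : IsAffineAdicOpen i U I' where
  toIsAdicOpen := H.toIsAdicOpen.of_pow_le hI' h1 h2
  isAffineOpen := H.isAffineOpen
  surjective := H.surjective
  ker_eq := by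
    have hle {J J' : Ideal (X.sec U)} {k : ℕ} (h : J ^ k ≤ J') : J.radical ≤ J'.radical := by
      intro x ⟨n, hn⟩
      exact ⟨n * k, pow_mul x n k ▸ h (Ideal.pow_mem_pow hn k)⟩
    exact H.ker_eq.trans (le_antisymm (hle h1) (hle h2))

/-- Basic open subsets of affine adic open sets are affine adic open sets. -/
theorem basicOpen (hi : Function.Surjective (TopLRS.Hom.base i)) (H : IsAffineAdicOpen i U I)
    (f : X.sec U) {W : Opens X.toTopCat} (h : W ≤ U) (hW : W = X.toRingedSpace.basicOpen f) :
    IsAffineAdicOpen i W (I.map (X.presheaf.resHom h)) := by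
  have hφ := H.loc f W h hW
  have hWT := (congrArg (Opens.map (TopLRS.Hom.base i)).obj hW).trans (preimage_basicOpen_app f)
  have hpre : (Opens.map (TopLRS.Hom.base i)).obj W ≤ (Opens.map (TopLRS.Hom.base i)).obj U :=
    fun _ hx => h hx
  obtain ⟨h1, h2⟩ := hφ.surjective_and_ker_eq_radical H.surjective H.ker_eq
    (H.isAffineOpen.isAdicLocalization_res ((TopLRS.Hom.hom i).c.app (op U) f) hpre hWT)
    (u := ((TopLRS.Hom.hom i).c.app (op W)).hom) (app_res h)
  have key (s : X.sec W) (m : ℕ) (a : X.sec U) (ha : X.presheaf.resHom h f ^ m * s -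
      X.presheaf.resHom h a ∈ I.map (X.presheaf.resHom h)) :
      X.toRingedSpace.basicOpen s = X.toRingedSpace.basicOpen (f * a) := by
    have e1 : X.toRingedSpace.basicOpen (X.presheaf.resHom h f ^ m * s) =
        X.toRingedSpace.basicOpen (X.presheaf.resHom h a) := by
      refine basicOpen_eq_of_app_eq hi (sub_eq_zero.1 ?_)
      have := Ideal.le_radical ha
      rw [← h2] at this
      exact (map_sub ((TopLRS.Hom.hom i).c.app (op W)).hom _ _).symm.trans this
    have e2 : X.toRingedSpace.basicOpen (X.presheaf.resHom h f ^ m * s) =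
        X.toRingedSpace.basicOpen s := by
      refine (RingedSpace.basicOpen_mul X.toRingedSpace _ _).trans (inf_eq_right.2 ?_)
      refine (RingedSpace.basicOpen_le X.toRingedSpace s).trans ?_
      exact (RingedSpace.basicOpen_of_isUnit X.toRingedSpace (hφ.isUnit.pow m)).ge
    rw [← e2, e1, basicOpen_res, RingedSpace.basicOpen_mul, ← hW]
  refine ⟨⟨H.fg.map _, fun s W' h' hW' => ?_, fun s W' h' hW' => ?_⟩, ?_, h1, h2⟩
  · refine hφ.of_comp fun n m a ha => ?_
    rw [TopCat.Presheaf.resHom_comp]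
    exact H.loc _ _ _ (hW'.trans (key s m a (Ideal.pow_le_self n.succ_ne_zero ha)))
  · obtain ⟨m, a, ha⟩ := hφ.surj 1 s
    rw [pow_one] at ha
    rw [Ideal.map_map, TopCat.Presheaf.resHom_comp]
    exact H.top_eq _ _ _ (hW'.trans (key s m a ha))
  · rw [hWT]
    exact H.isAffineOpen.basicOpen _

end IsAffineAdicOpen

end TopLRS

/-! ### Gluing two affine adic open sets -/

/-- Gluing of two sections. The intersection `W₁₂` is only assumed equal to `W₁ ⊓ W₂` in the form of
inequalities, so that no transport along an equality of open sets is needed. -/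
theorem AlgebraicGeometry.LocallyRingedSpace.exists_res_eq (X : LocallyRingedSpace.{u})
    {W W₁ W₂ W₁₂ : Opens X.toTopCat} (h₁ : W₁ ≤ W) (h₂ : W₂ ≤ W) (d₁ : W₁₂ ≤ W₁) (d₂ : W₁₂ ≤ W₂)
    (hW : W ≤ W₁ ⊔ W₂) (hW₁₂ : W₁ ⊓ W₂ ≤ W₁₂) (r₁ : X.presheaf.obj (op W₁))
    (r₂ : X.presheaf.obj (op W₂)) (h : X.presheaf.resHom d₁ r₁ = X.presheaf.resHom d₂ r₂) :
    ∃ x, X.presheaf.resHom h₁ x = r₁ ∧ X.presheaf.resHom h₂ x = r₂ := by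
  have h' : X.presheaf.resHom (inf_le_left : W₁ ⊓ W₂ ≤ W₁) r₁ =
      X.presheaf.resHom (inf_le_right : W₁ ⊓ W₂ ≤ W₂) r₂ := by
    have := congrArg (X.presheaf.resHom hW₁₂) h
    exact (X.presheaf.map_map_homOfLE hW₁₂ d₁ r₁).symm.trans
      (this.trans (X.presheaf.map_map_homOfLE hW₁₂ d₂ r₂))
  let U : Bool → Opens X.toTopCat := fun b => Bool.rec W₁ W₂ b
  have hU (b : Bool) : U b ≤ W := by cases b; exacts [h₁, h₂]
  let s : ∀ b, X.presheaf.obj (op (U b)) := fun b => by cases b; exacts [r₁, r₂]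
  obtain ⟨x, hx, -⟩ := X.sheaf.existsUnique_gluing' U W (fun b => homOfLE (hU b))
    (hW.trans (sup_le (le_iSup U false) (le_iSup U true))) s (by
      rintro (_ | _) (_ | _)
      · rfl
      · exact h'
      · have hle : W₂ ⊓ W₁ ≤ W₁ ⊓ W₂ := le_inf inf_le_right inf_le_left
        exact (X.presheaf.map_map_homOfLE hle inf_le_right r₂).symm.trans
          ((congrArg (X.presheaf.resHom hle) h'.symm).trans
            (X.presheaf.map_map_homOfLE hle inf_le_left r₁))
      · rfl)
  exact ⟨x, hx false, hx true⟩

theorem AlgebraicGeometry.LocallyRingedSpace.eq_zero_of_res (X : LocallyRingedSpace.{u})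
    {W W₁ W₂ : Opens X.toTopCat} (h₁ : W₁ ≤ W) (h₂ : W₂ ≤ W) (hW : W ≤ W₁ ⊔ W₂)
    (x : X.presheaf.obj (op W)) (e₁ : X.presheaf.resHom h₁ x = 0)
    (e₂ : X.presheaf.resHom h₂ x = 0) : x = 0 :=
  X.sheaf.eq_of_locally_eq₂ (homOfLE h₁) (homOfLE h₂) hW x 0
    (e₁.trans (map_zero (X.presheaf.resHom h₁)).symm)
    (e₂.trans (map_zero (X.presheaf.resHom h₂)).symm)

/-- As the stalks are local, the sections `f` and `1 - f` have no common zeros. -/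
theorem AlgebraicGeometry.LocallyRingedSpace.le_basicOpen_sup (X : LocallyRingedSpace.{u})
    {W : Opens X.toTopCat} (f : X.presheaf.obj (op W)) :
    W ≤ X.toRingedSpace.basicOpen f ⊔ X.toRingedSpace.basicOpen (1 - f) := by
  intro x hx
  rcases IsLocalRing.isUnit_or_isUnit_of_add_one (R := X.presheaf.stalk x)
    (a := X.presheaf.germ W x hx f) (b := X.presheaf.germ W x hx (1 - f))
    (by rw [← map_add, add_sub_cancel, map_one]) with h | h
  · exact Or.inl ((RingedSpace.mem_basicOpen X.toRingedSpace f x hx).2 h)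
  · exact Or.inr ((RingedSpace.mem_basicOpen X.toRingedSpace (1 - f) x hx).2 h)

namespace TopLRS

variable {X : TopLRS.{u}}

/-- The sheaf condition on the topologies, for a covering by two open sets. -/
theorem top_eq_inf (X : TopLRS.{u}) {W W₁ W₂ : Opens X.toTopCat} (h₁ : W₁ ≤ W) (h₂ : W₂ ≤ W)
    (hW : W ≤ W₁ ⊔ W₂) : X.top W = (X.top W₁).induced (X.presheaf.resHom h₁) ⊓
      (X.top W₂).induced (X.presheaf.resHom h₂) := by
  let U : ULift.{u} Bool → Opens X.toTopCat := fun b => Bool.rec W₁ W₂ b.down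
  have hU (b) : U b ≤ W := by rcases b with ⟨_ | _⟩; exacts [h₁, h₂]
  rw [X.top_eq_iInf W U hU (hW.trans (sup_le (le_iSup U ⟨false⟩) (le_iSup U ⟨true⟩)))]
  refine le_antisymm (le_inf (iInf_le _ (⟨false⟩ : ULift.{u} Bool))
    (iInf_le _ (⟨true⟩ : ULift.{u} Bool))) (le_iInf fun b => ?_)
  rcases b with ⟨_ | _⟩
  exacts [inf_le_left, inf_le_right]

/-- If `D(f)` and `D(1 - f)` are adic open sets whose ideals agree on the intersection, the sections
over `W` are glued from those over the two pieces. -/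
theorem IsAdicOpen.isAdicGluing {W W₁ W₂ W₁₂ : Opens X.toTopCat} {f : X.sec W} {h₁ : W₁ ≤ W}
    {h₂ : W₂ ≤ W} {d₁ : W₁₂ ≤ W₁} {d₂ : W₁₂ ≤ W₂} (hW₁ : W₁ = X.toRingedSpace.basicOpen f)
    (hW₂ : W₂ = X.toRingedSpace.basicOpen (1 - f)) (hW₁₂ : W₁₂ = W₁ ⊓ W₂) {I₁ : Ideal (X.sec W₁)}
    {I₂ : Ideal (X.sec W₂)} (H₁ : X.IsAdicOpen W₁ I₁) (H₂ : X.IsAdicOpen W₂ I₂)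
    (hI : I₁.map (X.presheaf.resHom d₁) = I₂.map (X.presheaf.resHom d₂)) :
    IsAdicGluing (X.presheaf.resHom h₁) (X.presheaf.resHom h₂) (X.presheaf.resHom d₁)
      (X.presheaf.resHom d₂) I₁ I₂ f := by
  have hW : W ≤ W₁ ⊔ W₂ := by
    rw [hW₁, hW₂]
    exact le_basicOpen_sup X.toLocallyRingedSpace f
  refine ⟨fun x => ?_, eq_zero_of_res X.toLocallyRingedSpace h₁ h₂ hW,
    exists_res_eq X.toLocallyRingedSpace h₁ h₂ d₁ d₂ hW hW₁₂.ge, hI, H₁.isAdicComplete,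
    H₂.isAdicComplete, isUnit_res _ h₁ f hW₁.le, isUnit_res _ h₂ _ hW₂.le, ?_, ?_⟩
  · exact (X.presheaf.map_map_homOfLE d₁ h₁ x).trans (X.presheaf.map_map_homOfLE d₂ h₂ x).symm
  · refine H₁.loc _ _ _ ?_
    rw [basicOpen_res, ← hW₂, hW₁₂]
  · refine H₂.loc _ _ _ ?_
    rw [basicOpen_res, ← hW₁, hW₁₂, inf_comm]

variable {T : Scheme.{u}} {i : schemeTop T ⟶ X}

namespace IsAffineAdicOpen

/-- If `V = D(f) ∪ D(1 - f)` and both pieces are affine adic open sets with ideals that agree on the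
intersection, then `V` is an affine adic open set. -/
theorem exists_of_basicOpen (hi : Function.Surjective (TopLRS.Hom.base i))
    {V W₁ W₂ W₁₂ : Opens X.toTopCat} {f : X.sec V} (h₁ : W₁ ≤ V) (h₂ : W₂ ≤ V) (d₁ : W₁₂ ≤ W₁)
    (d₂ : W₁₂ ≤ W₂) (hW₁ : W₁ = X.toRingedSpace.basicOpen f)
    (hW₂ : W₂ = X.toRingedSpace.basicOpen (1 - f)) (hW₁₂ : W₁₂ = W₁ ⊓ W₂) {I₁ : Ideal (X.sec W₁)}
    {I₂ : Ideal (X.sec W₂)} (H₁ : IsAffineAdicOpen i W₁ I₁) (H₂ : IsAffineAdicOpen i W₂ I₂)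
    (hI : I₁.map (X.presheaf.resHom d₁) = I₂.map (X.presheaf.resHom d₂))
    (hV : IsAffineOpen (X := T) ((Opens.map (TopLRS.Hom.base i)).obj V))
    (hsurj : Function.Surjective ((TopLRS.Hom.hom i).c.app (op V)).hom) :
    ∃ I, IsAffineAdicOpen i V I := by
  have G := H₁.isAdicGluing (h₁ := h₁) (h₂ := h₂) hW₁ hW₂ hW₁₂ H₂.toIsAdicOpen hI
  obtain ⟨I, hfg, e₁, e₂⟩ := G.exists_ideal H₁.fg H₂.fg
  have hsup : V ≤ W₁ ⊔ W₂ := by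
    rw [hW₁, hW₂]
    exact le_basicOpen_sup X.toLocallyRingedSpace f
  have H₁₂ := H₁.basicOpen hi (X.presheaf.resHom h₁ (1 - f)) d₁ (by
    rw [basicOpen_res, ← hW₂, hW₁₂])
  -- over a basic open set `W = D(s)` the same data glue
  have key (s : X.sec V) (W : Opens X.toTopCat) (h : W ≤ V)
      (hW : W = X.toRingedSpace.basicOpen s) :
      IsAdicLocalization I s (X.presheaf.resHom h) ∧
        X.top W = (I.map (X.presheaf.resHom h)).adicTopology := by
    have l₁ : W ⊓ W₁ ≤ W₁ := inf_le_right
    have l₂ : W ⊓ W₂ ≤ W₂ := inf_le_right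
    have l₁₂ : W ⊓ W₁₂ ≤ W₁₂ := inf_le_right
    have m₁ : W ⊓ W₁ ≤ W := inf_le_left
    have m₂ : W ⊓ W₂ ≤ W := inf_le_left
    have n₁ : W ⊓ W₁₂ ≤ W ⊓ W₁ := inf_le_inf le_rfl d₁
    have n₂ : W ⊓ W₁₂ ≤ W ⊓ W₂ := inf_le_inf le_rfl d₂
    have K₁ := H₁.basicOpen hi (X.presheaf.resHom h₁ s) l₁ (by
      rw [basicOpen_res, ← hW, inf_comm])
    have K₂ := H₂.basicOpen hi (X.presheaf.resHom h₂ s) l₂ (by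
      rw [basicOpen_res, ← hW, inf_comm])
    have hcomm {A B C D : Opens X.toTopCat} (a : A ≤ B) (b : B ≤ D) (c : A ≤ C) (d : C ≤ D) :
        (X.presheaf.resHom a).comp (X.presheaf.resHom b) =
          (X.presheaf.resHom c).comp (X.presheaf.resHom d) := by
      rw [TopCat.Presheaf.resHom_comp, TopCat.Presheaf.resHom_comp]
    have hI' : (I₁.map (X.presheaf.resHom l₁)).map (X.presheaf.resHom n₁) =
        (I₂.map (X.presheaf.resHom l₂)).map (X.presheaf.resHom n₂) := by
      rw [Ideal.map_map, Ideal.map_map, hcomm n₁ l₁ l₁₂ d₁, hcomm n₂ l₂ l₁₂ d₂, ← Ideal.map_map,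
        hI, Ideal.map_map]
    have G' := K₁.isAdicGluing (f := X.presheaf.resHom h f) (h₁ := m₁) (h₂ := m₂) (d₁ := n₁)
      (d₂ := n₂) (by rw [basicOpen_res, ← hW₁])
      (by rw [← map_one (X.presheaf.resHom h), ← map_sub, basicOpen_res, ← hW₂])
      (by rw [hW₁₂, inf_inf_distrib_left]) K₂.toIsAdicOpen hI'
    have he {A B C D : Opens X.toTopCat} (a : A ≤ B) (b : B ≤ D) (c : A ≤ C) (d : C ≤ D) (x) :
        X.presheaf.resHom a (X.presheaf.resHom b x) = X.presheaf.resHom c (X.presheaf.resHom d x) :=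
      congr($(hcomm a b c d) x)
    refine ⟨G.isAdicLocalization hfg e₁ e₂ G' (he _ _ _ _) (he _ _ _ _) (he n₁ l₁ l₁₂ d₁)
      (he n₂ l₂ l₁₂ d₂) (H₁.loc _ _ _ ?_) (H₂.loc _ _ _ ?_) (H₁₂.loc _ _ _ ?_)
      (isUnit_res _ h s hW.le), ?_⟩
    · rw [basicOpen_res, ← hW, inf_comm]
    · rw [basicOpen_res, ← hW, inf_comm]
    · rw [basicOpen_res, basicOpen_res, ← hW, ← inf_assoc, inf_eq_left.2 d₁, inf_comm]
    · rw [X.top_eq_inf m₁ m₂ ((le_inf le_rfl (h.trans hsup)).trans_eq (inf_sup_left _ _ _)),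
        K₁.top_eq_self, K₂.top_eq_self]
      refine G'.induced_inf_induced_eq (hfg.map _) ?_ ?_
      · rw [← e₁, Ideal.map_map, Ideal.map_map, hcomm m₁ h l₁ h₁]
      · rw [← e₂, Ideal.map_map, Ideal.map_map, hcomm m₂ h l₂ h₂]
  refine ⟨I, ⟨hfg, fun s W h hW => (key s W h hW).1, fun s W h hW => (key s W h hW).2⟩, hV, hsurj,
    ?_⟩
  have hk (x : X.sec V) : (TopLRS.Hom.hom i).c.app (op V) x = 0 ↔
      X.presheaf.resHom h₁ x ∈ I₁.radical ∧ X.presheaf.resHom h₂ x ∈ I₂.radical := by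
    rw [← H₁.ker_eq, ← H₂.ker_eq]
    constructor
    · intro hx
      exact ⟨(app_res h₁ x).trans ((congrArg _ hx).trans (map_zero _)),
        (app_res h₂ x).trans ((congrArg _ hx).trans (map_zero _))⟩
    · rintro ⟨hx₁, hx₂⟩
      exact eq_zero_of_res T.toLocallyRingedSpace
        (W₁ := (Opens.map (TopLRS.Hom.base i)).obj W₁) (W₂ := (Opens.map (TopLRS.Hom.base i)).obj W₂)
        (fun _ hx => h₁ hx) (fun _ hx => h₂ hx) (fun _ hx => hsup hx) _
        ((app_res h₁ x).symm.trans hx₁) ((app_res h₂ x).symm.trans hx₂)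
  ext x
  refine (hk x).trans ⟨fun ⟨⟨m, hm⟩, n, hn⟩ => ⟨m + n, ?_⟩, fun ⟨n, hn⟩ => ⟨⟨n, ?_⟩, n, ?_⟩⟩
  · rw [← pow_one I, ← G.fil_eq_pow hfg e₁ e₂, G.mem_fil, pow_one, pow_one, map_pow, map_pow,
      pow_add, pow_add]
    exact ⟨Ideal.mul_mem_right _ _ hm, Ideal.mul_mem_left _ _ hn⟩
  · rw [← map_pow, ← e₁]
    exact Ideal.mem_map_of_mem _ hn
  · rw [← map_pow, ← e₂]
    exact Ideal.mem_map_of_mem _ hn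

end IsAffineAdicOpen

end TopLRS

/-! ### Open sets with affine reduction -/

/-- On `D(k)`, multiplication by a unit does not change basic open sets. -/
theorem AlgebraicGeometry.basicOpen_unit_mul_res {T : Scheme.{u}} {O O' : T.Opens} (h : O' ≤ O)
    (u : Γ(T, O')ˣ) (k : Γ(T, O)) (hk : O' = T.basicOpen k) (x : Γ(T, O)) :
    T.basicOpen (u.1 * (T.toLocallyRingedSpace.presheaf.resHom h x : Γ(T, O'))) =
      T.basicOpen (k * x) := by
  rw [T.basicOpen_mul, T.basicOpen_mul, T.basicOpen_of_isUnit u.isUnit, ← hk]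
  refine (congrArg _ (basicOpen_res T.toLocallyRingedSpace h x)).trans ?_
  exact (inf_assoc _ _ _).symm.trans (congrArg (· ⊓ T.basicOpen x) (inf_idem O'))

namespace TopLRS

variable {X : TopLRS.{u}} {T : Scheme.{u}} {i : schemeTop T ⟶ X}

namespace IsAffineAdicOpen

/-- If the reduction of `V` is affine and covered by `D(f)` and `D(1 - f)`, and the corresponding
open subsets of `V` are affine adic open sets, then so is `V`. -/
theorem exists_of_preimage (hi : Function.Surjective (TopLRS.Hom.base i))
    {V W₁ W₂ : Opens X.toTopCat}
    (hV : IsAffineOpen (X := T) ((Opens.map (TopLRS.Hom.base i)).obj V))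
    (f : Γ(T, (Opens.map (TopLRS.Hom.base i)).obj V))
    (hW₁ : (Opens.map (TopLRS.Hom.base i)).obj W₁ = T.basicOpen f)
    (hW₂ : (Opens.map (TopLRS.Hom.base i)).obj W₂ = T.basicOpen (1 - f))
    {I₁ : Ideal (X.sec W₁)} {I₂ : Ideal (X.sec W₂)} (H₁ : IsAffineAdicOpen i W₁ I₁)
    (H₂ : IsAffineAdicOpen i W₂ I₂) : ∃ I, IsAffineAdicOpen i V I := by
  have le_of {W : Opens X.toTopCat} {g : Γ(T, (Opens.map (TopLRS.Hom.base i)).obj V)}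
      (hW : (Opens.map (TopLRS.Hom.base i)).obj W = T.basicOpen g) : W ≤ V := by
    intro x hx
    obtain ⟨t, rfl⟩ := hi x
    exact T.basicOpen_le g (hW.le hx)
  have h₁ := le_of hW₁
  have h₂ := le_of hW₂
  have d₁ : W₁ ⊓ W₂ ≤ W₁ := inf_le_left
  have d₂ : W₁ ⊓ W₂ ≤ W₂ := inf_le_right
  let r {A B : Opens X.toTopCat} (h : A ≤ B) := T.toLocallyRingedSpace.presheaf.resHom
    (show (Opens.map (TopLRS.Hom.base i)).obj A ≤ (Opens.map (TopLRS.Hom.base i)).obj B from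
      fun _ hx => h hx)
  let v (A : Opens X.toTopCat) := ((TopLRS.Hom.hom i).c.app (op A)).hom
  have hv {A B : Opens X.toTopCat} (h : A ≤ B) (x : X.sec B) :
      v A (X.presheaf.resHom h x) = r h (v B x) := app_res h x
  have hr {A B C : Opens X.toTopCat} (h : A ≤ B) (h' : B ≤ C) (x) :
      r h (r h' x) = r (h.trans h') x := T.toLocallyRingedSpace.presheaf.map_map_homOfLE _ _ x
  have hbr {A B : Opens X.toTopCat} (h : A ≤ B)
      (x : Γ(T, (Opens.map (TopLRS.Hom.base i)).obj B)) :
      T.basicOpen (r h x) = (Opens.map (TopLRS.Hom.base i)).obj A ⊓ T.basicOpen x :=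
    basicOpen_res T.toLocallyRingedSpace _ x
  have hbv {A : Opens X.toTopCat} (x : X.sec A) :
      (Opens.map (TopLRS.Hom.base i)).obj (X.toRingedSpace.basicOpen x) = T.basicOpen (v A x) :=
    preimage_basicOpen_app x
  -- `f` lifts over `W₁` and over `W₂`; the lifts agree on the intersection up to an element
  -- of the radical of the ideal of definition
  obtain ⟨t₁, ht₁⟩ := H₁.surjective (r h₁ f)
  obtain ⟨s₂, hs₂⟩ := H₂.surjective (r h₂ f)
  have hs₁ : v W₁ (1 - t₁) = r h₁ (1 - f) := (map_sub (v W₁) 1 t₁).trans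
    ((congrArg₂ (· - ·) ((map_one (v W₁)).trans (map_one (r h₁)).symm) ht₁).trans
      (map_sub (r h₁) 1 f).symm)
  have hD₁ : W₁ ⊓ W₂ = X.toRingedSpace.basicOpen (1 - t₁) := opens_eq_of_preimage_eq hi <| by
    rw [hbv]
    refine Eq.trans ?_ (congrArg T.basicOpen hs₁).symm
    rw [hbr h₁, ← hW₂]
    rfl
  have hD₂ : W₁ ⊓ W₂ = X.toRingedSpace.basicOpen s₂ := opens_eq_of_preimage_eq hi <| by
    rw [hbv]
    refine Eq.trans ?_ (congrArg T.basicOpen hs₂).symm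
    rw [hbr h₂, ← hW₁, inf_comm]
    rfl
  -- the ideals of definition on the intersection define the same topology
  have K₁ := H₁.basicOpen hi (1 - t₁) d₁ hD₁
  have K₂ := H₂.basicOpen hi s₂ d₂ hD₂
  obtain ⟨a, ha⟩ := exists_pow_le_of_adicTopology_eq (K₁.top_eq_self.symm.trans K₂.top_eq_self)
  obtain ⟨b, hb⟩ := exists_pow_le_of_adicTopology_eq (K₂.top_eq_self.symm.trans K₁.top_eq_self)
  have L₁ := H₁.loc (1 - t₁) _ d₁ hD₁
  have L₂ := H₂.loc s₂ _ d₂ hD₂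
  -- change the ideal over `W₂` so that both ideals agree on the intersection
  obtain ⟨J, hJ, hJI, ⟨k, hk⟩, l, hl⟩ := exists_ideal_map_eq L₂ H₁.fg H₂.fg ha hb
  have H₂' := H₂.of_pow_le hJ hk hl
  have hdiff {r₁ r₂ c} (e₁ : v W₁ r₁ = r h₁ c) (e₂ : v W₂ r₂ = r h₂ c) :
      X.presheaf.resHom d₁ r₁ - X.presheaf.resHom d₂ r₂ ∈
        (I₁.map (X.presheaf.resHom d₁)).radical := by
    rw [← K₁.ker_eq]
    refine (map_sub (v _) _ _).trans (sub_eq_zero.2 ?_)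
    exact (hv d₁ r₁).trans ((congrArg (r d₁) e₁).trans ((hr d₁ h₁ c).trans ((hr d₂ h₂ c).symm.trans
      ((congrArg (r d₂) e₂).symm.trans (hv d₂ r₂).symm))))
  have hsup : V ≤ W₁ ⊔ W₂ := by
    intro x hx
    obtain ⟨t, rfl⟩ := hi x
    rcases le_basicOpen_sup T.toLocallyRingedSpace f hx with h | h
    · exact Or.inl (hW₁.ge h)
    · exact Or.inr (hW₂.ge h)
  -- local lifts of a function differ by an element of the radical, which can be split
  have hsurj : Function.Surjective (v V) := by
    intro c
    obtain ⟨r₁, hr₁⟩ := H₁.surjective (r h₁ c)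
    obtain ⟨r₂, hr₂⟩ := H₂.surjective (r h₂ c)
    obtain ⟨k₁, hk₁, k₂, hk₂, hk⟩ := exists_split_radical hJI.symm H₁.isAdicComplete
      H₂'.isAdicComplete L₁
      (H₂'.loc s₂ _ d₂ hD₂) (hdiff ht₁ hs₂) (hdiff hr₁ hr₂)
    rw [← H₁.ker_eq] at hk₁
    rw [← H₂'.ker_eq] at hk₂
    obtain ⟨x, hx₁, hx₂⟩ := exists_res_eq X.toLocallyRingedSpace h₁ h₂ d₁ d₂ hsup le_rfl
      (r₁ - k₁) (r₂ + k₂) (by rw [map_sub, map_add]; linear_combination hk)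
    refine ⟨x, sub_eq_zero.1 (eq_zero_of_res T.toLocallyRingedSpace
      (W₁ := (Opens.map (TopLRS.Hom.base i)).obj W₁) (W₂ := (Opens.map (TopLRS.Hom.base i)).obj W₂)
      (fun _ hx => h₁ hx) (fun _ hx => h₂ hx) (fun _ hx => hsup hx) _ ?_ ?_)⟩
    · refine (map_sub (r h₁) (v V x) c).trans (sub_eq_zero.2 ?_)
      refine (hv h₁ x).symm.trans ((congrArg (v W₁) hx₁).trans ((map_sub (v W₁) _ _).trans ?_))
      exact (congrArg₂ (· - ·) hr₁ hk₁).trans (sub_zero _)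
    · refine (map_sub (r h₂) (v V x) c).trans (sub_eq_zero.2 ?_)
      refine (hv h₂ x).symm.trans ((congrArg (v W₂) hx₂).trans ((map_add (v W₂) _ _).trans ?_))
      exact (congrArg₂ (· + ·) hr₂ hk₂).trans (add_zero _)
  obtain ⟨f', hf'⟩ := hsurj f
  refine exists_of_basicOpen hi (f := f') h₁ h₂ d₁ d₂ (opens_eq_of_preimage_eq hi ?_)
    (opens_eq_of_preimage_eq hi ?_) rfl H₁ H₂' hJI.symm hV hsurj
  · rw [hW₁, hbv, hf']
  · rw [hW₂, hbv]
    exact congrArg T.basicOpen ((map_sub (v V) 1 f').trans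
      (congrArg₂ (· - ·) (map_one (v V)) hf')).symm

/-- The empty set is an affine adic open set, with the zero ring as its ring of sections. -/
theorem of_subsingleton {W : Opens X.toTopCat}
    (hW : IsAffineOpen (X := T) ((Opens.map (TopLRS.Hom.base i)).obj W))
    (hbot : W = ⊥) : IsAffineAdicOpen i W ⊥ := by
  subst hbot
  have h0 (Z : LocallyRingedSpace.{u}) (U : Opens Z.toTopCat) (hU : U ≤ ⊥) :
      Subsingleton (Z.presheaf.obj (op U)) := by
    obtain rfl := le_bot_iff.1 hU
    exact CommRingCat.subsingleton_of_isTerminal Z.sheaf.isTerminalOfEmpty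
  have hX (U : Opens X.toTopCat) (hU : U ≤ ⊥) : Subsingleton (X.sec U) := h0 _ U hU
  have hT : Subsingleton (T.toLocallyRingedSpace.presheaf.obj
      (op ((Opens.map (TopLRS.Hom.base i)).obj ⊥))) := h0 _ _ fun _ hx => hx
  have := hX ⊥ le_rfl
  refine ⟨⟨Submodule.fg_bot, fun f W h hf => ?_, fun f W h hf => ?_⟩, hW, fun y =>
    ⟨0, hT.elim _ _⟩, Subsingleton.elim _ _⟩
  · have := hX W h
    exact ⟨isUnit_of_subsingleton _, inferInstance, fun n x => ⟨0, 0, by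
      rw [Subsingleton.elim (_ - _) 0]; exact zero_mem _⟩, fun n a _ => ⟨0, by
      rw [Subsingleton.elim (_ * _) 0]; exact zero_mem _⟩⟩
  · have := hX W h
    exact Subsingleton.elim _ _

/-- An open set `V` whose reduction is affine is an affine adic open set, provided `X` is covered by
affine adic open sets: the sections `f` over the reduction of `V` for which `D(f)` has this property
form an ideal. -/
theorem exists_of_isAffineOpen (hi : IsHomeomorph (TopLRS.Hom.base i))
    (hcov : ∀ x : X.toTopCat, ∃ U I, x ∈ U ∧ IsAffineAdicOpen i U I) {V : Opens X.toTopCat}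
    (hV : IsAffineOpen (X := T) ((Opens.map (TopLRS.Hom.base i)).obj V)) :
    ∃ I, IsAffineAdicOpen i V I := by
  have hbv {A : Opens X.toTopCat} (x : X.sec A) :
      (Opens.map (TopLRS.Hom.base i)).obj (X.toRingedSpace.basicOpen x) =
        T.basicOpen ((TopLRS.Hom.hom i).c.app (op A) x) := preimage_basicOpen_app x
  have exists_pre (O : T.Opens) : ∃ W : Opens X.toTopCat,
      (Opens.map (TopLRS.Hom.base i)).obj W = O :=
    ⟨⟨_, hi.isOpenMap _ O.2⟩, Opens.ext (Set.preimage_image_eq _ hi.injective)⟩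
  let P (f : Γ(T, (Opens.map (TopLRS.Hom.base i)).obj V)) : Prop := ∃ W I,
    (Opens.map (TopLRS.Hom.base i)).obj W = T.basicOpen f ∧ IsAffineAdicOpen i W I
  have hmul (g f) (hf : P f) : P (g * f) := by
    obtain ⟨W, I, hW, H⟩ := hf
    have hle : (Opens.map (TopLRS.Hom.base i)).obj W ≤ (Opens.map (TopLRS.Hom.base i)).obj V :=
      hW.trans_le (T.basicOpen_le f)
    obtain ⟨s, hs⟩ := H.surjective (T.toLocallyRingedSpace.presheaf.resHom hle g)
    refine ⟨_, _, ?_, H.basicOpen hi.surjective s (RingedSpace.basicOpen_le _ s) rfl⟩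
    rw [hbv]
    refine (congrArg T.basicOpen hs).trans ?_
    refine (basicOpen_res T.toLocallyRingedSpace hle g).trans ?_
    exact (congrArg₂ (· ⊓ ·) hW rfl).trans ((inf_comm _ _).trans (T.basicOpen_mul g f).symm)
  -- on `D(f + g)` the functions `f / (f + g)` and `g / (f + g)` add up to `1`
  have hadd (f g) (hf : P f) (hg : P g) : P (f + g) := by
    obtain ⟨W, hW⟩ := exists_pre (T.basicOpen (f + g))
    have hle : (Opens.map (TopLRS.Hom.base i)).obj W ≤ (Opens.map (TopLRS.Hom.base i)).obj V :=
      hW.trans_le (T.basicOpen_le _)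
    obtain ⟨u, hu⟩ := isUnit_res T.toLocallyRingedSpace hle (f + g) hW.le
    let r := T.toLocallyRingedSpace.presheaf.resHom hle
    have hsum : 1 - (u⁻¹).1 * r f = (u⁻¹).1 * r g := by
      have : (u⁻¹).1 * (r f + r g) = 1 := by
        rw [← map_add]
        exact (congrArg _ hu.symm).trans u.inv_mul
      linear_combination -this
    have hD := fun u => basicOpen_unit_mul_res hle u (k := f + g) (hk := hW)
    obtain ⟨W₁, I₁, hW₁, H₁⟩ := hmul (f + g) f hf
    obtain ⟨W₂, I₂, hW₂, H₂⟩ := hmul (f + g) g hg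
    obtain ⟨I, H⟩ := exists_of_preimage hi.surjective (V := W) (W₁ := W₁) (W₂ := W₂)
      (hW ▸ hV.basicOpen _) ((u⁻¹).1 * r f) (hW₁.trans (hD u⁻¹ f).symm)
      (hW₂.trans ((hD u⁻¹ g).symm.trans (congrArg T.basicOpen hsum.symm))) H₁ H₂
    exact ⟨W, I, hW, H⟩
  have hzero : P 0 := by
    have h : (Opens.map (TopLRS.Hom.base i)).obj ⊥ = T.basicOpen
      (0 : Γ(T, (Opens.map (TopLRS.Hom.base i)).obj V)) := (T.basicOpen_zero _).symm
    exact ⟨⊥, ⊥, h, of_subsingleton (h ▸ hV.basicOpen _) rfl⟩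
  let G : Ideal Γ(T, (Opens.map (TopLRS.Hom.base i)).obj V) :=
    { carrier := {f | P f}, add_mem' := hadd _ _, zero_mem' := hzero, smul_mem' := hmul }
  -- the open sets `D(f)` with `f ∈ G` cover the reduction of `V`, since it has a basis of open sets
  -- that are basic both in it and in the reduction of a member of the given covering
  have hG : G = ⊤ := by
    rw [← Ideal.span_eq G, ← hV.iSup_basicOpen_eq_self_iff]
    refine le_antisymm (iSup_le fun f => T.basicOpen_le f.1) fun t ht => ?_
    obtain ⟨U, I, hU, H⟩ := hcov (TopLRS.Hom.base i t)
    obtain ⟨f, g, hfg, hf⟩ := exists_basicOpen_le_affine_inter hV H.isAffineOpen t ⟨ht, hU⟩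
    obtain ⟨s, hs⟩ := H.surjective g
    refine Opens.mem_iSup.2 ⟨⟨f, _, _, ?_, H.basicOpen hi.surjective s
      (RingedSpace.basicOpen_le _ s) rfl⟩, hf⟩
    rw [hbv]
    exact (congrArg T.basicOpen hs).trans hfg.symm
  obtain ⟨W, I, hW, H⟩ : P 1 := (Ideal.eq_top_iff_one G).1 hG
  obtain rfl : W = V := opens_eq_of_preimage_eq hi.surjective
    (hW.trans (T.basicOpen_of_isUnit isUnit_one))
  exact ⟨I, H⟩

end IsAffineAdicOpen

end TopLRS

/-! ### Affine adic open sets of the glued space -/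

theorem TopCat.Presheaf.bijective_resHom {X : TopCat.{u}} (P : X.Presheaf CommRingCat.{u})
    {U V : Opens X} (h : V ≤ U) (e : V = U) : Function.Bijective (P.resHom h) := by
  subst e
  rw [TopCat.Presheaf.resHom_refl]
  exact Function.bijective_id

namespace Glue

section

variable {X Y Z : TopLRS.{u}} (i : Z ⟶ X) (j : Z ⟶ Y) (hi : IsHomeomorph (TopLRS.Hom.base i))

/-- The open set of `X` over `U` corresponds to `j⁻¹ U` in the reduced special fibre. -/
theorem map_base_pre (U : Opens Y.toTopCat) : (Opens.map (TopLRS.Hom.base j)).obj U =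
    (Opens.map (TopLRS.Hom.base i)).obj (pre i j hi U) :=
  Opens.ext (Set.ext fun z => by
    change TopLRS.Hom.base j z ∈ U ↔ q i j hi (TopLRS.Hom.base i z) ∈ U
    rw [q_apply])

theorem toZ_surjective {U : Opens Y.toTopCat}
    (h : Function.Surjective ((TopLRS.Hom.hom i).c.app (op (pre i j hi U))).hom) :
    Function.Surjective (toZ i j hi U) :=
  (Z.presheaf.bijective_resHom (pre_le i j hi U) (map_base_pre i j hi U)).surjective.comp h

theorem ker_toZ (U : Opens Y.toTopCat) : RingHom.ker (toZ i j hi U) =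
    RingHom.ker ((TopLRS.Hom.hom i).c.app (op (pre i j hi U))).hom := by
  ext x
  exact map_eq_zero_iff (Z.presheaf.resHom (pre_le i j hi U))
    (Z.presheaf.bijective_resHom (pre_le i j hi U) (map_base_pre i j hi U)).injective

/-- The first projection on sections. -/
noncomputable def fst (U : Opens Y.toTopCat) : (space i j hi).sec U →+* X.sec (pre i j hi U) :=
  (RingHom.fst _ _).comp (sections i j hi U).subtype

/-- The second projection on sections. -/
noncomputable def snd (U : Opens Y.toTopCat) : (space i j hi).sec U →+* Y.sec U :=
  (RingHom.snd _ _).comp (sections i j hi U).subtype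

/-- The sections of the glued space form the fibre product of rings. -/
theorem isFibreProduct (U : Opens Y.toTopCat) :
    IsFibreProduct (fst i j hi U) (snd i j hi U) (toZ i j hi U) (ofY j U) where
  comm x := x.2
  inj _ h h' := Subtype.ext (Prod.ext h h')
  exact r s h := ⟨⟨(r, s), h⟩, rfl, rfl⟩

/-- Basic open sets of the glued space restrict to basic open sets of `X`. -/
theorem pre_basicOpen {U : Opens Y.toTopCat} (f : (space i j hi).sec U) :
    pre i j hi ((space i j hi).toRingedSpace.basicOpen f) =
      X.toRingedSpace.basicOpen (fst i j hi U f) :=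
  LocallyRingedSpace.preimage_basicOpen (TopLRS.Hom.hom (inl i j hi)) f

/-- Basic open sets of the glued space are basic open sets of `Y`. -/
theorem basicOpen_eq_snd {U : Opens Y.toTopCat} (f : (space i j hi).sec U) :
    (space i j hi).toRingedSpace.basicOpen f = Y.toRingedSpace.basicOpen (snd i j hi U f) :=
  LocallyRingedSpace.preimage_basicOpen (TopLRS.Hom.hom (inr i j hi)) f

end

variable {X : TopLRS.{u}} {S Y : Scheme.{u}} {i : schemeTop S ⟶ X} {j : S ⟶ Y}
  (hi : IsHomeomorph (TopLRS.Hom.base i))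

/-- Over an affine open subset `U` of `Y`, the glued space is the formal spectrum of the fibre
product, with ideal of definition generated by the element `w = (ϖ, 0)`. The hypothesis that `B → C`
is injective enters through the description of the kernel of `A → B`. -/
theorem isAffineAdicOpen {U : Y.Opens} (hU : IsAffineOpen U)
    (hinj : Function.Injective (ofY (schemeTopMap j) U))
    {ϖ : X.sec (pre i (schemeTopMap j) hi U)}
    (H : TopLRS.IsAffineAdicOpen i (pre i (schemeTopMap j) hi U) (Ideal.span {ϖ}))
    {w : (space i (schemeTopMap j) hi).sec U} (hw₁ : fst i (schemeTopMap j) hi U w = ϖ)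
    (hw₂ : snd i (schemeTopMap j) hi U w = 0) :
    TopLRS.IsAffineAdicOpen (inr i (schemeTopMap j) hi) U (Ideal.span {w}) := by
  subst hw₁
  have G := isFibreProduct i (schemeTopMap j) hi
  have hS : IsAffineOpen (X := S) ((Opens.map (TopLRS.Hom.base (schemeTopMap j))).obj U) := by
    rw [map_base_pre i (schemeTopMap j) hi U]
    exact H.isAffineOpen
  have hsurj := toZ_surjective i (schemeTopMap j) hi H.surjective
  refine ⟨⟨⟨{w}, by simp⟩, fun f W h hW => ?_, fun f W h hW => ?_⟩, hU, fun s => ?_, ?_⟩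
  · have hWX := (congrArg (pre i (schemeTopMap j) hi) hW).trans (pre_basicOpen i (schemeTopMap j) hi f)
    have hWY := hW.trans (basicOpen_eq_snd i (schemeTopMap j) hi f)
    have hWS := (congrArg (Opens.map (TopLRS.Hom.base (schemeTopMap j))).obj hWY).trans
      (LocallyRingedSpace.preimage_basicOpen (TopLRS.Hom.hom (schemeTopMap j))
        (snd i (schemeTopMap j) hi U f))
    have LR := H.loc (fst i (schemeTopMap j) hi U f) _ (fun x hx => h hx) hWX
    have LB := hU.isAdicLocalization_res (snd i (schemeTopMap j) hi U f) h hWY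
    have LC := hS.isAdicLocalization_res (ofY (schemeTopMap j) U (snd i (schemeTopMap j) hi U f))
      (fun x hx => h hx) hWS
    exact (G U).isAdicLocalization (G W) (fun _ => rfl) (fun _ => rfl)
      (toZ_res i (schemeTopMap j) hi h) (ofY_res (schemeTopMap j) h) hw₂ LR LB LC
      (isUnit_res _ h f hW.le)
  · have hWX := (congrArg (pre i (schemeTopMap j) hi) hW).trans (pre_basicOpen i (schemeTopMap j) hi f)
    have hWY := hW.trans (basicOpen_eq_snd i (schemeTopMap j) hi f)
    have hWa : IsAffineOpen (X := Y) W := by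
      rw [hWY]
      exact hU.basicOpen _
    have e1 := H.top_eq (fst i (schemeTopMap j) hi U f) _ (fun x hx => h hx) hWX
    have e2 : (schemeTop Y).top W = ⊥ := pseudoDiscrete_eq_bot _ hWa.isCompact
    have e3 := (G W).induced_inf_induced_eq (w := (space i (schemeTopMap j) hi).presheaf.resHom h w)
      ((congrArg (Y.toLocallyRingedSpace.presheaf.resHom h) hw₂).trans (map_zero _))
    rw [Ideal.map_span, Set.image_singleton] at e1 ⊢
    refine Eq.trans ?_ e3
    exact congrArg₂ (fun t t' => TopologicalSpace.induced (fst i (schemeTopMap j) hi W) t ⊓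
      TopologicalSpace.induced (snd i (schemeTopMap j) hi W) t') e1 e2
  · obtain ⟨r, hr⟩ := hsurj (ofY (schemeTopMap j) U s)
    obtain ⟨x, -, hx⟩ := (G U).exact r s hr
    exact ⟨x, hx⟩
  · exact (G U).ker_eq_radical hinj hw₂ ((ker_toZ i (schemeTopMap j) hi U).trans H.ker_eq)

/-- An element killed by `w = (ϖ, 0)` has first component zero; its second component then vanishes
in `C` and hence in `B`. -/
theorem mem_nonZeroDivisors {U : Y.Opens}
    (hinj : Function.Injective (ofY (schemeTopMap j) U))
    {w : (space i (schemeTopMap j) hi).sec U}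
    (hw₁ : fst i (schemeTopMap j) hi U w ∈ nonZeroDivisors _) : w ∈ nonZeroDivisors _ := by
  refine mem_nonZeroDivisors_iff_right.2 fun x hx => ?_
  have G := isFibreProduct i (schemeTopMap j) hi U
  have h1 : fst i (schemeTopMap j) hi U x = 0 := by
    refine (mem_nonZeroDivisors_iff_right.1 hw₁) _ ?_
    rw [← map_mul, hx, map_zero]
  refine G.inj x h1 (hinj ?_)
  rw [map_zero, ← G.comm, h1, map_zero]

end Glue

/-! ### Charts and principal ideals of definition -/

/-- In an `I`-adically complete ring an ideal is the unit ideal if it is so modulo `√I`, which lies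
in the Jacobson radical. -/
theorem Ideal.eq_top_of_map_radical_eq_top {A : Type*} [CommRing A] {I G : Ideal A}
    (hI : IsAdicComplete I A) (h : G.map (Ideal.Quotient.mk I.radical) = ⊤) : G = ⊤ := by
  obtain ⟨g, hg, h1⟩ := (Ideal.mem_map_iff_of_surjective _ Ideal.Quotient.mk_surjective).1
    ((Ideal.eq_top_iff_one _).1 h)
  obtain ⟨n, hn⟩ := Ideal.Quotient.eq.1 (h1.trans (map_one _).symm)
  have hr : 1 - (1 - g) ^ n ∈ G := by
    have h2 : (1 : A) - (1 - g) ∣ 1 ^ n - (1 - g) ^ n := sub_dvd_pow_sub_pow _ _ n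
    rw [sub_sub_cancel, one_pow] at h2
    exact G.mem_of_dvd h2 hg
  refine G.eq_top_of_isUnit_mem hr (isUnit_of_sub_mem_of_isAdicComplete hI isUnit_one ?_)
  rw [sub_sub_cancel_left, neg_mem_iff, ← neg_sub, neg_pow]
  exact I.mul_mem_left _ hn

namespace AffineChart

variable {X : TopLRS.{u}} (c : AffineChart X)

/-- A chart is of principal ideal type if its image is an adic open set for some ideal generated by
a nonzerodivisor: both ideals define the topology on sections. -/
theorem isPrincipal_of_isAdicOpen {w : X.sec c.opens} (hw : w ∈ nonZeroDivisors _)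
    (H : X.IsAdicOpen c.opens (Ideal.span {w})) : c.IsPrincipal := by
  have e : (Ideal.span {w}).adicTopology = _ := H.top_eq_self.symm.trans c.isAdicOpen.top_eq_self
  obtain ⟨k, hk⟩ := exists_pow_le_of_adicTopology_eq e
  obtain ⟨l, hl⟩ := exists_pow_le_of_adicTopology_eq e.symm
  have hs : (Ideal.span {c.ringEquiv.symm w}).map (c.ringEquiv : c.A →+* X.sec c.opens) =
      Ideal.span {w} := by
    rw [Ideal.map_span, Set.image_singleton]
    exact congrArg (fun z => Ideal.span {z}) (c.ringEquiv.apply_symm_apply w)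
  have hle {J J' : Ideal c.A} (h : J.map (c.ringEquiv : c.A →+* X.sec c.opens) ≤
      J'.map (c.ringEquiv : c.A →+* X.sec c.opens)) : J ≤ J' := by
    have := Ideal.comap_mono (f := (c.ringEquiv : c.A →+* X.sec c.opens)) h
    rwa [Ideal.comap_map_of_bijective (c.ringEquiv : c.A →+* X.sec c.opens) c.ringEquiv.bijective,
      Ideal.comap_map_of_bijective (c.ringEquiv : c.A →+* X.sec c.opens) c.ringEquiv.bijective] at this
  rw [← hs, ← Ideal.map_pow] at hk hl
  refine ⟨c.ringEquiv.symm w, ?_, adicTopology_eq_of_pow_le (hle hk) (k := k) (l := l) (hle ?_)⟩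
  · refine mem_nonZeroDivisors_iff_right.2 fun x hx => ?_
    refine c.ringEquiv.injective (((mem_nonZeroDivisors_iff_right.1 hw) _ ?_).trans
      (map_zero _).symm)
    rw [← c.ringEquiv.apply_symm_apply w, ← map_mul, hx, map_zero]
  · rwa [Ideal.map_pow] at hl ⊢

variable {T : Scheme.{u}} (i : schemeTop T ⟶ X)

/-- The reduction of any chart is affine. The chart is not assumed to be compatible with the reduced
special fibre, so its reduction is only known as a topological space; but the open sets `D(a)`, `a ∈
A`, contained in affine open subsets `O` of `T` are basic open sets of `O`, and finitely many of
them given by elements generating the unit ideal cover the reduction. -/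
theorem isAffineOpen (hi : IsHomeomorph (TopLRS.Hom.base i)) :
    IsAffineOpen (X := T) ((Opens.map (TopLRS.Hom.base i)).obj c.opens) := by
  let ρ := TopLRS.Hom.base (spfRed c.A c.I ≫ c.hom)
  have hρ (a : c.A) (y : PrimeSpectrum (c.A ⧸ c.I.radical)) :
      ρ y ∈ X.toRingedSpace.basicOpen (c.ringEquiv a) ↔
        y ∈ PrimeSpectrum.basicOpen (Ideal.Quotient.mk c.I.radical a) := by
    refine Iff.trans ?_ (SetLike.ext_iff.1 (spfRed_preimage_basicOpen c.A c.I a) y)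
    have h1 := basicOpen_appLE (TopLRS.Hom.hom c.hom) (U := c.opens) (V := ⊤)
      c.top_eq_preimage_opens.le (c.ringEquiv a)
    rw [c.appLE_ringEquiv] at h1
    exact (SetLike.ext_iff.1 (h1.trans (top_inf_eq _)) (TopLRS.Hom.base (spfRed c.A c.I) y)).symm
  have hrange {x} (hx : x ∈ c.opens) : ∃ y, ρ y = x := by
    obtain ⟨z, rfl⟩ := hx
    obtain ⟨y, rfl⟩ := (isHomeomorph_spfRed c.A c.I).surjective z
    exact ⟨y, rfl⟩
  let v : c.A →+* Γ(T, (Opens.map (TopLRS.Hom.base i)).obj c.opens) :=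
    ((TopLRS.Hom.hom i).c.app (op c.opens)).hom.comp (c.ringEquiv : c.A →+* X.sec c.opens)
  have hv (a) : T.basicOpen (v a) =
      (Opens.map (TopLRS.Hom.base i)).obj (X.toRingedSpace.basicOpen (c.ringEquiv a)) :=
    (TopLRS.preimage_basicOpen_app _).symm
  let s : Set c.A := {a | IsAffineOpen (T.basicOpen (v a))}
  refine isAffineOpen_of_isAffineOpen_basicOpen _ (v '' s) ?_ (by rintro _ ⟨a, ha, rfl⟩; exact ha)
  -- the functions in `s` are shown to have no common zero on the special fibre
  suffices h : Ideal.span s = ⊤ by rw [← Ideal.map_span, h, Ideal.map_top]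
  refine Ideal.eq_top_of_map_radical_eq_top c.complete ?_
  rw [Ideal.map_span, ← PrimeSpectrum.iSup_basicOpen_eq_top_iff', eq_top_iff]
  intro y _
  let O₀ : T.Opens := (Opens.map (TopLRS.Hom.base i)).obj c.opens
  obtain ⟨t, ht⟩ := hi.surjective (ρ y)
  obtain ⟨_, ⟨O, hO, rfl⟩, htO, hOc⟩ := T.isBasis_affineOpens.exists_subset_of_mem_open
    (show t ∈ (O₀ : Set T) from
      show TopLRS.Hom.base i t ∈ c.opens from ht ▸ Set.mem_range_self _) O₀.2
  let O' : Opens X.toTopCat := ⟨_, hi.isOpenMap _ O.2⟩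
  have hyO : y ∈ (Opens.map ρ).obj O' := ⟨t, htO, ht⟩
  obtain ⟨_, ⟨_, ⟨b, rfl⟩, rfl⟩, hyb, hbO⟩ :=
    PrimeSpectrum.isBasis_basic_opens.exists_subset_of_mem_open hyO ((Opens.map ρ).obj O').2
  obtain ⟨a, rfl⟩ := Ideal.Quotient.mk_surjective b
  refine Opens.mem_iSup.2 ⟨Ideal.Quotient.mk _ a, Opens.mem_iSup.2 ⟨⟨a, ?_, rfl⟩, hyb⟩⟩
  have hle : T.basicOpen (v a) ≤ O := by
    intro t' ht'
    rw [hv] at ht'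
    obtain ⟨y', hy'⟩ := hrange (RingedSpace.basicOpen_le X.toRingedSpace _ ht')
    have : ρ y' ∈ O' := hbO ((hρ a y').1 (hy' ▸ ht'))
    rw [hy'] at this
    obtain ⟨t'', ht'', e⟩ := this
    rwa [← hi.injective e]
  have e := basicOpen_res T.toLocallyRingedSpace (show O ≤ _ from hOc) (v a)
  have e' : T.basicOpen (v a) =
      T.basicOpen (T.toLocallyRingedSpace.presheaf.resHom (show O ≤ _ from hOc) (v a) : Γ(T, O)) :=
    (e.trans (inf_eq_right.2 hle)).symm
  change IsAffineOpen _
  rw [e']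
  exact IsAffineOpen.basicOpen hO _

end AffineChart

namespace TopLRS

variable {X : TopLRS.{u}} {T : Scheme.{u}} {i : schemeTop T ⟶ X}

/-- If all charts of `X` are of principal ideal type, the ideal of an affine adic open set may be
taken to be generated by a nonzerodivisor. -/
theorem IsAffineAdicOpen.exists_principal (hi : IsHomeomorph (TopLRS.Hom.base i))
    (hX : ∀ c : AffineChart X, c.IsPrincipal) {U : Opens X.toTopCat} {I : Ideal (X.sec U)}
    (H : IsAffineAdicOpen i U I) :
    ∃ ϖ ∈ nonZeroDivisors (X.sec U), IsAffineAdicOpen i U (Ideal.span {ϖ}) := by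
  obtain ⟨c, -, ⟨e, rfl⟩, -⟩ := H.exists_chart hi
  obtain ⟨ϖ, hϖ, h⟩ := hX c
  obtain ⟨k, hk⟩ := exists_pow_le_of_adicTopology_eq h
  obtain ⟨l, hl⟩ := exists_pow_le_of_adicTopology_eq h.symm
  have hs : (Ideal.span {ϖ}).map (e : c.A →+* X.sec U) = Ideal.span {e ϖ} := by
    rw [Ideal.map_span, Set.image_singleton]
    rfl
  refine ⟨e ϖ, ?_, H.of_pow_le ⟨{e ϖ}, by simp⟩ (k := l) (l := k) ?_ ?_⟩
  · refine mem_nonZeroDivisors_iff_right.2 fun x hx => ?_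
    refine e.symm.injective (((mem_nonZeroDivisors_iff_right.1 hϖ) _ ?_).trans (map_zero _).symm)
    rw [← e.symm_apply_apply ϖ, ← map_mul, hx, map_zero]
  · rw [← hs, ← Ideal.map_pow]
    exact Ideal.map_mono hl
  · rw [← hs, ← Ideal.map_pow]
    exact Ideal.map_mono hk

end TopLRS

/-! ### The pushout property -/

/-- Restriction maps are continuous. -/
theorem TopLRS.continuous_resHom (X : TopLRS.{u}) {U V : Opens X.toTopCat} (h : V ≤ U) :
    @Continuous _ _ (X.top U) (X.top V) (X.presheaf.resHom h) :=
  continuous_iff_le_induced.2 ((X.top_eq_inf le_rfl h le_sup_left).trans_le inf_le_right)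

theorem TopLRS.hom_ext {X Y : TopLRS.{u}} {f g : X ⟶ Y}
    (hfg : TopLRS.Hom.base f = TopLRS.Hom.base g)
    (h : ∀ (U : Opens Y.toTopCat) (W : Opens X.toTopCat)
      (h : W ≤ (Opens.map (TopLRS.Hom.base f)).obj U)
      (h' : W ≤ (Opens.map (TopLRS.Hom.base g)).obj U) (s : Y.sec U),
      appLE (TopLRS.Hom.hom f) h s = appLE (TopLRS.Hom.hom g) h' s) : f = g :=
  TopLRS.Hom.ext (hom_ext_of_basis hfg (fun U : Opens Y.toTopCat => U)
    (fun _ V hz => ⟨V, hz, le_rfl⟩) fun U W hU hU' => RingHom.ext (h U W hU hU'))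

namespace Glue

variable {X Y Z : TopLRS.{u}} (i : Z ⟶ X) (j : Z ⟶ Y) (hi : IsHomeomorph (TopLRS.Hom.base i))

/-- The square with the two canonical morphisms to the glued space commutes. -/
theorem inl_comp_eq : i ≫ inl i j hi = j ≫ inr i j hi := by
  refine TopLRS.hom_ext (TopCat.hom_ext (ContinuousMap.ext fun z => q_apply i j hi z))
    fun U W h h' s => ?_
  refine (appLE_comp (TopLRS.Hom.hom i) (TopLRS.Hom.hom (inl i j hi)) (V := pre i j hi U) le_rfl
    h s).trans ?_
  refine Eq.trans ?_ (appLE_comp (TopLRS.Hom.hom j) (TopLRS.Hom.hom (inr i j hi)) (V := U) le_rfl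
    h' s).symm
  refine (congrArg (appLE (TopLRS.Hom.hom i) h)
    (appLE_le_rfl (TopLRS.Hom.hom (inl i j hi)) s)).trans (Eq.trans ?_
      (congrArg (appLE (TopLRS.Hom.hom j) h')
        (appLE_le_rfl (TopLRS.Hom.hom (inr i j hi)) s)).symm)
  exact (res_appLE (TopLRS.Hom.hom i) (pre_le i j hi U) h' (fst i j hi U s)).symm.trans
    (congrArg (Z.presheaf.resHom h') s.2)

variable {W : TopLRS.{u}} (a : X ⟶ W) (b : Y ⟶ W)

/-- In a cocone, the map on points from `X` factors through `|Y|`. -/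
theorem base_apply_eq (w : i ≫ a = j ≫ b) (x : X.toTopCat) :
    TopLRS.Hom.base b (q i j hi x) = TopLRS.Hom.base a x := by
  obtain ⟨z, rfl⟩ := hi.surjective x
  rw [q_apply]
  exact (congr(TopLRS.Hom.base $w z)).symm

theorem pre_le_preimage (w : i ≫ a = j ≫ b) (U : Opens W.toTopCat) :
    pre i j hi ((Opens.map (TopLRS.Hom.base b)).obj U) ≤ (Opens.map (TopLRS.Hom.base a)).obj U :=
  fun x hx => (congrArg (· ∈ U) (base_apply_eq i j hi a b w x)).mp hx

/-- The map on sections induced by the universal property of the fibre product. -/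
noncomputable def lift (w : i ≫ a = j ≫ b) (U : Opens W.toTopCat) :
    W.sec U →+* sections i j hi ((Opens.map (TopLRS.Hom.base b)).obj U) :=
  ((appLE (TopLRS.Hom.hom a) (pre_le_preimage i j hi a b w U)).prod
    ((TopLRS.Hom.hom b).c.app (op U)).hom).codRestrict _ fun s => by
      have h1 := appLE_comp (TopLRS.Hom.hom i) (TopLRS.Hom.hom a)
        (pre_le_preimage i j hi a b w U) (pre_le i j hi _) s
      refine h1.symm.trans ((appLE_congr (congrArg TopLRS.Hom.hom w) _ s).trans ?_)
      exact appLE_le_rfl (TopLRS.Hom.hom (j ≫ b)) s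

/-- The map of sheaves induced by the universal property of the fibre product. -/
noncomputable def liftNat (w : i ≫ a = j ≫ b) : W.presheaf ⟶
    (TopCat.Presheaf.pushforward _ (TopLRS.Hom.base b : Y.toTopCat ⟶ W.toTopCat)).obj
      (presheaf i j hi) where
  app U := CommRingCat.ofHom (lift i j hi a b w U.unop)
  naturality U V f := by
    refine CommRingCat.hom_ext (RingHom.ext fun s => Subtype.ext (Prod.ext ?_ ?_))
    · exact (appLE_res (TopLRS.Hom.hom a) _ (leOfHom f.unop) s).trans
        (res_appLE (TopLRS.Hom.hom a) (pre_le_preimage i j hi a b w U.unop)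
          (fun x hx => leOfHom f.unop hx) s).symm
    · exact congr($((TopLRS.Hom.hom b).c.naturality f) s)

/-- The induced map on stalks is local: composed with the stalk map of the second projection it
becomes the local homomorphism given by `b`, so an element that becomes a unit was one. -/
theorem isLocalHom_stalkMap_lift (w : i ≫ a = j ≫ b) (y : Y.toTopCat) :
    IsLocalHom (PresheafedSpace.Hom.stalkMap (X := (space i j hi).toPresheafedSpace)
      (Y := W.toPresheafedSpace) ⟨(TopLRS.Hom.base b : Y.toTopCat ⟶ W.toTopCat),
        liftNat i j hi a b w⟩ y).hom := by
  refine ⟨fun t ht => ?_⟩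
  obtain ⟨U, hy, s, rfl⟩ := TopCat.Presheaf.exists_germ_eq W.presheaf t
  have h := PresheafedSpace.stalkMap_germ_apply (TopLRS.Hom.hom b).toHom U y hy s
  have := (TopLRS.Hom.hom b).prop y
  refine (isUnit_map_iff ((TopLRS.Hom.hom b).toHom.stalkMap y).hom _).1 ?_
  refine (iff_of_eq (congrArg IsUnit h)).2 ?_
  have h1 := PresheafedSpace.stalkMap_germ_apply (X := (space i j hi).toPresheafedSpace)
    (Y := W.toPresheafedSpace) ⟨(TopLRS.Hom.base b : Y.toTopCat ⟶ W.toTopCat),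
      liftNat i j hi a b w⟩ U y hy s
  have h2 := ((iff_of_eq (congrArg IsUnit h1)).1 ht).map
    ((TopCat.Presheaf.stalkFunctor CommRingCat y).map (sndNat i j hi)).hom
  exact (iff_of_eq (congrArg IsUnit (TopCat.Presheaf.stalkFunctor_map_germ_apply _ y hy
    (sndNat i j hi) (lift i j hi a b w U s)))).1 h2

/-- The induced map on sections is continuous, as the sections of the fibre product carry the
subspace topology of the product. -/
theorem continuous_lift (w : i ≫ a = j ≫ b) (U : Opens W.toTopCat) :
    @Continuous _ _ (W.top U) (topSections i j hi ((Opens.map (TopLRS.Hom.base b)).obj U))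
      (lift i j hi a b w U) := by
  have h1 := continuous_iff_le_induced.1 (@Continuous.comp _ _ _ (W.top U) (X.top _) (X.top _) _ _
    (X.continuous_resHom (pre_le_preimage i j hi a b w U)) (TopLRS.Hom.continuous_app a U))
  have h2 := continuous_iff_le_induced.1 (TopLRS.Hom.continuous_app b U)
  refine continuous_iff_le_induced.2 ?_
  rw [topSections, induced_inf, induced_compose, induced_compose]
  exact le_inf h1 h2

/-- The morphism from the glued space induced by a cocone. -/
noncomputable def desc (w : i ≫ a = j ≫ b) : space i j hi ⟶ W :=
  TopLRS.Hom.mk ⟨⟨(TopLRS.Hom.base b : Y.toTopCat ⟶ W.toTopCat), liftNat i j hi a b w⟩,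
    isLocalHom_stalkMap_lift i j hi a b w⟩ (continuous_lift i j hi a b w)

theorem inl_desc (w : i ≫ a = j ≫ b) : inl i j hi ≫ desc i j hi a b w = a := by
  refine TopLRS.hom_ext (TopCat.hom_ext (ContinuousMap.ext (base_apply_eq i j hi a b w)))
    fun U V h h' s => ?_
  exact res_appLE (TopLRS.Hom.hom a) (pre_le_preimage i j hi a b w U) h s

theorem inr_desc (w : i ≫ a = j ≫ b) : inr i j hi ≫ desc i j hi a b w = b :=
  rfl

/-- Morphisms from the glued space are determined by their restrictions to `X` and to `Y`. -/
theorem hom_ext {f g : space i j hi ⟶ W} (hl : inl i j hi ≫ f = inl i j hi ≫ g)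
    (hr : inr i j hi ≫ f = inr i j hi ≫ g) : f = g := by
  have hb : TopLRS.Hom.base f = TopLRS.Hom.base g :=
    congrArg (fun k : Y ⟶ W => TopLRS.Hom.base k) hr
  refine TopLRS.hom_ext hb fun U V h h' s => Subtype.ext (Prod.ext ?_ ?_)
  · have h1 := appLE_congr (congrArg TopLRS.Hom.hom hl) (U := U) (V := pre i j hi V)
      (fun _ hx => h hx) s
    have h2 := appLE_comp (TopLRS.Hom.hom (inl i j hi)) (TopLRS.Hom.hom f) h
      (W := pre i j hi V) le_rfl s
    have h3 := appLE_comp (TopLRS.Hom.hom (inl i j hi)) (TopLRS.Hom.hom g) h'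
      (W := pre i j hi V) le_rfl s
    have h4 := appLE_le_rfl (TopLRS.Hom.hom (inl i j hi)) (appLE (TopLRS.Hom.hom f) h s)
    have h5 := appLE_le_rfl (TopLRS.Hom.hom (inl i j hi)) (appLE (TopLRS.Hom.hom g) h' s)
    exact h4.symm.trans (h2.symm.trans (h1.trans (h3.trans h5)))
  · have h1 := appLE_congr (congrArg TopLRS.Hom.hom hr) (U := U) (V := V) (fun _ hx => h hx) s
    have h2 := appLE_comp (TopLRS.Hom.hom (inr i j hi)) (TopLRS.Hom.hom f) h
      (W := V) le_rfl s
    have h3 := appLE_comp (TopLRS.Hom.hom (inr i j hi)) (TopLRS.Hom.hom g) h'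
      (W := V) le_rfl s
    have h4 := appLE_le_rfl (TopLRS.Hom.hom (inr i j hi)) (appLE (TopLRS.Hom.hom f) h s)
    have h5 := appLE_le_rfl (TopLRS.Hom.hom (inr i j hi)) (appLE (TopLRS.Hom.hom g) h' s)
    exact h4.symm.trans (h2.symm.trans (h1.trans (h3.trans h5)))

theorem isPushout : IsPushout i j (inl i j hi) (inr i j hi) where
  w := inl_comp_eq i j hi
  isColimit' := ⟨Limits.PushoutCocone.IsColimit.mk (inl_comp_eq i j hi)
    (fun s => desc i j hi s.inl s.inr s.condition)
    (fun s => inl_desc i j hi s.inl s.inr s.condition)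
    (fun s => inr_desc i j hi s.inl s.inr s.condition)
    fun s _ hl hr => hom_ext i j hi (hl.trans (inl_desc i j hi s.inl s.inr s.condition).symm)
      (hr.trans (inr_desc i j hi s.inl s.inr s.condition).symm)⟩

end Glue

/-! ### The open immersion into the glued space -/

theorem IsFibreProduct.bijective_left {A R B C : Type*} [CommRing A] [CommRing R] [CommRing B]
    [CommRing C] {a : A →+* R} {b : A →+* B} {u : R →+* C} {v : B →+* C}
    (H : IsFibreProduct a b u v) (hv : Function.Bijective v) : Function.Bijective a := by
  refine ⟨(injective_iff_map_eq_zero a).2 fun x hx => H.inj x hx (hv.injective ?_), fun r => ?_⟩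
  · rw [← H.comm, hx, map_zero, map_zero]
  · obtain ⟨s, hs⟩ := hv.surjective (u r)
    obtain ⟨x, hx, -⟩ := H.exact r s hs.symm
    exact ⟨x, hx⟩

/-- If `B` has the topology induced from `C`, the projection to `B` is continuous for the topology
induced by the projection to `R`. -/
theorem IsFibreProduct.induced_le_induced {A R B C : Type*} [CommRing A] [CommRing R] [CommRing B]
    [CommRing C] {a : A →+* R} {b : A →+* B} {u : R →+* C} {v : B →+* C}
    (H : IsFibreProduct a b u v) {tR : TopologicalSpace R} {tB : TopologicalSpace B}
    {tC : TopologicalSpace C} (hu : Continuous u) (hv : tC.induced v ≤ tB) :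
    tR.induced a ≤ tB.induced b := by
  refine (induced_mono (continuous_iff_le_induced.1 hu)).trans (le_trans ?_ (induced_mono hv))
  rw [induced_compose, induced_compose]
  exact le_of_eq (congrArg (fun g => TopologicalSpace.induced g tC) (funext H.comm))

theorem induced_induced_bot_le {A B C D : Type*} {r : C → D} {v : A → C} {p : A → B} {v' : B → D}
    (h : r ∘ v = v' ∘ p) (hv' : Function.Injective v') :
    ((⊥ : TopologicalSpace D).induced r).induced v ≤ (⊥ : TopologicalSpace B).induced p := by
  rw [induced_compose, h, ← induced_compose]
  let _ : TopologicalSpace D := ⊥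
  have : DiscreteTopology D := ⟨rfl⟩
  let _ := (⊥ : TopologicalSpace D).induced v'
  exact induced_mono
    (DiscreteTopology.of_continuous_injective continuous_induced_dom hv').eq_bot.le

namespace Glue

theorem continuous_toZ {X Y Z : TopLRS.{u}} (i : Z ⟶ X) (j : Z ⟶ Y)
    (hi : IsHomeomorph (TopLRS.Hom.base i)) (U : Opens Y.toTopCat) :
    @Continuous _ _ (X.top (pre i j hi U)) (Z.top ((Opens.map (TopLRS.Hom.base j)).obj U))
      (toZ i j hi U) :=
  @Continuous.comp _ _ _ (X.top _) (Z.top _) (Z.top _) _ _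
    (Z.continuous_resHom (pre_le i j hi U)) (TopLRS.Hom.continuous_app i (pre i j hi U))

variable {X : TopLRS.{u}} {S Y : Scheme.{u}} {i : schemeTop S ⟶ X} {j : S ⟶ Y}
  (hi : IsHomeomorph (TopLRS.Hom.base i))

theorem bijective_ofY (hj : IsOpenImmersion j) {U : Y.Opens} (hU : (U : Set Y) ⊆ Set.range j) :
    Function.Bijective (ofY (schemeTopMap j) U) := by
  have h := bijective_appLE j.toLRSHom hj hU rfl
  have e : (appLE j.toLRSHom le_rfl : _ →+* _) = ofY (schemeTopMap j) U :=
    RingHom.ext fun s => appLE_le_rfl j.toLRSHom s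
  rwa [e] at h

/-- On open subsets of the image of `j`, the topology on the sections of `Y` is coarser than the one
induced from the sections of `S`: both are given by restriction to quasi-compact open subsets. -/
theorem induced_ofY_le (hj : IsOpenImmersion j) {U : Y.Opens} (hU : (U : Set Y) ⊆ Set.range j) :
    ((schemeTop S).top ((Opens.map (TopLRS.Hom.base (schemeTopMap j))).obj U)).induced
      (ofY (schemeTopMap j) U) ≤ (schemeTop Y).top U := by
  refine le_iInf fun V => ?_
  obtain ⟨V, hVU, hV⟩ := V
  let V' : Opens S.toTopCat := (Opens.map (TopLRS.Hom.base (schemeTopMap j))).obj V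
  have hVr (y) (hy : y ∈ V) : y ∈ Set.range j := hU (hVU hy)
  have hVS : IsCompact (V' : Set S.toTopCat) :=
    (j.isOpenEmbedding.isInducing.isCompact_preimage_iff hVr).2 hV
  have hinj := (bijective_ofY hj (U := V) hVr).injective
  refine (induced_mono (iInf_le _ ⟨V', fun x hx => hVU hx, hVS⟩)).trans ?_
  exact induced_induced_bot_le (funext fun s => (ofY_res (schemeTopMap j) hVU s).symm) hinj

/-- Over the image of `j`, the map `B → C` is an isomorphism of topological rings, and hence so is
the projection from the fibre product to `R`. -/
theorem isOpenImmersion_inl (hj : IsOpenImmersion j) :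
    TopLRS.IsOpenImmersion (inl i (schemeTopMap j) hi) := by
  have hq : Topology.IsOpenEmbedding (q i (schemeTopMap j) hi) :=
    j.isOpenEmbedding.comp hi.homeomorph.symm.isOpenEmbedding
  have hr {U : Y.Opens} (hU : (U : Set Y) ⊆ Set.range (q i (schemeTopMap j) hi)) :
      (U : Set Y) ⊆ Set.range j := fun x hx => by
    obtain ⟨x, rfl⟩ := hU hx
    exact ⟨hi.homeomorph.symm x, rfl⟩
  refine ⟨⟨hq, fun V => ?_⟩, fun U hU => le_antisymm inf_le_left (le_inf le_rfl ?_)⟩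
  · refine (ConcreteCategory.isIso_iff_bijective _).2 ?_
    refine (isFibreProduct i (schemeTopMap j) hi (hq.functor.obj V)).bijective_left
      (bijective_ofY hj (hr ?_))
    rintro _ ⟨x, -, rfl⟩
    exact ⟨x, rfl⟩
  · exact (isFibreProduct i (schemeTopMap j) hi U).induced_le_induced
      (tR := X.top (pre i (schemeTopMap j) hi U))
      (continuous_toZ i (schemeTopMap j) hi U) (induced_ofY_le hj (hr hU))

end Glue

/-! ### Affine open subsets of the glued space -/

/-- A formal scheme with a reduced special fibre is covered by affine adic open sets. -/
theorem IsReducedSpecialFibre.exists_isAffineAdicOpen {X : TopLRS.{u}} {S : Scheme.{u}}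
    {i : schemeTop S ⟶ X} (hi : IsReducedSpecialFibre i) (x : X.toTopCat) :
    ∃ U I, x ∈ U ∧ TopLRS.IsAffineAdicOpen i U I := by
  obtain ⟨c, hx, k, hk, hki, hkr⟩ := hi.exists_chart x
  exact ⟨c.opens, _, hx, c.isAffineAdicOpen k hk hki hkr⟩

namespace Glue

variable {X : TopLRS.{u}} {S Y : Scheme.{u}} {i : schemeTop S ⟶ X} {j : S ⟶ Y}

/-- The part of `X` over an affine open subset of `Y` is affine, because its reduction is. -/
theorem exists_isAffineAdicOpen_pre (hX : ∀ c : AffineChart X, c.IsPrincipal)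
    (hi : IsReducedSpecialFibre i) (hj : IsAffineHom j) {U : Y.Opens} (hU : IsAffineOpen U) :
    ∃ ϖ ∈ nonZeroDivisors (X.sec (pre i (schemeTopMap j) hi.isHomeomorph U)),
      TopLRS.IsAffineAdicOpen i (pre i (schemeTopMap j) hi.isHomeomorph U) (Ideal.span {ϖ}) := by
  have h : IsAffineOpen (X := S) ((Opens.map (TopLRS.Hom.base i)).obj
      (pre i (schemeTopMap j) hi.isHomeomorph U)) := by
    rw [← map_base_pre i (schemeTopMap j) hi.isHomeomorph U]
    exact hU.preimage j
  obtain ⟨I, H⟩ := TopLRS.IsAffineAdicOpen.exists_of_isAffineOpen hi.isHomeomorph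
    hi.exists_isAffineAdicOpen h
  exact H.exists_principal hi.isHomeomorph hX

/-- An affine open subset of `Y` is an affine adic open subset of the glued space, with ideal
generated by a nonzerodivisor. -/
theorem exists_isAffineAdicOpen (hX : ∀ c : AffineChart X, c.IsPrincipal)
    (hi : IsReducedSpecialFibre i) (hj : IsAffineHom j) (hjd : IsSchemeTheoreticallyDominant j)
    {U : Y.Opens} (hU : IsAffineOpen U) :
    ∃ w ∈ nonZeroDivisors ((space i (schemeTopMap j) hi.isHomeomorph).sec U),
      TopLRS.IsAffineAdicOpen (inr i (schemeTopMap j) hi.isHomeomorph) U (Ideal.span {w}) := by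
  obtain ⟨ϖ, hϖ, H⟩ := exists_isAffineAdicOpen_pre hX hi hj hU
  have hinj : Function.Injective (ofY (schemeTopMap j) U) := j.app_injective U
  have h0 : ϖ ∈ RingHom.ker (toZ i (schemeTopMap j) hi.isHomeomorph U) :=
    (SetLike.ext_iff.1 ((ker_toZ i (schemeTopMap j) hi.isHomeomorph U).trans H.ker_eq) ϖ).2
      (Ideal.le_radical (Ideal.mem_span_singleton_self ϖ))
  -- `ϖ` vanishes on the reduction, so it defines the element `w = (ϖ, 0)` of the fibre product
  obtain ⟨w, rfl, hw⟩ := (isFibreProduct i (schemeTopMap j) hi.isHomeomorph U).exact ϖ 0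
    (h0.trans (map_zero _).symm)
  exact ⟨w, mem_nonZeroDivisors hi.isHomeomorph hinj hϖ,
    isAffineAdicOpen hi.isHomeomorph hU hinj H rfl hw⟩

end Glue

theorem mainTheorem5 {X : TopLRS.{u}} (hX : IsPrincipalIdealType X)
    (hqc : CompactSpace X.toTopCat) (hqs : QuasiSeparatedSpace X.toTopCat)
    {S Y : Scheme.{u}} (i : schemeTop S ⟶ X) (hi : IsReducedSpecialFibre i)
    (j : S ⟶ Y) (hj : IsOpenImmersion j) (hja : IsAffineHom j)
    (hjd : IsSchemeTheoreticallyDominant j)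
    (D : CartierDivisor Y) (hD : (Set.range j)ᶜ = D.support) :
    IsPrincipalIdealType (Glue.space i (schemeTopMap j) hi.isHomeomorph) ∧
    IsReducedSpecialFibre (Glue.inr i (schemeTopMap j) hi.isHomeomorph) ∧
    TopLRS.IsOpenImmersion (Glue.inl i (schemeTopMap j) hi.isHomeomorph) ∧
    IsAffineMorphism (Glue.inl i (schemeTopMap j) hi.isHomeomorph) ∧
    IsPushout i (schemeTopMap j) (Glue.inl i (schemeTopMap j) hi.isHomeomorph)
      (Glue.inr i (schemeTopMap j) hi.isHomeomorph) := by
  have hid : IsHomeomorph (TopLRS.Hom.base (Glue.inr i (schemeTopMap j) hi.isHomeomorph)) :=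
    IsHomeomorph.id
  have hred : IsReducedSpecialFibre (Glue.inr i (schemeTopMap j) hi.isHomeomorph) := by
    refine ⟨hid, fun y => ?_⟩
    obtain ⟨_, ⟨U, hU, rfl⟩, hy, -⟩ := Y.isBasis_affineOpens.exists_subset_of_mem_open
      (Set.mem_univ (y : Y)) isOpen_univ
    obtain ⟨w, -, H⟩ := Glue.exists_isAffineAdicOpen hX.2 hi hja hjd hU
    obtain ⟨c, hc, -, k, hk⟩ := H.exists_chart hid
    exact ⟨c, hc.symm.subset hy, k, hk⟩
  have haff (c : AffineChart (Glue.space i (schemeTopMap j) hi.isHomeomorph)) :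
      IsAffineOpen (X := Y) c.opens :=
    c.isAffineOpen (Glue.inr i (schemeTopMap j) hi.isHomeomorph) hid
  refine ⟨⟨fun y => ?_, fun c => ?_⟩, hred, Glue.isOpenImmersion_inl hi.isHomeomorph hj,
    fun c => ?_, Glue.isPushout i (schemeTopMap j) hi.isHomeomorph⟩
  · obtain ⟨c, hc, -⟩ := hred.exists_chart y
    exact ⟨c, hc⟩
  · obtain ⟨w, hw, H⟩ := Glue.exists_isAffineAdicOpen hX.2 hi hja hjd (haff c)
    exact c.isPrincipal_of_isAdicOpen hw H.toIsAdicOpen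
  · obtain ⟨ϖ, -, H⟩ := Glue.exists_isAffineAdicOpen_pre hX.2 hi hja (haff c)
    obtain ⟨d, hd, -⟩ := H.exists_chart hi.isHomeomorph
    exact ⟨d, hd⟩
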